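/- A literal is a propositional variable or its negation, a clause is a finite list of literals, a formula $F$ is a finite list of clauses, and $n$ is the number of variables that occur in $F$. An x-model of $F$ is a truth assignment to these $n$ variables under which every clause of $F$ contains exactly one true literal. Max Hamming XSAT asks for the maximum Hamming distance between two (not necessarily distinct) x-models of $F$; the answer is $\bot$ if $F$ has no x-model. Let $Q$ be the following recursive algorithm. For each remaining variable $a$ (initially, every variable) it stores the maximum number of variables linked to $a$ (including $a$) on which two x-models $M,M'$ can differ in each of the cases "$a$ is true under both", "$a$ is false under both", "$a$ has different values"; $\bot$ marks an excluded case. 1. Simplify as long as possible: propagate forced values (unit clauses, and clauses in which a variable occurs twice); list each clause only once; if two variables of a clause occur in no other clause, remove one of them and link it to the other; for a clause $(a\lor b)$ substitute $\bar b$ for $a$ and link $a$ to $b$; remove a variable that occurs in no clause, or whose value has been fixed, and record its contribution. 2. If there is an empty clause, return $\bot$. If there are no clauses, return the recorded number. If $F$ is not connected, return the recorded number plus the sum of the answers for the connected components. 3. Otherwise take a longest clause $w=(a_1\lor\dots\lor a_k)$, where the variables of $a_1,a_2$ occur in at least two clauses. Return the maximum of the answers for: $a_1$ true under both models; $a_1$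 false under both models; and, for each $i=2,\dots,k$, $F(a_1/\bar a_i)$ with $a_1$ and $a_i$ having different values under the two models. If $k=4$, the answer for "$a_1$ false under both" is computed as the maximum of the answers for $a_1$ false under both together with, respectively: $a_2$ true under both; $a_2$ false under both; $F(a_2/\bar a_3)$ with $a_2,a_3$ having different values; $F(a_2/\bar a_4)$ with $a_2,a_4$ having different values. Time is the number of elementary steps under the uniform cost criterion. Space is the maximum number of memory cells in use at any time, where the memory used by a recursive call is released when it returns. $|F|$ denotes the number of clauses plus the number of literal occurrences of $F$. **Theorem.** $Q$ solves max Hamming XSAT, that is, $Q(F)$ is the correct answer for every formula $F$. It runs in polynomial space: the space used on $F$ is at most $p(|F|)$ for some polynomial $p$. It runs in time $O(1.8348^n)$: there is a polynomial $p$ such that the time used on $F$ is at most $p(|F|)\cdot 1.8348^n$ for every formula $F$; and for every polynomial $q$ there is a constant $C$ such that the time is at most $C\cdot 1.8348^n$ for all formulas $F$ with $|F|\le q(n)$. -/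

import Mathlib

/-! ## Formulas, x-models and the problem -/

namespace MaxHammingXSAT

/-- The literal `p` (if `pos = true`) or its negation (if `pos = false`), where `p` is the
propositional variable named `var`. -/
structure Literal where
  var : ℕ
  pos : Bool

/-- Flipping a literal. -/
def Literal.neg (l : Literal) : Literal := ⟨l.var, !l.pos⟩

/-- A clause, a list of literals; its length is the number of literals in it. -/
abbrev Clause := List Literal

/-- A formula, given by a list of its clauses. -/
abbrev Formula := List Clause

/-- `Var(F)`: the variables appearing in a clause of `F`. -/
def varSet (F : Formula) : Finset ℕ := (F.flatten.map Literal.var).toFinset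

/-- The number `n` of variables of `F`. -/
def numVars (F : Formula) : ℕ := (varSet F).card

/-- The size of the input: one cell per clause and one per literal occurrence. -/
def inputSize (F : Formula) : ℕ := (F.map fun c => c.length + 1).sum

/-- Assignments to the variables of `F`. -/
abbrev Assignment (F : Formula) := {v : ℕ // v ∈ varSet F} → Bool

/-- The value of a literal; every literal occurring in `F` is derived from a variable of `F`,
so the second case is irrelevant. -/
def Literal.holds {F : Formula} (M : Assignment F) (l : Literal) : Bool :=
  if h : l.var ∈ varSet F then M ⟨l.var, h⟩ == l.pos else false

/-- `M` is an x-model of `F`: there is exactly one true literal in every clause. -/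
def IsXModel (F : Formula) (M : Assignment F) : Prop :=
  ∀ c ∈ F, c.countP (fun l => l.holds M) = 1

open Classical in
/-- The answer of max Hamming XSAT: the maximum Hamming distance between any two x-models of `F`,
and `⊥` if `F` has no x-model. -/
noncomputable def maxHammingDistance (F : Formula) : WithBot ℕ :=
  (Finset.univ.filter fun p : Assignment F × Assignment F =>
    IsXModel F p.1 ∧ IsXModel F p.2).sup fun p => ((hammingDist p.1 p.2 : ℕ) : WithBot ℕ)

/-! ## The cost model

Programs are written in a monad that counts elementary steps (uniform cost).  One step is a bounded
number of the following: taking apart or building one node of a list, a record or a pair,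
comparing two variable names or signs, adding or comparing two numbers.  A step allocates at most
one (constant size) block of memory.  Memory is released only when the procedure call that
allocated it returns. -/

/-- The result of a run, the number of steps, the number of memory blocks still allocated at its
end, and the maximal number of blocks allocated at any time. -/
structure Run (α : Type) where
  val : α
  time : ℕ
  kept : ℕ
  peak : ℕ

instance : Monad Run where
  pure a := ⟨a, 0, 0, 0⟩
  bind x f :=
    { val := (f x.val).val
      time := x.time + (f x.val).time
      kept := x.kept + (f x.val).kept
      peak := max x.peak (x.kept + (f x.val).peak) }

/-- One elementary step. -/
def tick : Run Unit := ⟨(), 1, 1, 1⟩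

/-- A procedure call that returns a single number (or `⊥`): upon return all the memory it has used
is released, except for the block holding the returned number. -/
def call (x : Run (WithBot ℕ)) : Run (WithBot ℕ) := ⟨x.val, x.time + 1, 1, x.peak + 1⟩

/-! ## Elementary list programs -/

/-- Length of a list. -/
def len {α : Type} : List α → Run ℕ
  | [] => do tick; pure 0
  | _ :: xs => do tick; let n ← len xs; pure (n + 1)

/-- Concatenation. -/
def append {α : Type} : List α → List α → Run (List α)
  | [], ys => do tick; pure ys
  | x :: xs, ys => do tick; let zs ← append xs ys; pure (x :: zs)

/-- The first element with property `p`, together with all the other elements. -/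
def pick {α : Type} (p : α → Run Bool) : List α → Run (Option (α × List α))
  | [] => do tick; pure none
  | x :: xs => do
    tick
    if ← p x then pure (some (x, xs))
    else
      match ← pick p xs with
      | none => pure none
      | some (y, ys) => pure (some (y, x :: ys))

/-- The elements with property `p`, and those without. -/
def separate {α : Type} (p : α → Run Bool) : List α → Run (List α × List α)
  | [] => do tick; pure ([], [])
  | x :: xs => do
    tick
    let b ← p x
    let r ← separate p xs
    if b then pure (x :: r.1, r.2) else pure (r.1, x :: r.2)

/-- The first literal of a clause that is derived from the variable `v`. -/
def findVar (v : ℕ) : Clause → Run (Option Literal)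
  | [] => do tick; pure none
  | l :: c => do tick; if l.var = v then pure (some l) else findVar v c

/-- Is the literal `l` in the clause? -/
def hasLit (l : Literal) : Clause → Run Bool
  | [] => do tick; pure false
  | m :: c => do
    tick
    if m.var = l.var ∧ m.pos = l.pos then pure true else hasLit l c

/-- Delete the first occurrence of the literal `l`. -/
def removeFirst (l : Literal) : Clause → Run Clause
  | [] => do tick; pure []
  | m :: c => do
    tick
    if m.var = l.var ∧ m.pos = l.pos then pure c
    else do let r ← removeFirst l c; pure (m :: r)

/-- Delete all occurrences of the literal `l`. -/
def removeAll (l : Literal) : Clause → Run Clause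
  | [] => do tick; pure []
  | m :: c => do
    tick
    let r ← removeAll l c
    if m.var = l.var ∧ m.pos = l.pos then pure r else pure (m :: r)

/-- The degree of `v`: the number of clauses that contain a literal derived from `v`. -/
def degree (v : ℕ) : List Clause → Run ℕ
  | [] => do tick; pure 0
  | c :: cs => do
    tick
    let r ← findVar v c
    let d ← degree v cs
    match r with
    | none => pure d
    | some _ => pure (d + 1)

/-- Is the variable of `l` a singleton of the formula `cs`? -/
def isSingleton (cs : List Clause) (l : Literal) : Run Bool := do
  tick; let d ← degree l.var cs; pure (decide (d = 1))

/-- Two literals of the clause that are derived from the same variable, if there are any. -/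
def repeated : Clause → Run (Option (Literal × Literal))
  | [] => do tick; pure none
  | l :: c => do
    tick
    match ← findVar l.var c with
    | some m => pure (some (l, m))
    | none => repeated c

/-- Is every literal of the first clause in the second? -/
def subClause : Clause → Clause → Run Bool
  | [], _ => do tick; pure true
  | l :: c, d => do
    tick
    if ← hasLit l d then subClause c d else pure false

/-- Do the clauses consist of the same literals? -/
def sameClause (c d : Clause) : Run Bool := do
  tick; let a ← subClause c d; let b ← subClause d c; pure (a && b)

/-! ## Instances of the branching algorithm

Variables get removed during the execution: a variable is assigned a value, or found to be dual to
another variable (and then linked to that variable), or is a superfluous singleton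
(and then linked to another singleton).  For each remaining variable `a`, the numbers needed
about the variables linked to it (`a` itself included) are kept in a record. -/

/-- The maximum number of variables linked to `a`, including `a`, that can have different
values under two models `M` and `M'` if `a` is true under both (`tt`), if `a` is false under both
(`ff`), if `a` has different values (`df`); `⊥` marks a case that is excluded. -/
structure Gain where
  tt : WithBot ℕ
  ff : WithBot ℕ
  df : WithBot ℕ

/-- Exchange the roles of a variable and its negation if `l` is a negated variable.  So, if `g` is
the record of the variable of `l`, then this is the record for `l`, and conversely. -/
def Gain.orient (l : Literal) (g : Gain) : Gain := if l.pos then g else ⟨g.ff, g.tt, g.df⟩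

/-- A formula, its variables with their records, and the number of differing variables collected
from variables that have been assigned a value. -/
structure State where
  clauses : List Clause
  live : List (ℕ × Gain)
  acc : WithBot ℕ

/-- The record of a variable. -/
def getGain (v : ℕ) : List (ℕ × Gain) → Run Gain
  | [] => do tick; pure ⟨⊥, ⊥, ⊥⟩
  | (u, g) :: xs => do tick; if u = v then pure g else getGain v xs

/-- Replace the record of a variable. -/
def setGain (v : ℕ) (g : Gain) : List (ℕ × Gain) → Run (List (ℕ × Gain))
  | [] => do tick; pure []
  | (u, h) :: xs => do
    tick
    if u = v then pure ((u, g) :: xs)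
    else do let ys ← setGain v g xs; pure ((u, h) :: ys)

/-- Remove a variable. -/
def dropVar (v : ℕ) : List (ℕ × Gain) → Run (List (ℕ × Gain))
  | [] => do tick; pure []
  | (u, h) :: xs => do
    tick
    if u = v then pure xs
    else do let ys ← dropVar v xs; pure ((u, h) :: ys)

/-! ## Substitution -/

/-- Put in front of `cs`, for each literal `m` of the clause, the unit clause saying that `m` is
false. -/
def negUnits : Clause → List Clause → Run (List Clause)
  | [], cs => do tick; pure cs
  | m :: c, cs => do tick; let r ← negUnits c cs; pure ([m.neg] :: r)

/-- The same if the value of `l` is known to be true: literals derived from the variable of `l`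
are evaluated, and the empty clause is added if one of them is true. -/
def negUnitsOf (l : Literal) : Clause → List Clause → Run (List Clause)
  | [], cs => do tick; pure cs
  | m :: c, cs => do
    tick
    let r ← negUnitsOf l c cs
    if m.var = l.var then
      if m.pos = l.pos then pure ([] :: r) else pure r
    else pure ([m.neg] :: r)

/-- Replace `l` by true in all clauses: all other literals of a clause with `l` are false, and
the negation of `l` is deleted from the other clauses. -/
def assignClauses (l : Literal) : List Clause → Run (List Clause)
  | [] => do tick; pure []
  | c :: cs => do
    tick
    let r ← assignClauses l cs
    if ← hasLit l c then
      let d ← removeFirst l c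
      negUnitsOf l d r
    else
      let d ← removeAll l.neg c
      pure (d :: r)

/-- `F(l/true)`, where `l` is to be true under both models.  (Propagation is left to `simplify`.)
-/
def assign (l : Literal) (s : State) : Run State := do
  tick
  let g ← getGain l.var s.live
  let live ← dropVar l.var s.live
  let cs ← assignClauses l s.clauses
  pure ⟨cs, live, s.acc + (g.orient l).tt⟩

/-- Replace the literal `l` by the literal `m` (and `l.neg` by `m.neg`) in a clause. -/
def substClause (l m : Literal) : Clause → Run Clause
  | [] => do tick; pure []
  | x :: c => do
    tick
    let r ← substClause l m c
    if x.var = l.var then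
      if x.pos = l.pos then pure (m :: r) else pure (m.neg :: r)
    else pure (x :: r)

/-- Replace the literal `l` by the literal `m` in all clauses. -/
def substClauses (l m : Literal) : List Clause → Run (List Clause)
  | [] => do tick; pure []
  | c :: cs => do
    tick; let d ← substClause l m c; let r ← substClauses l m cs; pure (d :: r)

/-- `F(l/m.neg)`; the variable of `l` gets linked to the variable of `m`. -/
def link (l m : Literal) (s : State) : Run State := do
  tick
  let gl ← getGain l.var s.live
  let gm ← getGain m.var s.live
  let a := gl.orient l
  let b := gm.orient m
  let g : Gain := ⟨b.tt + a.ff, b.ff + a.tt, b.df + a.df⟩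
  let live ← dropVar l.var s.live
  let live ← setGain m.var (g.orient m) live
  let cs ← substClauses l m.neg s.clauses
  pure ⟨cs, live, s.acc⟩

/-- `F(l/m.neg)`, where `l` (and hence `m`) is to have different values under the two models. -/
def linkDiffer (l m : Literal) (s : State) : Run State := do
  tick
  let s ← link l m s
  let g ← getGain m.var s.live
  let live ← setGain m.var ⟨⊥, ⊥, g.df⟩ s.live
  pure ⟨s.clauses, live, s.acc⟩

/-! ## Simplification -/

/-- Does the clause have at most two literals, or two literals derived from the same variable? -/
def isReducible (c : Clause) : Run Bool := do
  tick
  let n ← len c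
  let r ← repeated c
  pure (decide (n ≤ 2) || r.isSome)

/-- The formula is a set of clauses: find a clause that is listed twice and list it once less. -/
def dropDuplicate : List Clause → Run (Option (List Clause))
  | [] => do tick; pure none
  | c :: cs => do
    tick
    match ← pick (sameClause c) cs with
    | some _ => pure (some cs)
    | none =>
      match ← dropDuplicate cs with
      | none => pure none
      | some r => pure (some (c :: r))

/-- Does the clause have two singletons? -/
def hasTwoSingletons (cs : List Clause) (c : Clause) : Run Bool := do
  tick
  let r ← separate (isSingleton cs) c
  let n ← len r.1
  pure (decide (2 ≤ n))

/-- If `l` and `m` are singletons of the same clause `c` (and `cs` are the other clauses), remove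
`m`; then `l` stands for `l` or `m` being true. -/
def mergeSingletons (l m : Literal) (c : Clause) (cs : List Clause) (s : State) : Run State := do
  tick
  let gl ← getGain l.var s.live
  let gm ← getGain m.var s.live
  let a := gl.orient l
  let b := gm.orient m
  let g : Gain :=
    ⟨max (max (a.tt + b.ff) (a.ff + b.tt)) (a.df + b.df),
     a.ff + b.ff,
     max (a.df + b.ff) (a.ff + b.df)⟩
  let live ← dropVar m.var s.live
  let live ← setGain l.var (g.orient l) live
  let d ← removeFirst m c
  pure ⟨d :: cs, live, s.acc⟩

/-- Is the degree of the variable 0? -/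
def isFree (cs : List Clause) (x : ℕ × Gain) : Run Bool := do
  tick; let d ← degree x.1 cs; pure (decide (d = 0))

/-- A simplification of a clause `c` with at most two literals or with two literals derived from
the same variable (`cs` are the other clauses); `none` if `c` is empty. -/
def reduceClause (c : Clause) (cs : List Clause) (s : State) : Run (Option State) := do
  tick
  match ← repeated c with
  | some (l, m) =>
    if l.pos = m.pos then
      let t ← assign l.neg s
      pure (some t)
    else
      let d ← removeFirst l c
      let d ← removeFirst m d
      let r ← negUnits d cs
      pure (some ⟨r, s.live, s.acc⟩)
  | none =>
    match c with
    | [l] => let t ← assign l s; pure (some t)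
    | [l, m] => let t ← link l m ⟨cs, s.live, s.acc⟩; pure (some t)
    | _ => pure none

/-- One simplification; `none` if the formula has an empty clause or nothing can be simplified. -/
def simplifyStep (s : State) : Run (Option State) := do
  tick
  match ← pick isReducible s.clauses with
  | some (c, cs) => reduceClause c cs s
  | none =>
    match ← dropDuplicate s.clauses with
    | some cs => pure (some ⟨cs, s.live, s.acc⟩)
    | none =>
      match ← pick (hasTwoSingletons s.clauses) s.clauses with
      | some (c, cs) =>
        match (← separate (isSingleton s.clauses) c).1 with
        | l :: m :: _ => let t ← mergeSingletons l m c cs s; pure (some t)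
        | _ => pure none
      | none =>
        match ← pick (isFree s.clauses) s.live with
        | some ((_, g), live) => pure (some ⟨s.clauses, live, s.acc + max (max g.tt g.ff) g.df⟩)
        | none => pure none

/-- Perform up to the given number of simplifications. -/
def simplifyLoop : ℕ → State → Run State
  | 0, s => do tick; pure s
  | k + 1, s => do
    tick
    match ← simplifyStep s with
    | none => pure s
    | some t => simplifyLoop k t

/-- The number of literal occurrences. -/
def countLits : List Clause → Run ℕ
  | [] => do tick; pure 0
  | c :: cs => do tick; let n ← len c; let k ← countLits cs; pure (n + k)

/-- Simplify as long as possible (every simplification decreases the number of literal occurrences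
plus the number of variables). -/
def simplify (s : State) : Run State := do
  tick
  let n ← len s.live
  let k ← countLits s.clauses
  simplifyLoop (n + k + 1) s

/-! ## Connected components -/

/-- Do the two clauses have a variable in common? -/
def meets : Clause → Clause → Run Bool
  | [], _ => do tick; pure false
  | l :: c, d => do
    tick
    match ← findVar l.var d with
    | some _ => pure true
    | none => meets c d

/-- Does the clause have a variable in common with one of the clauses `cs`? -/
def meetsAny (cs : List Clause) (c : Clause) : Run Bool := do
  tick
  match ← pick (meets c) cs with
  | some _ => pure true
  | none => pure false

/-- Move clauses of the second list to the first one as long as they have variables in common. -/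
def grow : ℕ → List Clause → List Clause → Run (List Clause × List Clause)
  | 0, ins, outs => do tick; pure (ins, outs)
  | k + 1, ins, outs => do
    tick
    let r ← separate (meetsAny ins) outs
    match r.1 with
    | [] => pure (ins, outs)
    | near => let ins ← append near ins; grow k ins r.2

/-- The connected components, as lists of clauses; the first argument is a bound for their
number. -/
def components : ℕ → List Clause → Run (List (List Clause))
  | 0, _ => do tick; pure []
  | _ + 1, [] => do tick; pure []
  | k + 1, c :: cs => do
    tick
    let n ← len cs
    let r ← grow n [c] cs
    let rest ← components k r.2
    pure (r.1 :: rest)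

/-- The components as instances of their own. -/
def toStates (live : List (ℕ × Gain)) : List (List Clause) → Run (List State)
  | [] => do tick; pure []
  | cs :: ds => do
    tick
    let r ← separate (isFree cs) live
    let rest ← toStates live ds
    pure (⟨cs, r.2, 0⟩ :: rest)

/-! ## The algorithm Q -/

/-- Is the clause empty? -/
def isEmptyClause : Clause → Run Bool
  | [] => do tick; pure true
  | _ :: _ => do tick; pure false

/-- A longest one among the given clauses. -/
def longest : Clause → List Clause → Run Clause
  | c, [] => do tick; pure c
  | c, d :: ds => do
    tick
    let m ← len c
    let n ← len d
    if m < n then longest d ds else longest c ds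

/-- The sum of the answers of a recursive procedure for several instances. -/
def sumAnswers (rec : State → Run (WithBot ℕ)) : List State → Run (WithBot ℕ)
  | [] => do tick; pure 0
  | s :: ss => do
    tick
    let a ← call (rec s)
    let b ← sumAnswers rec ss
    pure (a + b)

/-- The maximum of the answers for `F(a/m.neg)`, `a` having different values, over several
literals `m`. -/
def differAnswers (rec : State → Run (WithBot ℕ)) (a : Literal) (s : State) :
    List Literal → Run (WithBot ℕ)
  | [] => do tick; pure ⊥
  | m :: ms => do
    tick
    let t ← linkDiffer a m s
    let x ← call (rec t)
    let y ← differAnswers rec a s ms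
    pure (max x y)

/-- The answer in case that `a₁` is false under both models, where the other literals of the chosen
clause are `rest`; clauses of length 4 are handled specially. -/
def falseAnswer (rec : State → Run (WithBot ℕ)) (a₁ : Literal) (rest : Clause) (s : State) :
    Run (WithBot ℕ) := do
  tick
  let s₀ ← assign a₁.neg s
  match rest with
  | [a₂, a₃, a₄] =>
    let s₁ ← assign a₂ s₀
    let x₁ ← call (rec s₁)
    let s₂ ← assign a₂.neg s₀
    let x₂ ← call (rec s₂)
    let x₃ ← differAnswers rec a₂ s₀ [a₃, a₄]
    pure (max (max x₁ x₂) x₃)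
  | _ => call (rec s₀)

/-- Branching on the clause `w`, whose non-singletons are listed first. -/
def branch (rec : State → Run (WithBot ℕ)) (w : Clause) (s : State) : Run (WithBot ℕ) := do
  tick
  match w with
  | [] => pure ⊥
  | a₁ :: rest =>
    let s₁ ← assign a₁ s
    let x₁ ← call (rec s₁)
    let x₂ ← falseAnswer rec a₁ rest s
    let x₃ ← differAnswers rec a₁ s rest
    pure (max (max x₁ x₂) x₃)

/-- The recursive procedure.  The first argument bounds the depth of the recursion. -/
def solve : ℕ → State → Run (WithBot ℕ)
  | 0, _ => do tick; pure ⊥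
  | k + 1, s => do
    tick
    let s ← simplify s
    match ← pick isEmptyClause s.clauses with
    | some _ => pure ⊥
    | none =>
      match s.clauses with
      | [] => pure s.acc
      | c :: cs =>
        let n ← len s.clauses
        match ← components n s.clauses with
        | d₁ :: d₂ :: ds =>
          let ts ← toStates s.live (d₁ :: d₂ :: ds)
          let x ← sumAnswers (solve k) ts
          pure (s.acc + x)
        | _ =>
          let w ← longest c cs
          let r ← separate (isSingleton s.clauses) w
          let w ← append r.2 r.1
          branch (solve k) w s

/-- Add the variables of a clause to the list of variables; at the beginning no variable is linked
to another one. -/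
def addVars : Clause → List (ℕ × Gain) → Run (List (ℕ × Gain))
  | [], live => do tick; pure live
  | l :: c, live => do
    tick
    match ← pick (fun x : ℕ × Gain => do tick; pure (decide (x.1 = l.var))) live with
    | some _ => addVars c live
    | none => addVars c ((l.var, ⟨0, 0, 1⟩) :: live)

/-- The list of the variables of a formula. -/
def allVars : List Clause → List (ℕ × Gain) → Run (List (ℕ × Gain))
  | [], live => do tick; pure live
  | c :: cs, live => do tick; let r ← addVars c live; allVars cs r

/-- The algorithm `Q`.  Each recursive call has fewer variables, so the number of variables plus 1
bounds the depth of the recursion. -/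
def Q (F : Formula) : Run (WithBot ℕ) := do
  tick
  let live ← allVars F []
  let n ← len live
  call (solve (n + 1) ⟨F, live, 0⟩)

end MaxHammingXSAT

namespace MaxHammingXSAT

/-! ## Runs: values and costs -/

/-! Correctness. Models are assignments to all natural numbers, and an answer is characterised by
its upper bounds: `IsValue s a` says that the bounds for `total` over all pairs of models are
exactly the elements above `a`. A simplification does not change the set of upper bounds
(`Simp.ub`). Branching replaces it by the intersection over the branches (`branch_ub`): if the
chosen literal `a` differs between two models, then the model in which it is false has another true
literal `m` of the clause, and `a` and `m` are complementary under both. Pieces without common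
variables can be solved separately, and the answers add up (`components_value`). At the start
`total` is the Hamming distance (`eq_maxHammingDistance`).

Space. A call gives back its memory, so one level of the recursion needs polynomially many blocks of
its own plus the maximum over its calls (`Track`), and the depth is bounded by the number of
variables plus one.

Time. Let ζ be `zeta`. The weight `wt t` is ζ⁻ᵐ, where m variables remain after simplifying `t`, and
0 if simplification ends in a contradiction. The weights of the branches sum to at most ζ⁻ᵐ, where m
is the number of variables of the branching instance (`Chosen.weight`), and so do the bounds for
components (`sum_inv_zeta_pow_le`). Hence `solve_solvesBelow` bounds the time by a polynomial plus a
polynomial multiple of the weight.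

To count the variables that a branch eliminates, the order of propagation is not traced. The branch
and all later simplifications compose to one substitution φ (`Simp.subst`, `Subst.comp`). If no
contradiction results, every original clause is identically satisfied under φ, or at least three
literals of distinct variables remain of it and none of its literals is true (`Resolves`). So a
clause with a true literal has only false ones besides, a clause with two complementary literals
likewise, and a clause with two literals left makes these complementary. `Resolves.count` turns such
facts into numbers of eliminated variables.

For a clause with k + 1 ≥ 5 literals, ζ + ζᵏ⁺¹ + kζᵏ ≤ 1 suffices. For three or four literals,
another clause through the first literal, and if necessary one through the second, yields additional
eliminations (`three_forces`, `four_forces`). The critical case has four literals, the first two of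
which occur in clauses with three new variables each; it requires 2ζ⁷ + 6ζ³ ≤ 1. The choice ζ =
0.54502 satisfies this, and ζ⁻¹ < 1.8348 is strict, which leaves room for absorbing polynomial
factors. -/

@[simp] theorem pure_val {α : Type} (a : α) : (pure a : Run α).val = a := rfl

@[simp] theorem bind_val {α β : Type} (x : Run α) (f : α → Run β) :
    (x >>= f).val = (f x.val).val := rfl

@[simp] theorem call_val (x : Run (WithBot ℕ)) : (call x).val = x.val := rfl

/-- Time, kept memory and peak memory of a run are all at most `b`. -/
structure Cost {α : Type} (r : Run α) (b : ℕ) : Prop where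
  time : r.time ≤ b
  kept : r.kept ≤ b
  peak : r.peak ≤ b

namespace Cost

variable {α β : Type}

theorem mono {r : Run α} {a b : ℕ} (h : Cost r a) (hab : a ≤ b) : Cost r b :=
  ⟨h.time.trans hab, h.kept.trans hab, h.peak.trans hab⟩

theorem pure (a : α) (b : ℕ) : Cost (Pure.pure a : Run α) b :=
  ⟨Nat.zero_le _, Nat.zero_le _, Nat.zero_le _⟩

/-- Memory is kept until the enclosing call returns, so the peak of the second run is added to what
the first one keeps. A single number can therefore bound time, kept memory and peak together. -/
theorem bind {x : Run α} {f : α → Run β} {a b : ℕ} (hx : Cost x a) (hf : Cost (f x.val) b) :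
    Cost (x >>= f) (a + b) := by
  refine ⟨add_le_add hx.time hf.time, add_le_add hx.kept hf.kept, ?_⟩
  exact max_le (hx.peak.trans (Nat.le_add_right _ _)) (add_le_add hx.kept hf.peak)

theorem bind_pure {x : Run α} {f : α → β} {a : ℕ} (hx : Cost x a) :
    Cost (x >>= fun y => Pure.pure (f y)) a :=
  (hx.bind (f := fun y => Pure.pure (f y)) (Cost.pure (f x.val) 0)).mono le_rfl

theorem tick : Cost tick 1 := ⟨le_rfl, le_rfl, le_rfl⟩

theorem tick_bind {f : Unit → Run β} {b : ℕ} (hf : Cost (f ()) b) :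
    Cost (MaxHammingXSAT.tick >>= f) (1 + b) := tick.bind hf

theorem tick_pure (a : β) {b : ℕ} (hb : 1 ≤ b) :
    Cost (MaxHammingXSAT.tick >>= fun _ => Pure.pure a) b :=
  (tick_bind (Cost.pure a 0)).mono hb

end Cost

/-! ## Lists -/

section Lists

variable {α : Type}

@[simp] theorem len_val (xs : List α) : (len xs).val = xs.length := by
  induction xs with
  | nil => rfl
  | cons x xs ih => simp [len, ih]

theorem len_cost (xs : List α) : Cost (len xs) (xs.length + 1) := by
  induction xs with
  | nil => exact Cost.tick_pure _ le_rfl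
  | cons x xs ih =>
    exact (Cost.tick_bind ih.bind_pure).mono (by simp; omega)

@[simp] theorem append_val (xs ys : List α) : (append xs ys).val = xs ++ ys := by
  induction xs with
  | nil => rfl
  | cons x xs ih => simp [append, ih]

theorem append_cost (xs ys : List α) : Cost (append xs ys) (xs.length + 1) := by
  induction xs with
  | nil => exact Cost.tick_pure _ le_rfl
  | cons x xs ih =>
    exact (Cost.tick_bind ih.bind_pure).mono (by simp; omega)

theorem pick_none {p : α → Run Bool} {xs : List α} (h : (pick p xs).val = none) :
    ∀ x ∈ xs, (p x).val = false := by
  induction xs with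
  | nil => simp
  | cons x xs ih =>
    simp only [pick, bind_val] at h
    cases hp : (p x).val
    · simp only [hp, Bool.false_eq_true, if_false, bind_val] at h
      cases hr : (pick p xs).val with
      | none => simpa [hp] using ih hr
      | some r => simp [hr] at h
    · simp [hp] at h

theorem pick_some {p : α → Run Bool} {xs ys : List α} {y : α}
    (h : (pick p xs).val = some (y, ys)) :
    (p y).val = true ∧ ∃ l r, xs = l ++ y :: r ∧ ys = l ++ r := by
  induction xs generalizing ys with
  | nil => simp [pick] at h
  | cons x xs ih =>
    simp only [pick, bind_val] at h
    cases hp : (p x).val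
    · simp only [hp, Bool.false_eq_true, if_false, bind_val] at h
      cases hr : (pick p xs).val with
      | none => simp [hr] at h
      | some r =>
        obtain ⟨z, zs⟩ := r
        simp only [hr, pure_val, Option.some.injEq, Prod.mk.injEq] at h
        obtain ⟨rfl, rfl⟩ := h
        obtain ⟨h1, l, r, h2, h3⟩ := ih hr
        exact ⟨h1, x :: l, r, by simp [h2], by simp [h3]⟩
    · simp only [hp, if_true, pure_val, Option.some.injEq, Prod.mk.injEq] at h
      obtain ⟨rfl, rfl⟩ := h
      exact ⟨hp, [], xs, by simp⟩

theorem pick_some_perm {p : α → Run Bool} {xs ys : List α} {y : α}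
    (h : (pick p xs).val = some (y, ys)) : (p y).val = true ∧ xs.Perm (y :: ys) := by
  obtain ⟨h1, l, r, rfl, rfl⟩ := pick_some h
  exact ⟨h1, List.perm_middle⟩

theorem pick_cost {p : α → Run Bool} {xs : List α} {K : ℕ} (h : ∀ x ∈ xs, Cost (p x) K) :
    Cost (pick p xs) ((K + 1) * xs.length + 1) := by
  induction xs with
  | nil => exact Cost.tick_pure _ (by simp)
  | cons x xs ih =>
    have ih := ih fun y hy => h y (by simp [hy])
    refine (Cost.tick_bind (b := K + ((K + 1) * xs.length + 1)) ?_).mono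
      (by simp only [List.length_cons]; ring_nf; omega)
    refine (h x (by simp)).bind ?_
    split
    · exact Cost.pure _ _
    · refine (ih.bind (b := 0) ?_).mono le_rfl
      split <;> exact Cost.pure _ _

@[simp] theorem separate_val (p : α → Run Bool) (xs : List α) :
    (separate p xs).val =
      (xs.filter fun x => (p x).val, xs.filter fun x => !(p x).val) := by
  induction xs with
  | nil => rfl
  | cons x xs ih =>
    simp only [separate, bind_val, ih]
    cases hp : (p x).val <;> simp [hp]

theorem separate_cost {p : α → Run Bool} {xs : List α} {K : ℕ} (h : ∀ x ∈ xs, Cost (p x) K) :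
    Cost (separate p xs) ((K + 1) * xs.length + 1) := by
  induction xs with
  | nil => exact Cost.tick_pure _ (by simp)
  | cons x xs ih =>
    have ih := ih fun y hy => h y (by simp [hy])
    refine (Cost.tick_bind (b := K + (((K + 1) * xs.length + 1) + 0)) ?_).mono
      (by simp only [List.length_cons]; ring_nf; omega)
    refine (h x (by simp)).bind (ih.bind ?_)
    split <;> exact Cost.pure _ _

end Lists

/-! ## Literals and clauses -/

theorem Literal.ext_iff' {l m : Literal} : l = m ↔ l.var = m.var ∧ l.pos = m.pos := by
  cases l; cases m; simp

instance : DecidableEq Literal := fun _ _ => decidable_of_iff' _ Literal.ext_iff'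

@[simp] theorem Literal.neg_var (l : Literal) : l.neg.var = l.var := rfl

@[simp] theorem Literal.neg_pos (l : Literal) : l.neg.pos = !l.pos := rfl

@[simp] theorem Literal.neg_neg (l : Literal) : l.neg.neg = l := by
  simp [Literal.ext_iff']

theorem Literal.neg_ne (l : Literal) : l.neg ≠ l := by
  simp [Literal.ext_iff']

theorem Literal.eq_or_eq_neg {l m : Literal} (h : l.var = m.var) : l = m ∨ l = m.neg := by
  cases l with | mk v p => cases m with | mk u q =>
  simp only [Literal.ext_iff', Literal.neg] at *
  cases p <;> cases q <;> simp_all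

theorem findVar_none {v : ℕ} {c : Clause} (h : (findVar v c).val = none) :
    ∀ l ∈ c, l.var ≠ v := by
  induction c with
  | nil => simp
  | cons l c ih =>
    simp only [findVar, bind_val] at h
    split at h
    · simp at h
    · simp_all

theorem findVar_some {v : ℕ} {c : Clause} {l : Literal} (h : (findVar v c).val = some l) :
    l ∈ c ∧ l.var = v := by
  induction c with
  | nil => simp [findVar] at h
  | cons m c ih =>
    simp only [findVar, bind_val] at h
    split at h
    · simp_all
    · simp_all

theorem findVar_cost (v : ℕ) (c : Clause) : Cost (findVar v c) (c.length + 1) := by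
  induction c with
  | nil => exact Cost.tick_pure _ le_rfl
  | cons l c ih =>
    refine (Cost.tick_bind (b := c.length + 1) ?_).mono (by simp; omega)
    split
    · exact Cost.pure _ _
    · exact ih

@[simp] theorem hasLit_val (l : Literal) (c : Clause) : (hasLit l c).val = decide (l ∈ c) := by
  induction c with
  | nil => simp [hasLit]
  | cons m c ih =>
    simp only [hasLit, bind_val]
    split
    · next h => simp [(Literal.ext_iff'.2 h).symm]
    · next h =>
      rw [ih]
      have : l ≠ m := fun e => h ⟨by rw [e], by rw [e]⟩
      simp [this]

theorem hasLit_cost (l : Literal) (c : Clause) : Cost (hasLit l c) (c.length + 1) := by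
  induction c with
  | nil => exact Cost.tick_pure _ le_rfl
  | cons m c ih =>
    refine (Cost.tick_bind (b := c.length + 1) ?_).mono (by simp; omega)
    split
    · exact Cost.pure _ _
    · exact ih

@[simp] theorem removeFirst_val (l : Literal) (c : Clause) : (removeFirst l c).val = c.erase l := by
  induction c with
  | nil => simp [removeFirst]
  | cons m c ih =>
    simp only [removeFirst, bind_val]
    split
    · next h => simp [Literal.ext_iff'.2 h]
    · next h =>
      have : m ≠ l := fun e => h (Literal.ext_iff'.1 e)
      simp [ih, this]

theorem removeFirst_cost (l : Literal) (c : Clause) : Cost (removeFirst l c) (c.length + 1) := by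
  induction c with
  | nil => exact Cost.tick_pure _ le_rfl
  | cons m c ih =>
    refine (Cost.tick_bind (b := c.length + 1) ?_).mono (by simp; omega)
    split
    · exact Cost.pure _ _
    · exact ih.bind_pure

@[simp] theorem removeAll_val (l : Literal) (c : Clause) :
    (removeAll l c).val = c.filter fun m => decide (m ≠ l) := by
  induction c with
  | nil => simp [removeAll]
  | cons m c ih =>
    simp only [removeAll, bind_val, ih]
    split
    · next h => simp [Literal.ext_iff'.2 h]
    · next h =>
      have : m ≠ l := fun e => h (Literal.ext_iff'.1 e)
      simp [this]

theorem removeAll_cost (l : Literal) (c : Clause) : Cost (removeAll l c) (c.length + 1) := by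
  induction c with
  | nil => exact Cost.tick_pure _ le_rfl
  | cons m c ih =>
    refine (Cost.tick_bind (b := c.length + 1 + 0) (ih.bind ?_)).mono (by simp; omega)
    split <;> exact Cost.pure _ _

/-- Does the variable occur in the clause? -/
def occurs (v : ℕ) (c : Clause) : Bool := decide (∃ l ∈ c, l.var = v)

theorem findVar_isSome (v : ℕ) (c : Clause) : (findVar v c).val.isSome = occurs v c := by
  cases h : (findVar v c).val with
  | none => simpa [occurs] using findVar_none h
  | some l => simpa [occurs] using ⟨l, findVar_some h⟩

@[simp] theorem degree_val (v : ℕ) (cs : List Clause) : (degree v cs).val = cs.countP (occurs v) := by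
  induction cs with
  | nil => rfl
  | cons c cs ih =>
    simp only [degree, bind_val, ih]
    have := findVar_isSome v c
    cases h : (findVar v c).val with
    | none => simp [h] at this; simp [← this]
    | some l => simp [h] at this; simp [← this]

theorem degree_cost {n : ℕ} (v : ℕ) {cs : List Clause} (h : ∀ c ∈ cs, c.length ≤ n) :
    Cost (degree v cs) ((n + 2) * cs.length + 1) := by
  induction cs with
  | nil => exact Cost.tick_pure _ (by simp)
  | cons c cs ih =>
    have ih := ih fun y hy => h y (by simp [hy])
    have hc := h c (by simp)
    refine (Cost.tick_bind ((findVar_cost v c).bind (ih.bind (b := 0) ?_))).mono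
      (by simp only [List.length_cons]; ring_nf; omega)
    split <;> exact Cost.pure _ _

@[simp] theorem isSingleton_val (cs : List Clause) (l : Literal) :
    (isSingleton cs l).val = decide (cs.countP (occurs l.var) = 1) := by
  simp [isSingleton]

theorem isSingleton_cost {n : ℕ} {cs : List Clause} (h : ∀ c ∈ cs, c.length ≤ n) (l : Literal) :
    Cost (isSingleton cs l) ((n + 2) * cs.length + 2) :=
  (Cost.tick_bind (degree_cost l.var h).bind_pure).mono (by omega)

theorem repeated_none {c : Clause} (h : (repeated c).val = none) : (c.map Literal.var).Nodup := by
  induction c with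
  | nil => simp
  | cons l c ih =>
    simp only [repeated, bind_val] at h
    cases hf : (findVar l.var c).val with
    | none =>
      simp only [hf] at h
      simp only [List.map_cons, List.nodup_cons, ih h, and_true, List.mem_map, not_exists, not_and]
      exact findVar_none hf
    | some m => simp [hf] at h

theorem repeated_some {c : Clause} {l m : Literal} (h : (repeated c).val = some (l, m)) :
    l.var = m.var ∧ ∃ d, c.Perm (l :: m :: d) := by
  induction c with
  | nil => simp [repeated] at h
  | cons x c ih =>
    simp only [repeated, bind_val] at h
    cases hf : (findVar x.var c).val with
    | none =>
      simp only [hf] at h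
      obtain ⟨h1, d, hd⟩ := ih h
      exact ⟨h1, x :: d, (hd.cons x).trans
        ((List.Perm.swap l x (m :: d)).trans ((List.Perm.swap m x d).cons l))⟩
    | some y =>
      simp only [hf, pure_val, Option.some.injEq, Prod.mk.injEq] at h
      obtain ⟨rfl, rfl⟩ := h
      obtain ⟨h1, h2⟩ := findVar_some hf
      exact ⟨h2.symm, c.erase y, (List.perm_cons_erase h1).cons x⟩

theorem repeated_cost {n : ℕ} {c : Clause} (h : c.length ≤ n) :
    Cost (repeated c) ((n + 2) * c.length + 1) := by
  induction c with
  | nil => exact Cost.tick_pure _ (by simp)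
  | cons l c ih =>
    have h' : c.length + 1 ≤ n := h
    refine (Cost.tick_bind ((findVar_cost l.var c).bind (b := (n + 2) * c.length + 1) ?_)).mono
      (by simp only [List.length_cons]; ring_nf; omega)
    split
    · exact Cost.pure _ _
    · exact ih (by omega)

theorem subClause_val (c d : Clause) : (subClause c d).val = decide (∀ l ∈ c, l ∈ d) := by
  induction c with
  | nil => simp [subClause]
  | cons l c ih =>
    simp only [subClause, bind_val, hasLit_val]
    by_cases h : l ∈ d <;> simp [h, ih]

theorem subClause_cost {n : ℕ} (c : Clause) {d : Clause} (h : d.length ≤ n) :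
    Cost (subClause c d) ((n + 2) * c.length + 1) := by
  induction c with
  | nil => exact Cost.tick_pure _ (by simp)
  | cons l c ih =>
    refine (Cost.tick_bind ((hasLit_cost l d).bind (b := (n + 2) * c.length + 1) ?_)).mono
      (by simp only [List.length_cons]; ring_nf; omega)
    split
    · exact ih
    · exact Cost.pure _ _

theorem sameClause_val {c d : Clause} :
    (sameClause c d).val = true ↔ ∀ l, l ∈ c ↔ l ∈ d := by
  simp only [sameClause, bind_val, subClause_val, pure_val, Bool.and_eq_true, decide_eq_true_eq]
  exact ⟨fun h l => ⟨h.1 l, h.2 l⟩, fun h => ⟨fun l => (h l).1, fun l => (h l).2⟩⟩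

theorem sameClause_cost {n : ℕ} {c d : Clause} (hc : c.length ≤ n) (hd : d.length ≤ n) :
    Cost (sameClause c d) (1 + 2 * ((n + 2) * n + 1)) := by
  refine (Cost.tick_bind ((subClause_cost c hd).bind ((subClause_cost d hc).bind_pure))).mono ?_
  nlinarith [Nat.mul_le_mul_left (n + 2) hc, Nat.mul_le_mul_left (n + 2) hd]

/-! ## Records of the variables -/

/-- The variables of an instance. -/
abbrev vars (live : List (ℕ × Gain)) : List ℕ := live.map Prod.fst

/-- With `v` present, the default record of `getGain` never matters. The permutation form splits a
sum over all records into the term of `v` and the rest. -/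
theorem live_perm {v : ℕ} {live : List (ℕ × Gain)} (hv : v ∈ vars live) :
    live.Perm ((v, (getGain v live).val) :: (dropVar v live).val) := by
  induction live with
  | nil => simp at hv
  | cons x xs ih =>
    obtain ⟨u, g⟩ := x
    by_cases h : u = v
    · simp [getGain, dropVar, h]
    · have := ih (by simpa [Ne.symm h] using hv)
      simp only [getGain, dropVar, bind_val, h, if_false, pure_val]
      exact (this.cons _).trans (List.Perm.swap _ _ _)

theorem setGain_perm {v : ℕ} (h : Gain) {live : List (ℕ × Gain)} (hv : v ∈ vars live) :
    (setGain v h live).val.Perm ((v, h) :: (dropVar v live).val) := by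
  induction live with
  | nil => simp at hv
  | cons x xs ih =>
    obtain ⟨u, g⟩ := x
    by_cases e : u = v
    · simp [setGain, dropVar, e]
    · have := ih (by simpa [Ne.symm e] using hv)
      simp only [setGain, dropVar, bind_val, e, if_false, pure_val]
      exact (this.cons _).trans (List.Perm.swap _ _ _)

theorem vars_perm {v : ℕ} {live : List (ℕ × Gain)} (hv : v ∈ vars live) :
    (vars live).Perm (v :: vars (dropVar v live).val) :=
  (live_perm hv).map _

theorem vars_setGain {v : ℕ} (h : Gain) {live : List (ℕ × Gain)} (hv : v ∈ vars live) :
    (vars (setGain v h live).val).Perm (vars live) :=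
  ((setGain_perm h hv).map _).trans (vars_perm hv).symm

theorem mem_vars_dropVar {u v : ℕ} {live : List (ℕ × Gain)} (hn : (vars live).Nodup)
    (hv : v ∈ vars live) : u ∈ vars (dropVar v live).val ↔ u ∈ vars live ∧ u ≠ v := by
  have hp := vars_perm hv
  rw [hp.nodup_iff, List.nodup_cons] at hn
  rw [hp.mem_iff, List.mem_cons]
  constructor
  · exact fun h => ⟨Or.inr h, fun e => hn.1 (e ▸ h)⟩
  · rintro ⟨h | h, h'⟩
    · exact absurd h h'
    · exact h

theorem nodup_dropVar {v : ℕ} {live : List (ℕ × Gain)} (hn : (vars live).Nodup)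
    (hv : v ∈ vars live) : (vars (dropVar v live).val).Nodup := by
  rw [(vars_perm hv).nodup_iff, List.nodup_cons] at hn
  exact hn.2

theorem length_dropVar {v : ℕ} {live : List (ℕ × Gain)} (hv : v ∈ vars live) :
    (dropVar v live).val.length + 1 = live.length := by
  simpa using (live_perm hv).length_eq.symm

theorem getGain_cost (v : ℕ) (live : List (ℕ × Gain)) :
    Cost (getGain v live) (live.length + 1) := by
  induction live with
  | nil => exact Cost.tick_pure _ le_rfl
  | cons x xs ih =>
    refine (Cost.tick_bind (b := xs.length + 1) ?_).mono (by simp; omega)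
    split
    · exact Cost.pure _ _
    · exact ih

theorem setGain_cost (v : ℕ) (g : Gain) (live : List (ℕ × Gain)) :
    Cost (setGain v g live) (live.length + 1) := by
  induction live with
  | nil => exact Cost.tick_pure _ le_rfl
  | cons x xs ih =>
    refine (Cost.tick_bind (b := xs.length + 1) ?_).mono (by simp; omega)
    split
    · exact Cost.pure _ _
    · exact ih.bind_pure

theorem dropVar_cost (v : ℕ) (live : List (ℕ × Gain)) :
    Cost (dropVar v live) (live.length + 1) := by
  induction live with
  | nil => exact Cost.tick_pure _ le_rfl
  | cons x xs ih =>
    refine (Cost.tick_bind (b := xs.length + 1) ?_).mono (by simp; omega)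
    split
    · exact Cost.pure _ _
    · exact ih.bind_pure

/-! ## Substitution: values -/

@[simp] theorem negUnits_val (c : Clause) (cs : List Clause) :
    (negUnits c cs).val = (c.map fun m => [m.neg]) ++ cs := by
  induction c with
  | nil => rfl
  | cons m c ih => simp [negUnits, ih]

/-- The clauses that a literal `m` of a clause contributes if the literal `l` of this clause is
true. -/
def unitOf (l m : Literal) : List Clause :=
  if m.var = l.var then if m.pos = l.pos then [[]] else [] else [[m.neg]]

@[simp] theorem negUnitsOf_val (l : Literal) (c : Clause) (cs : List Clause) :
    (negUnitsOf l c cs).val = c.flatMap (unitOf l) ++ cs := by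
  induction c with
  | nil => rfl
  | cons m c ih =>
    simp only [negUnitsOf, bind_val, ih, unitOf, List.flatMap_cons]
    split_ifs <;> simp

/-- The clauses that replace a clause if `l` is true. -/
def assignClause (l : Literal) (c : Clause) : List Clause :=
  if l ∈ c then (c.erase l).flatMap (unitOf l) else [c.filter fun m => decide (m ≠ l.neg)]

@[simp] theorem assignClauses_val (l : Literal) (cs : List Clause) :
    (assignClauses l cs).val = cs.flatMap (assignClause l) := by
  induction cs with
  | nil => rfl
  | cons c cs ih =>
    simp only [assignClauses, bind_val, ih, hasLit_val, List.flatMap_cons]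
    by_cases h : l ∈ c <;> simp [h, assignClause]

/-- Replacement of `l` by `m` in a literal. -/
def substLit (l m x : Literal) : Literal :=
  if x.var = l.var then if x.pos = l.pos then m else m.neg else x

@[simp] theorem substClause_val (l m : Literal) (c : Clause) :
    (substClause l m c).val = c.map (substLit l m) := by
  induction c with
  | nil => rfl
  | cons x c ih =>
    simp only [substClause, bind_val, ih, List.map_cons, substLit]
    split_ifs <;> simp

@[simp] theorem substClauses_val (l m : Literal) (cs : List Clause) :
    (substClauses l m cs).val = cs.map (List.map (substLit l m)) := by
  induction cs with
  | nil => rfl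
  | cons c cs ih => simp [substClauses, ih]

theorem assign_val (l : Literal) (s : State) :
    (assign l s).val = ⟨s.clauses.flatMap (assignClause l), (dropVar l.var s.live).val,
      s.acc + ((getGain l.var s.live).val.orient l).tt⟩ := by
  simp [assign]

/-- The record of `m` if `l` is replaced by the negation of `m`. -/
def linkGain (a b : Gain) : Gain := ⟨b.tt + a.ff, b.ff + a.tt, b.df + a.df⟩

theorem link_val (l m : Literal) (s : State) :
    (link l m s).val = ⟨s.clauses.map (List.map (substLit l m.neg)),
      (setGain m.var ((linkGain ((getGain l.var s.live).val.orient l)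
        ((getGain m.var s.live).val.orient m)).orient m) (dropVar l.var s.live).val).val,
      s.acc⟩ := by
  simp [link, linkGain]

theorem linkDiffer_val (l m : Literal) (s : State) :
    (linkDiffer l m s).val = ⟨(link l m s).val.clauses,
      (setGain m.var ⟨⊥, ⊥, (getGain m.var (link l m s).val.live).val.df⟩
        (link l m s).val.live).val, (link l m s).val.acc⟩ := by
  simp [linkDiffer]

/-- The record of `l` if `m` is another singleton of the same clause. -/
def mergeGain (a b : Gain) : Gain :=
  ⟨max (max (a.tt + b.ff) (a.ff + b.tt)) (a.df + b.df), a.ff + b.ff,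
    max (a.df + b.ff) (a.ff + b.df)⟩

theorem mergeSingletons_val (l m : Literal) (c : Clause) (cs : List Clause) (s : State) :
    (mergeSingletons l m c cs s).val = ⟨c.erase m :: cs,
      (setGain l.var ((mergeGain ((getGain l.var s.live).val.orient l)
        ((getGain m.var s.live).val.orient m)).orient l) (dropVar m.var s.live).val).val,
      s.acc⟩ := by
  simp [mergeSingletons, mergeGain]

theorem isReducible_val (c : Clause) :
    (isReducible c).val = true ↔ c.length ≤ 2 ∨ (repeated c).val.isSome = true := by
  simp [isReducible]

theorem isFree_val (cs : List Clause) (x : ℕ × Gain) :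
    (isFree cs x).val = true ↔ ∀ c ∈ cs, ∀ l ∈ c, l.var ≠ x.1 := by
  simp [isFree, List.countP_eq_zero, occurs]

theorem hasTwoSingletons_val (cs : List Clause) (c : Clause) :
    (hasTwoSingletons cs c).val =
      decide (2 ≤ (c.filter fun l => decide (cs.countP (occurs l.var) = 1)).length) := by
  simp [hasTwoSingletons]

/-! ## Sizes -/

/-- The size of a clause, counting the empty clause as 1. -/
def clauseSize (c : Clause) : ℕ := max c.length 1

/-- The sum of the sizes of the clauses. -/
def formSize (F : List Clause) : ℕ := (F.map clauseSize).sum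

/-- The number of literal occurrences. -/
def litCount (F : List Clause) : ℕ := (F.map List.length).sum

/-- The size of an instance. -/
def State.size (s : State) : ℕ := formSize s.clauses + s.live.length

@[simp] theorem formSize_cons (c : Clause) (F : List Clause) :
    formSize (c :: F) = clauseSize c + formSize F := by simp [formSize]

@[simp] theorem formSize_append (F G : List Clause) :
    formSize (F ++ G) = formSize F + formSize G := by simp [formSize]

@[simp] theorem litCount_cons (c : Clause) (F : List Clause) :
    litCount (c :: F) = c.length + litCount F := by simp [litCount]

@[simp] theorem litCount_append (F G : List Clause) :
    litCount (F ++ G) = litCount F + litCount G := by simp [litCount]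

@[simp] theorem formSize_nil : formSize [] = 0 := rfl

@[simp] theorem litCount_nil : litCount [] = 0 := rfl

theorem formSize_perm {F G : List Clause} (h : F.Perm G) : formSize F = formSize G :=
  (h.map _).sum_eq

theorem litCount_perm {F G : List Clause} (h : F.Perm G) : litCount F = litCount G :=
  (h.map _).sum_eq

theorem one_le_clauseSize (c : Clause) : 1 ≤ clauseSize c := le_max_right _ _

theorem length_le_clauseSize (c : Clause) : c.length ≤ clauseSize c := le_max_left _ _

/-- This is the reason for counting an empty clause as 1: the size then bounds the number of clauses
too, which the number of literal occurrences does not. -/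
theorem length_le_formSize (F : List Clause) : F.length ≤ formSize F := by
  induction F with
  | nil => simp
  | cons c F ih => simp only [List.length_cons, formSize_cons]; have := one_le_clauseSize c; omega

theorem litCount_le_formSize (F : List Clause) : litCount F ≤ formSize F := by
  induction F with
  | nil => simp
  | cons c F ih =>
    simp only [litCount_cons, formSize_cons]; have := length_le_clauseSize c; omega

theorem clauseSize_le_formSize {F : List Clause} {c : Clause} (h : c ∈ F) :
    clauseSize c ≤ formSize F :=
  List.le_sum_of_mem (List.mem_map_of_mem h)

theorem length_le_of_mem {F : List Clause} {c : Clause} (h : c ∈ F) : c.length ≤ formSize F :=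
  (length_le_clauseSize c).trans (clauseSize_le_formSize h)

theorem formSize_units (c : Clause) : formSize (c.map fun m => [m.neg]) = c.length := by
  induction c with
  | nil => rfl
  | cons m c ih => simp [ih, clauseSize]; omega

theorem litCount_units (c : Clause) : litCount (c.map fun m => [m.neg]) = c.length := by
  induction c with
  | nil => rfl
  | cons m c ih => simp [ih]; omega

theorem formSize_unitOf (l : Literal) (c : Clause) :
    formSize (c.flatMap (unitOf l)) ≤ c.length := by
  induction c with
  | nil => simp
  | cons m c ih =>
    simp only [List.flatMap_cons, formSize_append, List.length_cons, unitOf]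
    split_ifs <;> simp [clauseSize] <;> omega

/-- A clause made true falls apart into clauses of size 1, at most one for each remaining literal.
As a consequence sizes never grow, and the size at the root bounds the cost of every step in the
whole recursion. -/
theorem formSize_assignClause (l : Literal) (c : Clause) :
    formSize (assignClause l c) ≤ clauseSize c := by
  unfold assignClause
  split_ifs with h
  · exact (formSize_unitOf l _).trans ((List.length_erase_le).trans (length_le_clauseSize c))
  · simp only [formSize_cons, formSize_nil, clauseSize, add_zero]
    exact max_le_max (List.length_filter_le _ _) le_rfl

theorem litCount_assignClause (l : Literal) (c : Clause) :
    litCount (assignClause l c) ≤ c.length := by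
  unfold assignClause
  split_ifs with h
  · exact (litCount_le_formSize _).trans ((formSize_unitOf l _).trans (List.length_erase_le))
  · simpa using List.length_filter_le _ _

theorem formSize_assign (l : Literal) (F : List Clause) :
    formSize (F.flatMap (assignClause l)) ≤ formSize F := by
  induction F with
  | nil => simp
  | cons c F ih =>
    simp only [List.flatMap_cons, formSize_append, formSize_cons]
    have := formSize_assignClause l c
    omega

theorem litCount_assign (l : Literal) (F : List Clause) :
    litCount (F.flatMap (assignClause l)) ≤ litCount F := by
  induction F with
  | nil => simp
  | cons c F ih =>
    simp only [List.flatMap_cons, litCount_append, litCount_cons]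
    have := litCount_assignClause l c
    omega

theorem formSize_map (f : Literal → Literal) (F : List Clause) :
    formSize (F.map (List.map f)) = formSize F := by
  induction F with
  | nil => simp
  | cons c F ih => simp [ih, clauseSize]

theorem litCount_map (f : Literal → Literal) (F : List Clause) :
    litCount (F.map (List.map f)) = litCount F := by
  induction F with
  | nil => simp
  | cons c F ih => simp [ih]

@[simp] theorem countLits_val (F : List Clause) : (countLits F).val = litCount F := by
  induction F with
  | nil => rfl
  | cons c F ih => simp [countLits, ih]

/-! ## Costs of the simplifications -/

theorem negUnits_cost (c : Clause) (cs : List Clause) :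
    Cost (negUnits c cs) (c.length + 1) := by
  induction c with
  | nil => exact Cost.tick_pure _ le_rfl
  | cons m c ih => exact (Cost.tick_bind ih.bind_pure).mono (by simp; omega)

theorem negUnitsOf_cost (l : Literal) (c : Clause) (cs : List Clause) :
    Cost (negUnitsOf l c cs) (c.length + 1) := by
  induction c with
  | nil => exact Cost.tick_pure _ le_rfl
  | cons m c ih =>
    refine (Cost.tick_bind (b := c.length + 1 + 0) (ih.bind ?_)).mono (by simp; omega)
    split_ifs <;> exact Cost.pure _ _

theorem assignClauses_cost {n : ℕ} (l : Literal) {cs : List Clause} (h : ∀ c ∈ cs, c.length ≤ n) :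
    Cost (assignClauses l cs) ((3 * n + 4) * cs.length + 1) := by
  induction cs with
  | nil => exact Cost.tick_pure _ (by simp)
  | cons c cs ih =>
    have ih := ih fun y hy => h y (by simp [hy])
    have hc := h c (by simp)
    refine (Cost.tick_bind (ih.bind ((hasLit_cost l c).bind (b := n + 1 + (n + 1)) ?_))).mono
      (by simp only [List.length_cons]; ring_nf; omega)
    split_ifs
    · refine ((removeFirst_cost l c).mono (by omega)).bind ((negUnitsOf_cost l _ _).mono ?_)
      simp only [removeFirst_val]
      have := List.length_erase_le (a := l) (l := c)
      omega
    · exact (removeAll_cost _ c).bind_pure.mono (by omega)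

theorem substClause_cost (l m : Literal) (c : Clause) :
    Cost (substClause l m c) (c.length + 1) := by
  induction c with
  | nil => exact Cost.tick_pure _ le_rfl
  | cons x c ih =>
    refine (Cost.tick_bind (b := c.length + 1 + 0) (ih.bind ?_)).mono (by simp; omega)
    split_ifs <;> exact Cost.pure _ _

theorem substClauses_cost {n : ℕ} (l m : Literal) {cs : List Clause}
    (h : ∀ c ∈ cs, c.length ≤ n) : Cost (substClauses l m cs) ((n + 2) * cs.length + 1) := by
  induction cs with
  | nil => exact Cost.tick_pure _ (by simp)
  | cons c cs ih =>
    have ih := ih fun y hy => h y (by simp [hy])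
    have hc := h c (by simp)
    exact (Cost.tick_bind ((substClause_cost l m c).bind ih.bind_pure)).mono
      (by simp only [List.length_cons]; ring_nf; omega)

/-- All lists of the instance have length at most `n`. -/
structure Small (n : ℕ) (F : List Clause) (live : List (ℕ × Gain)) : Prop where
  clause : ∀ c ∈ F, c.length ≤ n
  clauses : F.length ≤ n
  live : live.length ≤ n

theorem State.small {n : ℕ} {s : State} (h : s.size ≤ n) : Small n s.clauses s.live := by
  unfold State.size at h
  exact ⟨fun c hc => (length_le_of_mem hc).trans (by omega),
    (length_le_formSize _).trans (by omega), by omega⟩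

theorem dropVar_length_le (v : ℕ) (live : List (ℕ × Gain)) :
    (dropVar v live).val.length ≤ live.length := by
  induction live with
  | nil => simp [dropVar]
  | cons x xs ih =>
    simp only [dropVar, bind_val]
    split <;> simp [ih]

theorem setGain_length (v : ℕ) (g : Gain) (live : List (ℕ × Gain)) :
    (setGain v g live).val.length = live.length := by
  induction live with
  | nil => simp [setGain]
  | cons x xs ih =>
    simp only [setGain, bind_val]
    split <;> simp [ih]

section

variable {n : ℕ}

/-- Only polynomial growth matters for this bound and the following ones; powers of `n + 10` are
generous enough to swallow all lower terms. -/
theorem assign_cost (l : Literal) {s : State} (h : Small n s.clauses s.live) :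
    Cost (assign l s) ((n + 10) ^ 3) := by
  refine (Cost.tick_bind (((getGain_cost _ _).mono (Nat.succ_le_succ h.live)).bind
    (((dropVar_cost _ _).mono (Nat.succ_le_succ h.live)).bind
    ((assignClauses_cost l h.clause).mono
      (Nat.succ_le_succ (Nat.mul_le_mul_left _ h.clauses))).bind_pure))).mono ?_
  simp only [Nat.succ_eq_add_one]
  ring_nf
  nlinarith [Nat.zero_le (n ^ 2), Nat.zero_le (n ^ 3)]

theorem link_cost (l m : Literal) {s : State} (h : Small n s.clauses s.live) :
    Cost (link l m s) ((n + 10) ^ 2) := by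
  have hd := (dropVar_length_le l.var s.live).trans h.live
  refine (Cost.tick_bind (((getGain_cost _ _).mono (Nat.succ_le_succ h.live)).bind
    (((getGain_cost _ _).mono (Nat.succ_le_succ h.live)).bind
    (((dropVar_cost _ _).mono (Nat.succ_le_succ h.live)).bind
    (((setGain_cost _ _ _).mono (Nat.succ_le_succ hd)).bind
    ((substClauses_cost l _ h.clause).mono
      (Nat.succ_le_succ (Nat.mul_le_mul_left _ h.clauses))).bind_pure))))).mono ?_
  simp only [Nat.succ_eq_add_one]
  nlinarith

theorem linkDiffer_cost (l m : Literal) {s : State} (h : Small n s.clauses s.live) :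
    Cost (linkDiffer l m s) ((n + 10) ^ 3) := by
  have hd : (link l m s).val.live.length ≤ n := by
    rw [link_val]
    simp only [setGain_length]
    exact (dropVar_length_le l.var s.live).trans h.live
  refine (Cost.tick_bind ((link_cost l m h).bind
    (((getGain_cost _ _).mono (Nat.succ_le_succ hd)).bind
      ((setGain_cost _ _ _).mono (Nat.succ_le_succ hd)).bind_pure))).mono ?_
  simp only [Nat.succ_eq_add_one]
  nlinarith [Nat.zero_le (n ^ 3)]

theorem isReducible_cost {c : Clause} (h : c.length ≤ n) :
    Cost (isReducible c) ((n + 10) ^ 2) := by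
  refine (Cost.tick_bind ((len_cost c).bind (repeated_cost h).bind_pure)).mono ?_
  nlinarith [Nat.mul_le_mul_left (n + 2) h]

theorem dropDuplicate_cost {F : List Clause} (h : ∀ c ∈ F, c.length ≤ n) (hF : F.length ≤ n) :
    Cost (dropDuplicate F) ((n + 10) ^ 4 * F.length + 1) := by
  induction F with
  | nil => exact Cost.tick_pure _ (by simp)
  | cons c F ih =>
    have hF' : F.length + 1 ≤ n := hF
    have ih := ih (fun y hy => h y (by simp [hy])) (by omega)
    refine (Cost.tick_bind (((pick_cost fun d hd => sameClause_cost (n := n)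
      (h c (by simp)) (h d (by simp [hd])))).bind
        (b := (n + 10) ^ 4 * F.length + 1) ?_)).mono ?_
    · split
      · exact Cost.pure _ _
      · refine (ih.bind (b := 0) ?_)
        split <;> exact Cost.pure _ _
    · simp only [List.length_cons]
      have : (1 + 2 * ((n + 2) * n + 1) + 1) * F.length ≤ (1 + 2 * ((n + 2) * n + 1) + 1) * n :=
        Nat.mul_le_mul_left _ (by omega)
      nlinarith [Nat.zero_le (n ^ 3), Nat.zero_le (n ^ 4), Nat.zero_le (n ^ 2)]

theorem hasTwoSingletons_cost {F : List Clause} {c : Clause} (h : ∀ c ∈ F, c.length ≤ n)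
    (hF : F.length ≤ n) (hc : c.length ≤ n) :
    Cost (hasTwoSingletons F c) ((n + 10) ^ 3) := by
  refine (Cost.tick_bind ((separate_cost fun l _ => (isSingleton_cost h l).mono
    (Nat.succ_le_succ (Nat.succ_le_succ (Nat.mul_le_mul_left (n + 2) hF)))).bind
      ((len_cost _).mono (b := n + 1) ?_).bind_pure)).mono ?_
  · simpa using (List.length_filter_le _ _).trans hc
  · have := Nat.mul_le_mul_left ((n + 2) * n + 1 + 1 + 1) hc
    simp only [Nat.succ_eq_add_one]
    nlinarith [Nat.zero_le (n ^ 3), Nat.zero_le (n ^ 2)]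

theorem mergeSingletons_cost (l m : Literal) {c : Clause} (cs : List Clause) {s : State}
    (hc : c.length ≤ n) (hl : s.live.length ≤ n) :
    Cost (mergeSingletons l m c cs s) ((n + 10) ^ 2) := by
  have hd := (dropVar_length_le m.var s.live).trans hl
  refine (Cost.tick_bind (((getGain_cost _ _).mono (Nat.succ_le_succ hl)).bind
    (((getGain_cost _ _).mono (Nat.succ_le_succ hl)).bind
    (((dropVar_cost _ _).mono (Nat.succ_le_succ hl)).bind
    (((setGain_cost _ _ _).mono (Nat.succ_le_succ hd)).bind
    ((removeFirst_cost _ _).mono (Nat.succ_le_succ hc)).bind_pure))))).mono ?_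
  simp only [Nat.succ_eq_add_one]
  nlinarith

theorem isFree_cost {F : List Clause} (h : ∀ c ∈ F, c.length ≤ n) (hF : F.length ≤ n)
    (x : ℕ × Gain) : Cost (isFree F x) ((n + 10) ^ 2) := by
  refine (Cost.tick_bind (degree_cost _ h).bind_pure).mono ?_
  nlinarith [Nat.mul_le_mul_left (n + 2) hF]

theorem reduceClause_cost {c : Clause} {cs : List Clause} {s : State} (hc : c.length ≤ n)
    (hcs : ∀ c ∈ cs, c.length ≤ n) (hcs' : cs.length ≤ n)
    (h : Small n s.clauses s.live) : Cost (reduceClause c cs s) ((n + 10) ^ 4) := by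
  refine (Cost.tick_bind ((repeated_cost hc).bind (b := (n + 10) ^ 3) ?_)).mono ?_
  · split
    · split_ifs
      · exact (assign_cost _ h).bind_pure
      · refine (((removeFirst_cost _ _).mono (Nat.succ_le_succ hc)).bind
          (((removeFirst_cost _ _).mono (b := n + 1) ?_).bind
          ((negUnits_cost _ _).mono (b := n + 1) ?_).bind_pure)).mono ?_
        · simp only [removeFirst_val]
          exact Nat.succ_le_succ (List.length_erase_le.trans hc)
        · simp only [removeFirst_val]
          exact Nat.succ_le_succ (List.length_erase_le.trans (List.length_erase_le.trans hc))
        · simp only [Nat.succ_eq_add_one]; ring_nf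
          nlinarith [Nat.zero_le (n ^ 3), Nat.zero_le (n ^ 2)]
    · split
      · exact (assign_cost _ h).bind_pure
      · exact ((link_cost _ _ (s := ⟨cs, s.live, s.acc⟩) ⟨hcs, hcs', h.live⟩).mono
          (Nat.pow_le_pow_right (by omega) (by omega))).bind_pure
      · exact Cost.pure _ _
  · have := Nat.mul_le_mul_left (n + 2) hc
    ring_nf at *
    nlinarith [Nat.zero_le (n ^ 3), Nat.zero_le (n ^ 4), Nat.zero_le (n ^ 2)]

end

/-! ## The simplifications as a relation -/

/-- The variables of the literals of a clause are distinct. -/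
abbrev ClauseNodup (c : Clause) : Prop := (c.map Literal.var).Nodup

/-- Every clause has at least three literals, derived from distinct variables. -/
def Irreducible (F : List Clause) : Prop := ∀ c ∈ F, 3 ≤ c.length ∧ ClauseNodup c

/-- The variable does not occur in the formula. -/
def Absent (v : ℕ) (F : List Clause) : Prop := ∀ c ∈ F, ∀ l ∈ c, l.var ≠ v

/-- One simplification. -/
inductive Simp (s : State) : State → Prop
  | twice (l : Literal) (c d : Clause) (hc : c ∈ s.clauses) (hd : c.Perm (l :: l :: d)) :
    Simp s (assign l.neg s).val
  | opposite (l : Literal) (c d : Clause) (cs : List Clause) (hc : s.clauses.Perm (c :: cs))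
    (hd : c.Perm (l :: l.neg :: d)) :
    Simp s ⟨(d.map fun m => [m.neg]) ++ cs, s.live, s.acc⟩
  | unit (l : Literal) (hl : [l] ∈ s.clauses) : Simp s (assign l s).val
  | pair (l m : Literal) (cs : List Clause) (hc : s.clauses.Perm ([l, m] :: cs))
    (hlm : l.var ≠ m.var) : Simp s (link l m ⟨cs, s.live, s.acc⟩).val
  | duplicate (c d : Clause) (cs : List Clause) (hs : Irreducible s.clauses)
    (hc : s.clauses.Perm (c :: cs)) (hd : d ∈ cs) (hcd : ∀ l, l ∈ c ↔ l ∈ d) :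
    Simp s ⟨cs, s.live, s.acc⟩
  | merge (l m : Literal) (c d : Clause) (cs : List Clause) (hs : Irreducible s.clauses)
    (hc : s.clauses.Perm (c :: cs)) (hd : c.Perm (m :: l :: d)) (hl : Absent l.var cs)
    (hm : Absent m.var cs) : Simp s (mergeSingletons l m c cs s).val
  | free (v : ℕ) (g : Gain) (live : List (ℕ × Gain)) (hs : Irreducible s.clauses)
    (hl : s.live.Perm ((v, g) :: live)) (hv : Absent v s.clauses) :
    Simp s ⟨s.clauses, live, s.acc + max (max g.tt g.ff) g.df⟩

/-- Nothing can be simplified. -/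
structure Simplified (s : State) : Prop where
  irreducible : Irreducible s.clauses
  distinct : s.clauses.Pairwise fun c d => ¬ ∀ l, l ∈ c ↔ l ∈ d
  singleton : ∀ c ∈ s.clauses,
    (c.filter fun l => decide (s.clauses.countP (occurs l.var) = 1)).length ≤ 1
  free : ∀ x ∈ s.live, ¬ Absent x.1 s.clauses

theorem reduceClause_some {c : Clause} {cs : List Clause} {s t : State}
    (hc : s.clauses.Perm (c :: cs)) (h : (reduceClause c cs s).val = some t) : Simp s t := by
  have hmem : c ∈ s.clauses := hc.mem_iff.2 (by simp)
  simp only [reduceClause, bind_val] at h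
  cases hr : (repeated c).val with
  | some lm =>
    obtain ⟨l, m⟩ := lm
    obtain ⟨h1, d, hd⟩ := repeated_some hr
    simp only [hr] at h
    split_ifs at h with hp
    · have : m = l := Literal.ext_iff'.2 ⟨h1.symm, hp.symm⟩
      subst this
      simp only [bind_val, pure_val, Option.some.injEq] at h
      subst h
      exact .twice m c d hmem hd
    · have : m = l.neg := by
        rcases Literal.eq_or_eq_neg h1 with e | e
        · exact absurd (by rw [e]) hp
        · rw [e, Literal.neg_neg]
      subst this
      simp only [bind_val, pure_val, removeFirst_val, negUnits_val, Option.some.injEq] at h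
      subst h
      refine .opposite l c _ cs hc (hd.trans ((List.Perm.cons _ (List.Perm.cons _ ?_))))
      have := (hd.erase l).erase l.neg
      simpa using this.symm
  | none =>
    have hn := repeated_none hr
    simp only [hr] at h
    split at h
    · next l =>
      simp only [bind_val, pure_val, Option.some.injEq] at h
      subst h
      exact .unit l hmem
    · next l m =>
      simp only [bind_val, pure_val, Option.some.injEq] at h
      subst h
      exact .pair l m cs hc (by simpa using hn)
    · simp at h

/-- A repetition can always be resolved, and so can a clause with one or two literals, so the only
reducible clause without a successor is the empty one. -/
theorem reduceClause_none {c : Clause} {cs : List Clause} {s : State}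
    (hc : (isReducible c).val = true) (h : (reduceClause c cs s).val = none) : c = [] := by
  simp only [reduceClause, bind_val] at h
  cases hr : (repeated c).val with
  | some lm =>
    simp only [hr] at h
    split_ifs at h
  | none =>
    simp only [hr] at h
    have hl : c.length ≤ 2 := by simpa [isReducible_val, hr] using hc
    match c, hl, h with
    | [], _, _ => rfl
    | [l], _, h => simp at h
    | [l, m], _, h => simp at h
    | _ :: _ :: _ :: _, hl, _ => simp at hl

theorem dropDuplicate_some {F G : List Clause} (h : (dropDuplicate F).val = some G) :
    ∃ c d, F.Perm (c :: G) ∧ d ∈ G ∧ ∀ l, l ∈ c ↔ l ∈ d := by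
  induction F generalizing G with
  | nil => simp [dropDuplicate] at h
  | cons c F ih =>
    simp only [dropDuplicate, bind_val] at h
    cases hp : (pick (sameClause c) F).val with
    | some r =>
      obtain ⟨d, r⟩ := r
      simp only [hp, pure_val, Option.some.injEq] at h
      subst h
      obtain ⟨h1, h2⟩ := pick_some_perm hp
      exact ⟨c, d, List.Perm.refl _, h2.mem_iff.2 (by simp), sameClause_val.1 h1⟩
    | none =>
      simp only [hp, bind_val] at h
      cases hr : (dropDuplicate F).val with
      | none => simp [hr] at h
      | some r =>
        simp only [hr, pure_val, Option.some.injEq] at h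
        subst h
        obtain ⟨a, d, h1, h2, h3⟩ := ih hr
        exact ⟨a, d, (h1.cons c).trans (List.Perm.swap _ _ _), by simp [h2], h3⟩

theorem dropDuplicate_none {F : List Clause} (h : (dropDuplicate F).val = none) :
    F.Pairwise fun c d => ¬ ∀ l, l ∈ c ↔ l ∈ d := by
  induction F with
  | nil => simp
  | cons c F ih =>
    simp only [dropDuplicate, bind_val] at h
    cases hp : (pick (sameClause c) F).val with
    | some r => simp [hp] at h
    | none =>
      simp only [hp, bind_val] at h
      cases hr : (dropDuplicate F).val with
      | some r => simp [hr] at h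
      | none =>
        refine List.pairwise_cons.2 ⟨fun d hd h' => ?_, ih hr⟩
        have := pick_none hp d hd
        rw [sameClause_val.2 h'] at this
        exact absurd this (by simp)

theorem irreducible_of_pick {F : List Clause} (h : (pick isReducible F).val = none) :
    Irreducible F := by
  intro c hc
  have h1 := pick_none h c hc
  have h2 : ¬ ((isReducible c).val = true) := by simp [h1]
  rw [isReducible_val] at h2
  push Not at h2
  exact ⟨h2.1, repeated_none (by simpa using h2.2)⟩

theorem absent_of_countP {v : ℕ} {c : Clause} {F : List Clause} (hc : occurs v c = true)
    (h : (c :: F).countP (occurs v) = 1) : Absent v F := by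
  rw [List.countP_cons_of_pos hc, Nat.add_eq_right, List.countP_eq_zero] at h
  intro d hd l hl e
  exact h d hd (by simpa [occurs] using ⟨l, hl, e⟩)

/-- This replaces the program by the relation `Simp`. Since the searches are done in a fixed order,
the last three rules are applied only to irreducible formulas, where each clause has distinct
variables. -/
theorem simplifyStep_some {s t : State} (h : (simplifyStep s).val = some t) : Simp s t := by
  simp only [simplifyStep, bind_val] at h
  cases h1 : (pick isReducible s.clauses).val with
  | some r =>
    obtain ⟨c, cs⟩ := r
    simp only [h1] at h
    exact reduceClause_some (pick_some_perm h1).2 h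
  | none =>
    have hirr := irreducible_of_pick h1
    simp only [h1, bind_val] at h
    cases h2 : (dropDuplicate s.clauses).val with
    | some cs =>
      simp only [h2, pure_val, Option.some.injEq] at h
      subst h
      obtain ⟨c, d, h3, h4, h5⟩ := dropDuplicate_some h2
      exact .duplicate c d cs hirr h3 h4 h5
    | none =>
      simp only [h2, bind_val] at h
      cases h3 : (pick (hasTwoSingletons s.clauses) s.clauses).val with
      | some r =>
        obtain ⟨c, cs⟩ := r
        obtain ⟨h4, h5⟩ := pick_some_perm h3
        simp only [h3, bind_val, separate_val, isSingleton_val] at h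
        cases h6 : c.filter (fun l => decide (s.clauses.countP (occurs l.var) = 1)) with
        | nil => simp [h6] at h
        | cons l r =>
          cases r with
          | nil => simp [h6] at h
          | cons m r =>
            simp only [h6, bind_val, pure_val, Option.some.injEq] at h
            subst h
            -- The two singletons found are different literals, because the clause has no
            -- repetitions.
            have hn : c.Nodup := (hirr c (h5.mem_iff.2 (by simp))).2.of_map _
            have hf := hn.filter (fun l => decide (s.clauses.countP (occurs l.var) = 1))
            rw [h6] at hf
            have hlm : l ≠ m := by
              have := (List.nodup_cons.1 hf).1
              exact fun e => this (by simp [e])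
            have hl : l ∈ c.filter (fun l => decide (s.clauses.countP (occurs l.var) = 1)) := by
              simp [h6]
            have hm : m ∈ c.filter (fun l => decide (s.clauses.countP (occurs l.var) = 1)) := by
              simp [h6]
            simp only [List.mem_filter, decide_eq_true_eq] at hl hm
            refine .merge l m c ((c.erase m).erase l) cs hirr h5 ?_ ?_ ?_
            · refine (List.perm_cons_erase hm.1).trans (List.Perm.cons _ ?_)
              exact List.perm_cons_erase ((List.mem_erase_of_ne hlm).2 hl.1)
            · refine absent_of_countP (c := c) (by simpa [occurs] using ⟨l, hl.1, rfl⟩) ?_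
              rw [← h5.countP_eq]; exact hl.2
            · refine absent_of_countP (c := c) (by simpa [occurs] using ⟨m, hm.1, rfl⟩) ?_
              rw [← h5.countP_eq]; exact hm.2
      | none =>
        simp only [h3, bind_val] at h
        cases h4 : (pick (isFree s.clauses) s.live).val with
        | none => simp [h4] at h
        | some r =>
          obtain ⟨⟨v, g⟩, live⟩ := r
          simp only [h4, pure_val, Option.some.injEq] at h
          subst h
          obtain ⟨h5, h6⟩ := pick_some_perm h4
          exact .free v g live hirr h6 ((isFree_val _ _).1 h5)

/-- Each search that fails supplies one field of `Simplified`; a successful search without a result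
happens only for the empty clause. -/
theorem simplifyStep_none {s : State} (h : (simplifyStep s).val = none) :
    [] ∈ s.clauses ∨ Simplified s := by
  simp only [simplifyStep, bind_val] at h
  cases h1 : (pick isReducible s.clauses).val with
  | some r =>
    obtain ⟨c, cs⟩ := r
    simp only [h1] at h
    obtain ⟨h2, h3⟩ := pick_some_perm h1
    have := reduceClause_none h2 h
    subst this
    exact Or.inl (h3.mem_iff.2 (by simp))
  | none =>
    have hirr := irreducible_of_pick h1
    simp only [h1, bind_val] at h
    cases h2 : (dropDuplicate s.clauses).val with
    | some cs => simp [h2] at h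
    | none =>
      simp only [h2, bind_val] at h
      cases h3 : (pick (hasTwoSingletons s.clauses) s.clauses).val with
      | some r =>
        obtain ⟨c, cs⟩ := r
        have h4 := (pick_some_perm h3).1
        rw [hasTwoSingletons_val] at h4
        simp only [h3, bind_val, separate_val, isSingleton_val] at h
        cases h6 : c.filter (fun l => decide (s.clauses.countP (occurs l.var) = 1)) with
        | nil => simp [h6] at h4
        | cons l r =>
          cases r with
          | nil => simp [h6] at h4
          | cons m r => simp [h6] at h
      | none =>
        simp only [h3, bind_val] at h
        cases h4 : (pick (isFree s.clauses) s.live).val with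
        | some r => simp [h4] at h
        | none =>
          refine Or.inr ⟨hirr, dropDuplicate_none h2, fun c hc => ?_, fun x hx hv => ?_⟩
          · have := pick_none h3 c hc
            rw [hasTwoSingletons_val] at this
            simp only [decide_eq_false_iff_not] at this
            omega
          · have h5 := pick_none h4 x hx
            rw [(isFree_val _ _).2 hv] at h5
            exact absurd h5 (by simp)

/-! ## Invariants -/

/-- The variables of an instance are distinct, and include those of its clauses. -/
structure Inv (s : State) : Prop where
  nodup : (vars s.live).Nodup
  mem : ∀ c ∈ s.clauses, ∀ l ∈ c, l.var ∈ vars s.live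

theorem mem_assignClause {l x : Literal} {c d : Clause} (hd : d ∈ assignClause l c) (hx : x ∈ d) :
    x.var ≠ l.var ∧ ∃ y ∈ c, y.var = x.var := by
  unfold assignClause at hd
  split_ifs at hd with h
  · obtain ⟨m, hm, hd⟩ := List.mem_flatMap.1 hd
    unfold unitOf at hd
    split_ifs at hd with h1 h2
    · simp only [List.mem_singleton] at hd
      subst hd
      simp at hx
    · simp at hd
    · simp only [List.mem_singleton] at hd
      subst hd
      simp only [List.mem_singleton] at hx
      subst hx
      exact ⟨h1, m, List.mem_of_mem_erase hm, rfl⟩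
  · simp only [List.mem_singleton] at hd
    subst hd
    simp only [List.mem_filter, decide_eq_true_eq] at hx
    refine ⟨fun e => ?_, x, hx.1, rfl⟩
    rcases Literal.eq_or_eq_neg e with e | e
    · exact h (e ▸ hx.1)
    · exact hx.2 e

theorem mem_assign {l x : Literal} {d : Clause} {F : List Clause}
    (hd : d ∈ F.flatMap (assignClause l)) (hx : x ∈ d) :
    x.var ≠ l.var ∧ ∃ c ∈ F, ∃ y ∈ c, y.var = x.var := by
  obtain ⟨c, hc, hd⟩ := List.mem_flatMap.1 hd
  obtain ⟨h1, y, hy, h2⟩ := mem_assignClause hd hx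
  exact ⟨h1, c, hc, y, hy, h2⟩

theorem Inv.assign {s : State} {l : Literal} (h : Inv s) (hl : l.var ∈ vars s.live) :
    Inv (assign l s).val := by
  rw [assign_val]
  refine ⟨nodup_dropVar h.nodup hl, fun d hd x hx => ?_⟩
  obtain ⟨h1, c, hc, y, hy, h2⟩ := mem_assign hd hx
  rw [mem_vars_dropVar h.nodup hl]
  exact ⟨h2 ▸ h.mem c hc y hy, h1⟩

theorem substLit_var {l m x : Literal} :
    (substLit l m x).var = if x.var = l.var then m.var else x.var := by
  unfold substLit
  split_ifs <;> rfl

theorem Inv.link {s : State} {l m : Literal} (h : Inv s) (hl : l.var ∈ vars s.live)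
    (hm : m.var ∈ vars s.live) (hlm : l.var ≠ m.var) : Inv (link l m s).val := by
  rw [link_val]
  have hm' : m.var ∈ vars (dropVar l.var s.live).val :=
    (mem_vars_dropVar h.nodup hl).2 ⟨hm, hlm.symm⟩
  refine ⟨((vars_setGain _ hm').nodup_iff).2 (nodup_dropVar h.nodup hl), fun d hd x hx => ?_⟩
  rw [(vars_setGain _ hm').mem_iff, mem_vars_dropVar h.nodup hl]
  obtain ⟨c, hc, rfl⟩ := List.mem_map.1 hd
  obtain ⟨y, hy, rfl⟩ := List.mem_map.1 hx
  rw [substLit_var]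
  split_ifs with e
  · exact ⟨hm, hlm.symm⟩
  · exact ⟨h.mem c hc y hy, e⟩

theorem link_vars {s : State} {l m : Literal} (h : Inv s) (hl : l.var ∈ vars s.live)
    (hm : m.var ∈ vars s.live) (hlm : l.var ≠ m.var) :
    (vars (link l m s).val.live).Perm (vars (dropVar l.var s.live).val) := by
  rw [link_val]
  exact vars_setGain _ ((mem_vars_dropVar h.nodup hl).2 ⟨hm, hlm.symm⟩)

theorem linkDiffer_vars {s : State} {l m : Literal} (h : Inv s) (hl : l.var ∈ vars s.live)
    (hm : m.var ∈ vars s.live) (hlm : l.var ≠ m.var) :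
    (vars (linkDiffer l m s).val.live).Perm (vars (dropVar l.var s.live).val) := by
  have hp := link_vars h hl hm hlm
  rw [linkDiffer_val]
  exact (vars_setGain _ (hp.mem_iff.2 ((mem_vars_dropVar h.nodup hl).2 ⟨hm, hlm.symm⟩))).trans hp

theorem Inv.linkDiffer {s : State} {l m : Literal} (h : Inv s) (hl : l.var ∈ vars s.live)
    (hm : m.var ∈ vars s.live) (hlm : l.var ≠ m.var) : Inv (linkDiffer l m s).val := by
  have h1 := h.link hl hm hlm
  have hp := linkDiffer_vars h hl hm hlm
  refine ⟨hp.nodup_iff.2 (nodup_dropVar h.nodup hl), fun d hd x hx => ?_⟩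
  rw [linkDiffer_val] at hd
  rw [hp.mem_iff, ← (link_vars h hl hm hlm).mem_iff]
  exact h1.mem d hd x hx

theorem length_assign {s : State} {l : Literal} (hl : l.var ∈ vars s.live) :
    (assign l s).val.live.length + 1 = s.live.length := by
  rw [assign_val]; exact length_dropVar hl

theorem length_link {s : State} {l m : Literal} (hl : l.var ∈ vars s.live) :
    (link l m s).val.live.length + 1 = s.live.length := by
  rw [link_val]; simp only [setGain_length]; exact length_dropVar hl

theorem length_linkDiffer {s : State} {l m : Literal} (hl : l.var ∈ vars s.live) :
    (linkDiffer l m s).val.live.length + 1 = s.live.length := by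
  rw [linkDiffer_val]; simp only [setGain_length]; exact length_link hl

theorem size_assign (l : Literal) (s : State) : (assign l s).val.size ≤ s.size := by
  rw [assign_val]
  exact add_le_add (formSize_assign _ _) (dropVar_length_le _ _)

theorem size_link (l m : Literal) (s : State) : (link l m s).val.size ≤ s.size := by
  rw [link_val]
  simp only [State.size, formSize_map, setGain_length]
  exact Nat.add_le_add_left (dropVar_length_le _ _) _

theorem size_linkDiffer (l m : Literal) (s : State) : (linkDiffer l m s).val.size ≤ s.size := by
  refine le_trans ?_ (size_link l m s)
  rw [linkDiffer_val]
  simp only [State.size, setGain_length]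
  exact le_rfl

/-- The number of literal occurrences plus the number of variables. -/
def State.measure (s : State) : ℕ := litCount s.clauses + s.live.length

section

variable {s t : State}

theorem Simp.inv (h : Simp s t) (hs : Inv s) : Inv t := by
  cases h with
  | twice l c d hc hd => exact hs.assign (l := l.neg) (hs.mem c hc l (hd.mem_iff.2 (by simp)))
  | opposite l c d cs hc hd =>
    refine ⟨hs.nodup, fun e he x hx => ?_⟩
    rcases List.mem_append.1 he with he | he
    · obtain ⟨m, hm, rfl⟩ := List.mem_map.1 he
      simp only [List.mem_singleton] at hx
      subst hx
      exact hs.mem c (hc.mem_iff.2 (by simp)) m (hd.mem_iff.2 (by simp [hm]))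
    · exact hs.mem e (hc.mem_iff.2 (by simp [he])) x hx
  | unit l hl => exact hs.assign (hs.mem _ hl l (by simp))
  | pair l m cs hc hlm =>
    have hc' := hs.mem [l, m] (hc.mem_iff.2 (by simp))
    exact Inv.link (s := ⟨cs, s.live, s.acc⟩) ⟨hs.nodup, fun c h => hs.mem c (hc.mem_iff.2 (by simp [h]))⟩
      (hc' l (by simp)) (hc' m (by simp)) hlm
  | duplicate c d cs _ hc _ _ => exact ⟨hs.nodup, fun c h => hs.mem c (hc.mem_iff.2 (by simp [h]))⟩
  | merge l m c d cs hirr hc hd hl hm =>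
    have hcs : c ∈ s.clauses := hc.mem_iff.2 (by simp)
    have hml : m.var ∈ vars s.live := hs.mem c hcs m (hd.mem_iff.2 (by simp))
    have hll : l.var ∈ vars s.live := hs.mem c hcs l (hd.mem_iff.2 (by simp))
    have hn : ((m :: l :: d).map Literal.var).Nodup := (hd.map _).nodup_iff.1 (hirr c hcs).2
    have hlm : l.var ≠ m.var := fun e => by simp [e] at hn
    have hll' : l.var ∈ vars (dropVar m.var s.live).val :=
      (mem_vars_dropVar hs.nodup hml).2 ⟨hll, hlm⟩
    rw [mergeSingletons_val]
    refine ⟨((vars_setGain _ hll').nodup_iff).2 (nodup_dropVar hs.nodup hml), fun e he x hx => ?_⟩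
    rw [(vars_setGain _ hll').mem_iff, mem_vars_dropVar hs.nodup hml]
    rcases List.mem_cons.1 he with rfl | he
    · have he : (c.erase m).Perm (l :: d) := by simpa using hd.erase m
      refine ⟨hs.mem c hcs x (List.mem_of_mem_erase hx), fun e => ?_⟩
      rw [List.map_cons, List.nodup_cons] at hn
      exact hn.1 (e ▸ List.mem_map_of_mem (he.mem_iff.1 hx))
    · exact ⟨hs.mem e (hc.mem_iff.2 (by simp [he])) x hx, hm e he x hx⟩
  | free v g live hirr hl hv =>
    have hp : (vars s.live).Perm (v :: vars live) := hl.map _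
    refine ⟨(List.nodup_cons.1 (hp.nodup_iff.1 hs.nodup)).2, fun c hc x hx => ?_⟩
    have := hp.mem_iff.1 (hs.mem c hc x hx)
    rcases List.mem_cons.1 this with h | h
    · exact absurd h (hv c hc x hx)
    · exact h

theorem Simp.size_le (h : Simp s t) : t.size ≤ s.size := by
  cases h with
  | twice l c d hc hd => exact size_assign _ _
  | opposite l c d cs hc hd =>
    have h1 := hd.length_eq
    have h2 := length_le_clauseSize c
    simp only [State.size, formSize_append, formSize_units, formSize_perm hc, formSize_cons]
    simp only [List.length_cons] at h1
    omega
  | unit l hl => exact size_assign _ _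
  | pair l m cs hc hlm =>
    refine (size_link _ _ _).trans ?_
    simp only [State.size, formSize_perm hc, formSize_cons]
    omega
  | duplicate c d cs _ hc _ _ =>
    simp only [State.size, formSize_perm hc, formSize_cons]
    omega
  | merge l m c d cs hirr hc hd hl hm =>
    rw [mergeSingletons_val]
    simp only [State.size, formSize_perm hc, formSize_cons, setGain_length]
    have h1 := dropVar_length_le m.var s.live
    have h2 : clauseSize (c.erase m) ≤ clauseSize c := max_le_max List.length_erase_le le_rfl
    omega
  | free v g live hirr hl hv =>
    have := hl.length_eq
    simp only [List.length_cons] at this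
    simp only [State.size]
    omega

theorem Simp.live_le (h : Simp s t) : t.live.length ≤ s.live.length := by
  cases h with
  | twice l c d hc hd => rw [assign_val]; exact dropVar_length_le _ _
  | opposite l c d cs hc hd => exact le_rfl
  | unit l hl => rw [assign_val]; exact dropVar_length_le _ _
  | pair l m cs hc hlm =>
    rw [link_val]; simp only [setGain_length]; exact dropVar_length_le _ _
  | duplicate c d cs _ hc _ _ => exact le_rfl
  | merge l m c d cs hirr hc hd hl hm =>
    rw [mergeSingletons_val]; simp only [setGain_length]; exact dropVar_length_le _ _
  | free v g live hirr hl hv =>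
    have := hl.length_eq
    simp only [List.length_cons] at this
    simp only
    omega

/-- Every rule removes a variable or at least one literal occurrence. Dropping a duplicate relies on
irreducibility here: an empty clause would carry no occurrence. -/
theorem Simp.measure_lt (h : Simp s t) (hs : Inv s) : t.measure < s.measure := by
  cases h with
  | twice l c d hc hd =>
    have h1 := length_assign (s := s) (l := l.neg) (hs.mem c hc l (hd.mem_iff.2 (by simp)))
    have h2 := litCount_assign l.neg s.clauses
    rw [assign_val] at *
    simp only [State.measure] at *
    omega
  | opposite l c d cs hc hd =>
    have h1 := hd.length_eq
    simp only [State.measure, litCount_append, litCount_units, litCount_perm hc, litCount_cons]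
    simp only [List.length_cons] at h1
    omega
  | unit l hl =>
    have h1 := length_assign (s := s) (hs.mem _ hl l (by simp))
    have h2 := litCount_assign l s.clauses
    rw [assign_val] at *
    simp only [State.measure] at *
    omega
  | pair l m cs hc hlm =>
    rw [link_val]
    have := dropVar_length_le l.var s.live
    simp only [State.measure, litCount_perm hc, litCount_cons, litCount_map, setGain_length,
      List.length_cons]
    omega
  | duplicate c d cs hirr hc _ _ =>
    have := (hirr c (hc.mem_iff.2 (by simp))).1
    simp only [State.measure, litCount_perm hc, litCount_cons]
    omega
  | merge l m c d cs hirr hc hd hl hm =>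
    rw [mergeSingletons_val]
    have h1 := dropVar_length_le m.var s.live
    have h2 := (List.perm_cons_erase (hd.mem_iff.2 (by simp) : m ∈ c)).length_eq
    simp only [List.length_cons] at h2
    simp only [State.measure, litCount_perm hc, litCount_cons, setGain_length]
    omega
  | free v g live hirr hl hv =>
    have := hl.length_eq
    simp only [List.length_cons] at this
    simp only [State.measure]
    omega

end

/-! ## The result of the simplifications -/

/-- Repeated simplification. -/
abbrev Simps : State → State → Prop := Relation.ReflTransGen Simp

theorem Simps.inv {s t : State} (h : Simps s t) (hs : Inv s) : Inv t := by
  induction h with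
  | refl => exact hs
  | tail _ h ih => exact h.inv ih

theorem Simps.size_le {s t : State} (h : Simps s t) : t.size ≤ s.size := by
  induction h with
  | refl => exact le_rfl
  | tail _ h ih => exact h.size_le.trans ih

theorem Simps.live_le {s t : State} (h : Simps s t) : t.live.length ≤ s.live.length := by
  induction h with
  | refl => exact le_rfl
  | tail _ h ih => exact h.live_le.trans ih

theorem simplifyLoop_spec (k : ℕ) {s : State} (hs : Inv s) (hk : s.measure < k) :
    Simps s (simplifyLoop k s).val ∧
      ([] ∈ (simplifyLoop k s).val.clauses ∨ Simplified (simplifyLoop k s).val) := by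
  induction k generalizing s with
  | zero => omega
  | succ k ih =>
    simp only [simplifyLoop, bind_val]
    cases h : (simplifyStep s).val with
    | none => exact ⟨.refl, simplifyStep_none h⟩
    | some t =>
      have h1 := simplifyStep_some h
      have h2 := h1.measure_lt hs
      obtain ⟨h3, h4⟩ := ih (h1.inv hs) (by omega)
      exact ⟨.head h1 h3, h4⟩

/-- The loop is given one more round than the measure, which decreases in every round, so it ends
because nothing applies and not because the rounds run out. -/
theorem simplify_spec {s : State} (hs : Inv s) :
    Simps s (simplify s).val ∧
      ([] ∈ (simplify s).val.clauses ∨ Simplified (simplify s).val) := by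
  simp only [simplify, bind_val, len_val, countLits_val]
  exact simplifyLoop_spec _ hs (by unfold State.measure; omega)

theorem simplifyStep_cost {n : ℕ} {s : State} (h : Small n s.clauses s.live) :
    Cost (simplifyStep s) ((n + 10) ^ 6) := by
  refine (Cost.tick_bind (((pick_cost fun c hc => isReducible_cost (h.clause c hc)).mono
    (b := (n + 10) ^ 3) ?_).bind (b := 6 * (n + 10) ^ 5) ?_)).mono ?_
  · have := Nat.mul_le_mul_left ((n + 10) ^ 2 + 1) h.clauses
    ring_nf at *
    nlinarith [Nat.zero_le (n ^ 3), Nat.zero_le (n ^ 2)]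
  · cases h1 : (pick isReducible s.clauses).val with
    | some r =>
      obtain ⟨c, cs⟩ := r
      have h2 := (pick_some_perm h1).2
      have h3 := h2.length_eq
      simp only [List.length_cons] at h3
      refine (reduceClause_cost (h.clause c (h2.mem_iff.2 (by simp)))
        (fun d hd => h.clause d (h2.mem_iff.2 (by simp [hd]))) ?_ h).mono ?_
      · have := h.clauses; omega
      · refine (Nat.pow_le_pow_right (by omega) (by omega : 4 ≤ 5)).trans ?_
        omega
    | none =>
      refine (((dropDuplicate_cost h.clause h.clauses).mono (b := (n + 10) ^ 5) ?_).bind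
        (b := 3 * (n + 10) ^ 5) ?_).mono (by omega)
      · have := Nat.mul_le_mul_left ((n + 10) ^ 4) h.clauses
        ring_nf at *
        nlinarith [Nat.zero_le (n ^ 4), Nat.zero_le (n ^ 3), Nat.zero_le (n ^ 2)]
      · split
        · exact Cost.pure _ _
        · refine (((pick_cost fun c hc =>
            hasTwoSingletons_cost h.clause h.clauses (h.clause c hc)).mono
            (b := (n + 10) ^ 5) ?_).bind (b := 2 * (n + 10) ^ 5) ?_).mono (by omega)
          · refine le_trans ?_ (Nat.pow_le_pow_right (by omega) (by omega : 4 ≤ 5))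
            have := Nat.mul_le_mul_left ((n + 10) ^ 3 + 1) h.clauses
            ring_nf at *
            nlinarith [Nat.zero_le (n ^ 4), Nat.zero_le (n ^ 3), Nat.zero_le (n ^ 2)]
          · split
            · next c cs h3 =>
              have h4 := (pick_some_perm h3).2
              have hc := h.clause c (h4.mem_iff.2 (by simp))
              refine (((separate_cost fun l _ => (isSingleton_cost h.clause l).mono
                (b := (n + 10) ^ 2) ?_).mono (b := (n + 10) ^ 5) ?_).bind
                (b := (n + 10) ^ 5) ?_).mono (by omega)
              · nlinarith [Nat.mul_le_mul_left (n + 2) h.clauses]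
              · refine le_trans ?_ (Nat.pow_le_pow_right (by omega) (by omega : 3 ≤ 5))
                have := Nat.mul_le_mul_left ((n + 10) ^ 2 + 1) hc
                ring_nf at *
                nlinarith [Nat.zero_le (n ^ 3), Nat.zero_le (n ^ 2)]
              · split
                · exact ((mergeSingletons_cost _ _ _ hc h.live).mono
                    (Nat.pow_le_pow_right (by omega) (by omega))).bind_pure
                · exact Cost.pure _ _
            · refine (((pick_cost fun x _ => isFree_cost h.clause h.clauses x).mono
                (b := (n + 10) ^ 5) ?_).bind (b := 0) ?_).mono (by omega)
              · refine le_trans ?_ (Nat.pow_le_pow_right (by omega) (by omega : 3 ≤ 5))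
                have := Nat.mul_le_mul_left ((n + 10) ^ 2 + 1) h.live
                ring_nf at *
                nlinarith [Nat.zero_le (n ^ 3), Nat.zero_le (n ^ 2)]
              · split <;> exact Cost.pure _ _
  · have h3 : (n + 10) ^ 3 ≤ (n + 10) ^ 5 := Nat.pow_le_pow_right (by omega) (by omega)
    have h5 : 1 ≤ (n + 10) ^ 5 := Nat.one_le_pow _ _ (by omega)
    have h6 : 10 * (n + 10) ^ 5 ≤ (n + 10) ^ 6 := by
      rw [pow_succ (n + 10) 5, mul_comm]; exact Nat.mul_le_mul_left _ (by omega)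
    omega

theorem countLits_cost {n : ℕ} {F : List Clause} (h : ∀ c ∈ F, c.length ≤ n) :
    Cost (countLits F) ((n + 2) * F.length + 1) := by
  induction F with
  | nil => exact Cost.tick_pure _ (by simp)
  | cons c F ih =>
    have ih := ih fun y hy => h y (by simp [hy])
    have hc := h c (by simp)
    exact (Cost.tick_bind ((len_cost c).bind ih.bind_pure)).mono
      (by simp only [List.length_cons]; ring_nf; omega)

theorem simplifyLoop_cost {n : ℕ} (k : ℕ) {s : State} (h : s.size ≤ n) :
    Cost (simplifyLoop k s) (((n + 10) ^ 6 + 1) * k + 1) := by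
  induction k generalizing s with
  | zero => exact Cost.tick_pure _ (by simp)
  | succ k ih =>
    refine (Cost.tick_bind ((simplifyStep_cost (State.small h)).bind
      (b := ((n + 10) ^ 6 + 1) * k + 1) ?_)).mono (by ring_nf; omega)
    split
    · exact Cost.pure _ _
    · next t ht => exact ih ((simplifyStep_some ht).size_le.trans h)

theorem simplify_cost {n : ℕ} {s : State} (h : s.size ≤ n) :
    Cost (simplify s) ((n + 10) ^ 8) := by
  have hs := State.small h
  have hk : s.live.length + litCount s.clauses + 1 ≤ n + 1 := by
    have := litCount_le_formSize s.clauses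
    unfold State.size at h
    omega
  refine (Cost.tick_bind (((len_cost _).mono (Nat.succ_le_succ hs.live)).bind
    (((countLits_cost hs.clause).mono
      (Nat.succ_le_succ (Nat.mul_le_mul_left _ hs.clauses))).bind
    ((simplifyLoop_cost _ h).mono (b := ((n + 10) ^ 6 + 1) * (n + 1) + 1) ?_)))).mono ?_
  · simp only [len_val, countLits_val]
    exact Nat.succ_le_succ (Nat.mul_le_mul_left _ hk)
  · have h6 : (n + 10) ^ 2 ≤ (n + 10) ^ 6 := Nat.pow_le_pow_right (by omega) (by omega)
    have h8 : (n + 10) ^ 8 = (n + 10) ^ 6 * (n + 10) ^ 2 := by rw [← pow_add]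
    rw [h8]
    simp only [Nat.succ_eq_add_one]
    generalize (n + 10) ^ 6 = Y at *
    nlinarith [Nat.zero_le (Y * n), Nat.zero_le (Y * n ^ 2)]

/-! ## Semantics of the instances -/

/-- The value of a literal under an assignment to all variables. -/
def litv (M : ℕ → Bool) (l : Literal) : Bool := M l.var == l.pos

/-- Exactly one literal of the clause is true. -/
def SatC (M : ℕ → Bool) (c : Clause) : Prop := c.countP (litv M) = 1

/-- Every clause contains exactly one true literal. -/
def Sat (M : ℕ → Bool) (F : List Clause) : Prop := ∀ c ∈ F, SatC M c

/-- The entry of a record for the values of a variable under two assignments. -/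
def gv (g : Gain) (a b : Bool) : WithBot ℕ := if a = b then (if a then g.tt else g.ff) else g.df

/-- The sum of the entries of the records for two assignments. -/
def score (live : List (ℕ × Gain)) (M M' : ℕ → Bool) : WithBot ℕ :=
  (live.map fun x => gv x.2 (M x.1) (M' x.1)).sum

/-- The number of differences that two models of an instance stand for. -/
def total (s : State) (M M' : ℕ → Bool) : WithBot ℕ := s.acc + score s.live M M'

/-- `b` is an upper bound for the number of differences over pairs of models with a property. -/
def UBOn (P : (ℕ → Bool) → (ℕ → Bool) → Prop) (s : State) (b : WithBot ℕ) : Prop :=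
  ∀ M M', Sat M s.clauses → Sat M' s.clauses → P M M' → total s M M' ≤ b

/-- `b` is an upper bound for the number of differences over pairs of models. -/
def UB (s : State) (b : WithBot ℕ) : Prop :=
  ∀ M M', Sat M s.clauses → Sat M' s.clauses → total s M M' ≤ b

@[simp] theorem litv_neg (M : ℕ → Bool) (l : Literal) : litv M l.neg = !litv M l := by
  unfold litv
  cases h : M l.var <;> cases h' : l.pos <;> simp [h, h']

theorem litv_congr {M N : ℕ → Bool} {l : Literal} (h : M l.var = N l.var) :
    litv M l = litv N l := by unfold litv; rw [h]

theorem SatC.perm {M : ℕ → Bool} {c d : Clause} (h : c.Perm d) : SatC M c ↔ SatC M d := by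
  unfold SatC; rw [h.countP_eq]

theorem satC_congr {M N : ℕ → Bool} {c : Clause} (h : ∀ l ∈ c, litv M l = litv N l) :
    SatC M c ↔ SatC N c := by
  unfold SatC
  rw [List.countP_congr (q := litv N) fun l hl => by rw [h l hl]]

theorem sat_congr {M N : ℕ → Bool} {F : List Clause} (h : ∀ c ∈ F, ∀ l ∈ c, M l.var = N l.var) :
    Sat M F ↔ Sat N F :=
  forall₂_congr fun c hc => satC_congr fun l hl => litv_congr (h c hc l hl)

theorem Sat.perm {M : ℕ → Bool} {F G : List Clause} (h : F.Perm G) : Sat M F ↔ Sat M G :=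
  forall_congr' fun c => by rw [h.mem_iff]

@[simp] theorem sat_cons {M : ℕ → Bool} {c : Clause} {F : List Clause} :
    Sat M (c :: F) ↔ SatC M c ∧ Sat M F := by simp [Sat]

@[simp] theorem sat_append {M : ℕ → Bool} {F G : List Clause} :
    Sat M (F ++ G) ↔ Sat M F ∧ Sat M G := by
  simp only [Sat, List.mem_append]
  exact ⟨fun h => ⟨fun c hc => h c (Or.inl hc), fun c hc => h c (Or.inr hc)⟩,
    fun h c hc => hc.elim (h.1 c) (h.2 c)⟩

theorem satC_cons {M : ℕ → Bool} {l : Literal} {c : Clause} :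
    SatC M (l :: c) ↔ if litv M l then (∀ m ∈ c, litv M m = false) else SatC M c := by
  unfold SatC
  split_ifs with h
  · rw [List.countP_cons_of_pos h, Nat.add_eq_right, List.countP_eq_zero]
    simp
  · rw [List.countP_cons_of_neg h]

theorem score_perm {live live' : List (ℕ × Gain)} (h : live.Perm live') (M M' : ℕ → Bool) :
    score live M M' = score live' M M' := (h.map _).sum_eq

@[simp] theorem score_cons (x : ℕ × Gain) (live : List (ℕ × Gain)) (M M' : ℕ → Bool) :
    score (x :: live) M M' = gv x.2 (M x.1) (M' x.1) + score live M M' := by simp [score]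

theorem score_congr {live : List (ℕ × Gain)} {M M' N N' : ℕ → Bool}
    (h : ∀ v ∈ vars live, M v = N v) (h' : ∀ v ∈ vars live, M' v = N' v) :
    score live M M' = score live N N' := by
  unfold score
  congr 1
  refine List.map_congr_left fun x hx => ?_
  rw [h x.1 (List.mem_map_of_mem hx), h' x.1 (List.mem_map_of_mem hx)]

theorem score_eq {v : ℕ} {live : List (ℕ × Gain)} (hv : v ∈ vars live) (M M' : ℕ → Bool) :
    score live M M' = gv (getGain v live).val (M v) (M' v) + score (dropVar v live).val M M' := by
  rw [score_perm (live_perm hv), score_cons]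

theorem score_setGain {v : ℕ} {live : List (ℕ × Gain)} (hv : v ∈ vars live) (g : Gain)
    (M M' : ℕ → Bool) :
    score (setGain v g live).val M M' = gv g (M v) (M' v) + score (dropVar v live).val M M' := by
  rw [score_perm (setGain_perm g hv), score_cons]

theorem orient_orient (l : Literal) (g : Gain) : (g.orient l).orient l = g := by
  unfold Gain.orient
  cases l.pos <;> simp

/-- Orienting a record and reading it at the values of the literal is the same as reading the
original at the values of the variable; a negation exchanges the two equal-value cases and leaves
the third alone. -/
theorem gv_orient (l : Literal) (g : Gain) (M M' : ℕ → Bool) :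
    gv (g.orient l) (litv M l) (litv M' l) = gv g (M l.var) (M' l.var) := by
  unfold Gain.orient litv gv
  cases l.pos <;> cases M l.var <;> cases M' l.var <;> rfl

theorem gv_orient' (l : Literal) (g : Gain) (M M' : ℕ → Bool) :
    gv (g.orient l) (M l.var) (M' l.var) = gv g (litv M l) (litv M' l) := by
  rw [← gv_orient l (g.orient l), orient_orient]

/-- Change the value of a literal. -/
def setLit (M : ℕ → Bool) (l : Literal) (b : Bool) : ℕ → Bool :=
  Function.update M l.var (b == l.pos)

@[simp] theorem litv_setLit (M : ℕ → Bool) (l : Literal) (b : Bool) :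
    litv (setLit M l b) l = b := by
  unfold litv setLit
  rw [Function.update_self]
  cases b <;> cases l.pos <;> rfl

theorem setLit_of_ne {M : ℕ → Bool} {l : Literal} {b : Bool} {v : ℕ} (h : v ≠ l.var) :
    setLit M l b v = M v := Function.update_of_ne h _ _

theorem litv_setLit_of_ne {M : ℕ → Bool} {l m : Literal} {b : Bool} (h : m.var ≠ l.var) :
    litv (setLit M l b) m = litv M m := litv_congr (setLit_of_ne h)

theorem sat_setLit {M : ℕ → Bool} {l : Literal} {b : Bool} {F : List Clause}
    (h : Absent l.var F) : Sat (setLit M l b) F ↔ Sat M F :=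
  sat_congr fun c hc m hm => setLit_of_ne (h c hc m hm)

theorem score_setLit {live : List (ℕ × Gain)} {M M' : ℕ → Bool} {l : Literal} {b b' : Bool}
    (h : l.var ∉ vars live) : score live (setLit M l b) (setLit M' l b') = score live M M' :=
  score_congr (fun _ hv => setLit_of_ne fun e => h (e ▸ hv))
    (fun _ hv => setLit_of_ne fun e => h (e ▸ hv))

theorem notMem_dropVar {v : ℕ} {live : List (ℕ × Gain)} (hn : (vars live).Nodup)
    (hv : v ∈ vars live) : v ∉ vars (dropVar v live).val := by
  rw [mem_vars_dropVar hn hv]; simp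

/-! ### Assigning a value -/

theorem satC_flatMap_unitOf {M : ℕ → Bool} {l : Literal} (hl : litv M l = true) (c : Clause) :
    Sat M (c.flatMap (unitOf l)) ↔ ∀ m ∈ c, litv M m = false := by
  induction c with
  | nil => simp [Sat]
  | cons m c ih =>
    rw [List.flatMap_cons, sat_append, ih, List.forall_mem_cons]
    refine and_congr_left fun _ => ?_
    unfold unitOf
    split_ifs with h1 h2
    · rw [Literal.ext_iff'.2 ⟨h1, h2⟩, hl]
      simp [Sat, SatC]
    · have : m = l.neg := by
        rcases Literal.eq_or_eq_neg h1 with e | e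
        · exact absurd (by rw [e]) h2
        · exact e
      simp [this, hl, Sat]
    · cases h : litv M m <;> simp [Sat, SatC, h]

theorem sat_assignClause {M : ℕ → Bool} {l : Literal} (hl : litv M l = true) (c : Clause) :
    Sat M (assignClause l c) ↔ SatC M c := by
  unfold assignClause
  split_ifs with h
  · rw [satC_flatMap_unitOf hl, SatC.perm (List.perm_cons_erase h), satC_cons, if_pos hl]
  · rw [sat_cons, and_iff_left (by simp [Sat])]
    unfold SatC
    rw [List.countP_filter, List.countP_congr]
    intro m _
    by_cases e : m = l.neg
    · simp [e, hl]
    · simp [e]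

theorem sat_assign {M : ℕ → Bool} {l : Literal} (hl : litv M l = true) (F : List Clause) :
    Sat M (F.flatMap (assignClause l)) ↔ Sat M F := by
  induction F with
  | nil => simp
  | cons c F ih => rw [List.flatMap_cons, sat_append, ih, sat_assignClause hl, sat_cons]

theorem total_assign {s : State} {l : Literal} (hl : l.var ∈ vars s.live) {M M' : ℕ → Bool}
    (hM : litv M l = true) (hM' : litv M' l = true) :
    total (assign l s).val M M' = total s M M' := by
  rw [assign_val]
  unfold total
  rw [score_eq hl, ← gv_orient, hM, hM', add_assoc]
  rfl

/-- The variable of `l` no longer occurs after the assignment, neither in the clauses nor in the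
records. A model of the new instance may thus be changed there to make `l` true, and then both
totals agree. -/
theorem assign_ub {s : State} {l : Literal} (hs : Inv s) (hl : l.var ∈ vars s.live)
    (b : WithBot ℕ) :
    UB (assign l s).val b ↔ UBOn (fun M M' => litv M l = true ∧ litv M' l = true) s b := by
  constructor
  · rintro h M M' hM hM' ⟨h1, h2⟩
    rw [← total_assign hl h1 h2]
    refine h M M' ?_ ?_ <;> rw [assign_val]
    · exact (sat_assign h1 _).2 hM
    · exact (sat_assign h2 _).2 hM'
  · intro h M M' hM hM'
    have ha : Absent l.var (assign l s).val.clauses := by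
      rw [assign_val]; exact fun d hd x hx => (mem_assign hd hx).1
    have h1 := litv_setLit M l true
    have h2 := litv_setLit M' l true
    have h3 : total (assign l s).val M M' =
        total (assign l s).val (setLit M l true) (setLit M' l true) := by
      unfold total
      rw [assign_val]
      dsimp only
      rw [score_setLit (notMem_dropVar hs.nodup hl)]
    rw [h3, total_assign hl h1 h2]
    rw [← sat_setLit ha (b := true)] at hM hM'
    rw [assign_val] at hM hM'
    exact h _ _ ((sat_assign h1 _).1 hM) ((sat_assign h2 _).1 hM') ⟨h1, h2⟩

/-! ### Linking a variable -/

theorem litv_substLit {M : ℕ → Bool} {l m : Literal} (h : litv M l = litv M m) (x : Literal) :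
    litv M (substLit l m x) = litv M x := by
  unfold substLit
  split_ifs with h1 h2
  · rw [← h, Literal.ext_iff'.2 ⟨h1, h2⟩]
  · rcases Literal.eq_or_eq_neg h1 with e | e
    · exact absurd (by rw [e]) h2
    · rw [e, litv_neg, litv_neg, h]
  · rfl

theorem satC_subst {M : ℕ → Bool} {l m : Literal} (h : litv M l = litv M m) (c : Clause) :
    SatC M (c.map (substLit l m)) ↔ SatC M c := by
  unfold SatC
  rw [List.countP_map, List.countP_congr]
  intro x _
  simp [litv_substLit h]

theorem sat_subst {M : ℕ → Bool} {l m : Literal} (h : litv M l = litv M m) (F : List Clause) :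
    Sat M (F.map (List.map (substLit l m))) ↔ Sat M F := by
  simp only [Sat, List.forall_mem_map, satC_subst h]

/-- The first record is read at negated values because `l` has been replaced by the negation of `m`.
-/
theorem gv_linkGain (a b : Gain) (x y : Bool) :
    gv (linkGain a b) x y = gv b x y + gv a (!x) (!y) := by
  cases x <;> cases y <;> rfl

theorem total_link {s : State} {l m : Literal} (hs : Inv s) (hl : l.var ∈ vars s.live)
    (hm : m.var ∈ vars s.live) (hlm : l.var ≠ m.var) {M M' : ℕ → Bool}
    (hM : litv M l = !litv M m) (hM' : litv M' l = !litv M' m) :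
    total (link l m s).val M M' = total s M M' := by
  have hm' := (mem_vars_dropVar hs.nodup hl).2 ⟨hm, hlm.symm⟩
  have hg : (getGain m.var (dropVar l.var s.live).val).val = (getGain m.var s.live).val := by
    clear hs hm hm'
    generalize s.live = live at hl ⊢
    induction live with
    | nil => simp at hl
    | cons x xs ih =>
      obtain ⟨u, g⟩ := x
      by_cases h : u = l.var
      · subst h
        simp [dropVar, getGain, hlm]
      · have hl' : l.var ∈ vars xs := by simpa [Ne.symm h] using hl
        by_cases h' : u = m.var
        · simp [dropVar, getGain, h', hlm.symm]
        · simp [dropVar, getGain, h, h', ih hl']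
  rw [link_val]
  unfold total
  rw [score_setGain hm', gv_orient', gv_linkGain, ← hM, ← hM', gv_orient, gv_orient,
    score_eq hl, score_eq hm', hg]
  dsimp only
  congr 1
  rw [add_comm (gv _ (M m.var) _), add_assoc]

/-- The new instance does not mention the variable of `l`, so its value can be chosen opposite to
that of `m`. The side condition `P`, insensitive to this variable, serves both plain linking and the
case of differing values. -/
theorem link_ub {s : State} {l m : Literal} (hs : Inv s) (hl : l.var ∈ vars s.live)
    (hm : m.var ∈ vars s.live) (hlm : l.var ≠ m.var) (P : (ℕ → Bool) → (ℕ → Bool) → Prop)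
    (hP : ∀ M M' b b', P (setLit M l b) (setLit M' l b') ↔ P M M') (b : WithBot ℕ) :
    UBOn P (link l m s).val b ↔
      UBOn (fun M M' => (litv M l = !litv M m) ∧ (litv M' l = !litv M' m) ∧ P M M') s b := by
  constructor
  · rintro h M M' hM hM' ⟨h1, h2, h3⟩
    rw [← total_link hs hl hm hlm h1 h2]
    refine h M M' ?_ ?_ h3 <;> rw [link_val]
    · exact (sat_subst (by simpa using h1) _).2 hM
    · exact (sat_subst (by simpa using h2) _).2 hM'
  · intro h M M' hM hM' h3
    have ha : Absent l.var (link l m s).val.clauses := by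
      rw [link_val]
      intro d hd x hx
      obtain ⟨c, hc, rfl⟩ := List.mem_map.1 hd
      obtain ⟨y, hy, rfl⟩ := List.mem_map.1 hx
      rw [substLit_var]
      split_ifs with e
      · exact hlm.symm
      · exact e
    have h1 : litv (setLit M l !litv M m) l = !litv (setLit M l !litv M m) m := by
      rw [litv_setLit, litv_setLit_of_ne hlm.symm]
    have h2 : litv (setLit M' l !litv M' m) l = !litv (setLit M' l !litv M' m) m := by
      rw [litv_setLit, litv_setLit_of_ne hlm.symm]
    have h4 : total (link l m s).val M M' =
        total (link l m s).val (setLit M l !litv M m) (setLit M' l !litv M' m) := by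
      unfold total
      rw [score_setLit]
      rw [(link_vars hs hl hm hlm).mem_iff]
      exact notMem_dropVar hs.nodup hl
    rw [h4, total_link hs hl hm hlm h1 h2]
    rw [← sat_setLit ha (b := !litv M m)] at hM
    rw [← sat_setLit ha (b := !litv M' m)] at hM'
    rw [link_val] at hM hM'
    exact h _ _ ((sat_subst (by simpa using h1) _).1 hM) ((sat_subst (by simpa using h2) _).1 hM')
      ⟨h1, h2, (hP _ _ _ _).2 h3⟩

/-- Setting two entries of the record of `m` to `⊥` makes the total `⊥` for models that agree at
`m`. Such pairs satisfy every bound, which amounts to leaving them out. -/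
theorem linkDiffer_ub {s : State} {l m : Literal} (hs : Inv s) (hl : l.var ∈ vars s.live)
    (hm : m.var ∈ vars s.live) (hlm : l.var ≠ m.var) (b : WithBot ℕ) :
    UB (linkDiffer l m s).val b ↔
      UBOn (fun M M' => (litv M l = !litv M m) ∧ (litv M' l = !litv M' m) ∧ M m.var ≠ M' m.var)
        s b := by
  rw [← link_ub hs hl hm hlm (fun M M' => M m.var ≠ M' m.var)
    (fun M M' b b' => by rw [setLit_of_ne hlm.symm, setLit_of_ne hlm.symm])]
  have hm' : m.var ∈ vars (link l m s).val.live :=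
    (link_vars hs hl hm hlm).mem_iff.2 ((mem_vars_dropVar hs.nodup hl).2 ⟨hm, hlm.symm⟩)
  rw [linkDiffer_val]
  unfold UB UBOn
  refine forall₄_congr fun M M' _ _ => ?_
  unfold total
  simp only [score_setGain hm']
  by_cases h : M m.var = M' m.var
  · have : gv ⟨⊥, ⊥, (getGain m.var (link l m s).val.live).val.df⟩ (M m.var) (M' m.var) = ⊥ := by
      unfold gv; rw [if_pos h]; simp
    rw [this]
    simp [h]
  · have : gv ⟨⊥, ⊥, (getGain m.var (link l m s).val.live).val.df⟩ (M m.var) (M' m.var) =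
        gv (getGain m.var (link l m s).val.live).val (M m.var) (M' m.var) := by
      unfold gv; rw [if_neg h, if_neg h]
    rw [this, score_eq hm']
    simp [h]

/-! ### Merging singletons -/

theorem gv_mergeGain_le {a b : Gain} {x y x' y' : Bool} (h : (x && y) = false)
    (h' : (x' && y') = false) :
    gv a x x' + gv b y y' ≤ gv (mergeGain a b) (x || y) (x' || y') := by
  cases x <;> cases y <;> cases x' <;> cases y' <;> simp_all [gv, mergeGain]

/-- Together with the preceding inequality this shows that the merged record is the maximum over all
values of the two singletons, not both true, that yield the given disjunctions. -/
theorem exists_gv_mergeGain (a b : Gain) (p p' : Bool) :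
    ∃ x y x' y' : Bool, (x && y) = false ∧ (x' && y') = false ∧ (x || y) = p ∧ (x' || y') = p' ∧
      gv (mergeGain a b) p p' = gv a x x' + gv b y y' := by
  cases p <;> cases p'
  · exact ⟨false, false, false, false, by simp [gv, mergeGain]⟩
  · rcases max_choice (a.df + b.ff) (a.ff + b.df) with h | h
    · exact ⟨false, false, true, false, by simp [gv, mergeGain, h]⟩
    · exact ⟨false, false, false, true, by simp [gv, mergeGain, h]⟩
  · rcases max_choice (a.df + b.ff) (a.ff + b.df) with h | h
    · exact ⟨true, false, false, false, by simp [gv, mergeGain, h]⟩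
    · exact ⟨false, true, false, false, by simp [gv, mergeGain, h]⟩
  · rcases max_choice (max (a.tt + b.ff) (a.ff + b.tt)) (a.df + b.df) with h | h
    · rcases max_choice (a.tt + b.ff) (a.ff + b.tt) with h1 | h1
      · exact ⟨true, false, true, false, rfl, rfl, rfl, rfl, h.trans h1⟩
      · exact ⟨false, true, false, true, rfl, rfl, rfl, rfl, h.trans h1⟩
    · exact ⟨true, false, false, true, by simp [gv, mergeGain, h]⟩

/-- Two singletons of a clause, and the instance after merging them. -/
theorem merge_ub {s : State} {l m : Literal} {c d : Clause} {cs : List Clause} (hs : Inv s)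
    (hirr : Irreducible s.clauses) (hc : s.clauses.Perm (c :: cs)) (hd : c.Perm (m :: l :: d))
    (hl : Absent l.var cs) (hm : Absent m.var cs) (b : WithBot ℕ) :
    UB s b ↔ UB (mergeSingletons l m c cs s).val b := by
  have hcs : c ∈ s.clauses := hc.mem_iff.2 (by simp)
  have hml : m.var ∈ vars s.live := hs.mem c hcs m (hd.mem_iff.2 (by simp))
  have hll : l.var ∈ vars s.live := hs.mem c hcs l (hd.mem_iff.2 (by simp))
  have hn : ((m :: l :: d).map Literal.var).Nodup := (hd.map _).nodup_iff.1 (hirr c hcs).2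
  simp only [List.map_cons, List.nodup_cons, List.mem_cons, not_or, List.mem_map, not_exists,
    not_and] at hn
  have hlm : l.var ≠ m.var := fun e => hn.1.1 e.symm
  have hmd : ∀ x ∈ d, x.var ≠ m.var := fun x hx => hn.1.2 x hx
  have hld : ∀ x ∈ d, x.var ≠ l.var := fun x hx => hn.2.1 x hx
  have hnd := nodup_dropVar hs.nodup hml
  have hll' : l.var ∈ vars (dropVar m.var s.live).val :=
    (mem_vars_dropVar hs.nodup hml).2 ⟨hll, hlm⟩
  have he : (c.erase m).Perm (l :: d) := by simpa using hd.erase m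
  set a := (getGain l.var s.live).val with ha
  set e := (getGain m.var s.live).val with he'
  have hga : (getGain l.var (dropVar m.var s.live).val).val = a := by
    have h1 : (l.var, a) ∈ s.live := (live_perm hll).mem_iff.2 (by simp [ha])
    have h2 : (l.var, a) ∈ (dropVar m.var s.live).val := by
      have := (live_perm hml).mem_iff.1 h1
      rcases List.mem_cons.1 this with h | h
      · exact absurd (Prod.mk.inj h).1 hlm
      · exact h
    have h3 := (live_perm hll').mem_iff.1 h2
    rcases List.mem_cons.1 h3 with h | h
    · exact (Prod.mk.inj h).2.symm
    · exact absurd (List.mem_map_of_mem (f := Prod.fst) h) (notMem_dropVar hnd hll')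
  set rest := (dropVar l.var (dropVar m.var s.live).val).val with hrest
  have hrl : l.var ∉ vars rest := notMem_dropVar hnd hll'
  have hrm : m.var ∉ vars rest := fun h =>
    notMem_dropVar hs.nodup hml ((mem_vars_dropVar hnd hll').1 h).1
  have ht1 : ∀ M M', total s M M' = s.acc + ((gv (a.orient l) (litv M l) (litv M' l) +
      gv (e.orient m) (litv M m) (litv M' m)) + score rest M M') := by
    intro M M'
    unfold total
    rw [score_eq hml, score_eq hll', hga, gv_orient, gv_orient, ← he', ← hrest]
    congr 1
    rw [add_comm (gv a _ _), add_assoc, ← add_assoc, add_comm]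
  have ht2 : ∀ M M', total (mergeSingletons l m c cs s).val M M' =
      s.acc + (gv (mergeGain (a.orient l) (e.orient m)) (litv M l) (litv M' l) +
        score rest M M') := by
    intro M M'
    rw [mergeSingletons_val]
    unfold total
    rw [score_setGain hll', gv_orient']
  have hsat1 : ∀ M, Sat M s.clauses ↔ SatC M (m :: l :: d) ∧ Sat M cs := by
    intro M
    rw [Sat.perm hc, sat_cons, SatC.perm hd]
  have hsat2 : ∀ M, Sat M (mergeSingletons l m c cs s).val.clauses ↔
      SatC M (l :: d) ∧ Sat M cs := by
    intro M
    rw [mergeSingletons_val, sat_cons, SatC.perm he]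
  constructor
  · intro h N N' hN hN'
    rw [hsat2] at hN hN'
    obtain ⟨x, y, x', y', h1, h2, h3, h4, h5⟩ :=
      exists_gv_mergeGain (a.orient l) (e.orient m) (litv N l) (litv N' l)
    -- A true merged literal is split into exactly one true singleton, a false one into two false
    -- singletons. Changing both is harmless outside the clause, as they occur nowhere else.
    have key : ∀ (K : ℕ → Bool) (x y : Bool), (x && y) = false → (x || y) = litv K l →
        SatC K (l :: d) ∧ Sat K cs → Sat (setLit (setLit K l x) m y) s.clauses := by
      intro K x y hxy hxy' hK
      rw [hsat1, sat_setLit hm, sat_setLit hl]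
      refine ⟨?_, hK.2⟩
      have hK1 := hK.1
      rw [satC_cons, ← hxy'] at hK1
      rw [satC_cons, satC_cons, litv_setLit, litv_setLit_of_ne hlm, litv_setLit,
        List.forall_mem_cons, litv_setLit_of_ne hlm, litv_setLit]
      have hd' : ∀ z ∈ d, litv (setLit (setLit K l x) m y) z = litv K z := fun z hz => by
        rw [litv_setLit_of_ne (hmd z hz), litv_setLit_of_ne (hld z hz)]
      rw [satC_congr hd']
      have hd'' : (∀ z ∈ d, litv (setLit (setLit K l x) m y) z = false) ↔
          ∀ z ∈ d, litv K z = false := forall₂_congr fun z hz => by rw [hd' z hz]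
      rw [hd'']
      cases x <;> cases y <;> simp_all
    have := h _ _ (key N x y h1 h3 hN) (key N' x' y' h2 h4 hN')
    rw [ht1] at this
    simp only [litv_setLit, litv_setLit_of_ne hlm] at this
    rw [score_setLit hrm, score_setLit hrl, ← h5, ← ht2] at this
    exact this
  · intro h M M' hM hM'
    rw [hsat1] at hM hM'
    -- Conversely, two literals of one clause are never both true, and `l` receives the value of
    -- their disjunction.
    have key : ∀ K : ℕ → Bool, SatC K (m :: l :: d) ∧ Sat K cs →
        (litv K l && litv K m) = false ∧
        Sat (setLit K l (litv K l || litv K m)) (mergeSingletons l m c cs s).val.clauses := by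
      intro K hK
      have hK1 := hK.1
      rw [hsat2, sat_setLit hl, satC_cons, litv_setLit]
      have hd' : ∀ z ∈ d, litv (setLit K l (litv K l || litv K m)) z = litv K z := fun z hz =>
        litv_setLit_of_ne (hld z hz)
      have hd'' : (∀ z ∈ d, litv (setLit K l (litv K l || litv K m)) z = false) ↔
          ∀ z ∈ d, litv K z = false := forall₂_congr fun z hz => by rw [hd' z hz]
      rw [satC_congr hd', hd'']
      rw [satC_cons, satC_cons, List.forall_mem_cons] at hK1
      cases hx : litv K l <;> cases hy : litv K m <;> simp_all
    obtain ⟨k1, k2⟩ := key M hM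
    obtain ⟨k3, k4⟩ := key M' hM'
    have := h _ _ k2 k4
    rw [ht2] at this
    simp only [litv_setLit] at this
    rw [score_setLit hrl] at this
    rw [ht1]
    refine le_trans ?_ this
    gcongr
    exact gv_mergeGain_le k1 k3

/-! ### One simplification -/

theorem sat_units {M : ℕ → Bool} (c : Clause) :
    Sat M (c.map fun m => [m.neg]) ↔ ∀ m ∈ c, litv M m = false := by
  simp only [Sat, List.forall_mem_map]
  refine forall₂_congr fun m _ => ?_
  cases h : litv M m <;> simp [SatC, h]

theorem ubOn_of_forall {P : (ℕ → Bool) → (ℕ → Bool) → Prop} {s : State} {b : WithBot ℕ}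
    (h : ∀ M M', Sat M s.clauses → Sat M' s.clauses → P M M') : UB s b ↔ UBOn P s b :=
  ⟨fun hu M M' hM hM' _ => hu M M' hM hM', fun hu M M' hM hM' => hu M M' hM hM' (h M M' hM hM')⟩

theorem ub_congr {s t : State} {b : WithBot ℕ}
    (h : ∀ M, Sat M s.clauses ↔ Sat M t.clauses) (hl : s.live = t.live) (ha : s.acc = t.acc) :
    UB s b ↔ UB t b := by
  unfold UB total
  rw [hl, ha]
  exact forall₂_congr fun M M' => by rw [h M, h M']

/-- The first and third rule assign values that all models share; the second, the pair rule and the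
removal of duplicates rewrite clauses that are equivalent; merging and free variables are
maximisations over variables that are eliminated. -/
theorem Simp.ub {s t : State} (h : Simp s t) (hs : Inv s) (b : WithBot ℕ) : UB s b ↔ UB t b := by
  cases h with
  | twice l c d hc hd =>
    have hf : ∀ M, Sat M s.clauses → litv M l.neg = true := by
      intro M hM
      have h := hM c hc
      rw [SatC.perm hd, satC_cons] at h
      cases hl : litv M l with
      | false => simp [hl]
      | true => simp [hl] at h
    rw [assign_ub (l := l.neg) hs (hs.mem c hc l (hd.mem_iff.2 (by simp)))]
    exact ubOn_of_forall fun M M' hM hM' => ⟨hf M hM, hf M' hM'⟩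
  | opposite l c d cs hc hd =>
    refine ub_congr (fun M => ?_) rfl rfl
    rw [Sat.perm hc, sat_cons, sat_append, SatC.perm hd, satC_cons, satC_cons, sat_units,
      List.forall_mem_cons, litv_neg]
    cases litv M l <;> simp
  | unit l hl =>
    have hf : ∀ M, Sat M s.clauses → litv M l = true := by
      intro M hM
      have h := hM _ hl
      rw [satC_cons] at h
      by_contra h'
      rw [if_neg h'] at h
      simp [SatC] at h
    rw [assign_ub hs (hs.mem _ hl l (by simp))]
    exact ubOn_of_forall fun M M' hM hM' => ⟨hf M hM, hf M' hM'⟩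
  | pair l m cs hc hlm =>
    have hmem := hs.mem [l, m] (hc.mem_iff.2 (by simp))
    have hs' : Inv ⟨cs, s.live, s.acc⟩ :=
      ⟨hs.nodup, fun c h => hs.mem c (hc.mem_iff.2 (by simp [h]))⟩
    have h1 := link_ub hs' (hmem l (by simp)) (hmem m (by simp)) hlm (fun _ _ => True)
      (fun _ _ _ _ => Iff.rfl) b
    rw [← ubOn_of_forall (fun _ _ _ _ => trivial)] at h1
    rw [h1]
    unfold UB UBOn
    refine forall₂_congr fun M M' => ?_
    have key : ∀ K : ℕ → Bool, Sat K s.clauses ↔ Sat K cs ∧ litv K l = !litv K m := by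
      intro K
      rw [Sat.perm hc, sat_cons, and_comm]
      refine and_congr_right fun _ => ?_
      unfold SatC
      cases h : litv K l <;> cases h' : litv K m <;> simp [h, h']
    rw [key, key]
    exact ⟨fun h h1 h2 h3 => h ⟨h1, h3.1⟩ ⟨h2, h3.2.1⟩,
      fun h h1 h2 => h h1.1 h2.1 ⟨h1.2, h2.2, trivial⟩⟩
  | duplicate c d cs hirr hc hd hcd =>
    refine ub_congr (fun M => ?_) rfl rfl
    rw [Sat.perm hc, sat_cons]
    refine and_iff_right_of_imp fun h => ?_
    have h1 : c.Nodup := (hirr c (hc.mem_iff.2 (by simp))).2.of_map _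
    have h2 : d.Nodup := (hirr d (hc.mem_iff.2 (by simp [hd]))).2.of_map _
    -- In clauses without repetitions, having the same literals means being permutations of each
    -- other, so the true literals are counted equally.
    exact (SatC.perm ((List.perm_ext_iff_of_nodup h1 h2).2 hcd)).2 (h d hd)
  | merge l m c d cs hirr hc hd hl hm => exact merge_ub hs hirr hc hd hl hm b
  | free v g live hirr hl hv =>
    have hp : (vars s.live).Perm (v :: vars live) := hl.map _
    have hvl : v ∉ vars live := (List.nodup_cons.1 (hp.nodup_iff.1 hs.nodup)).1
    have h1 : ∀ M M', total s M M' = s.acc + (gv g (M v) (M' v) + score live M M') := fun M M' => by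
      unfold total; rw [score_perm hl, score_cons]
    constructor
    · intro h M M' hM hM'
      -- The two models may take any values at a variable that occurs nowhere, in particular those
      -- attaining the largest entry of its record.
      obtain ⟨x, x', hx⟩ : ∃ x x' : Bool, max (max g.tt g.ff) g.df = gv g x x' := by
        rcases max_choice (max g.tt g.ff) g.df with h | h
        · rcases max_choice g.tt g.ff with h' | h'
          · exact ⟨true, true, by rw [h, h']; rfl⟩
          · exact ⟨false, false, by rw [h, h']; rfl⟩
        · exact ⟨true, false, by rw [h]; rfl⟩
      have h2 := h (setLit M ⟨v, true⟩ x) (setLit M' ⟨v, true⟩ x')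
        ((sat_setLit (l := ⟨v, true⟩) hv).2 hM) ((sat_setLit (l := ⟨v, true⟩) hv).2 hM')
      rw [h1, score_setLit hvl] at h2
      simp only [setLit, Function.update_self, beq_true] at h2
      rw [← hx, ← add_assoc] at h2
      exact h2
    · intro h M M' hM hM'
      refine le_trans ?_ (h M M' hM hM')
      rw [h1, ← add_assoc]
      unfold total
      refine add_le_add_left (add_le_add_right ?_ _) _
      unfold gv
      split_ifs <;> simp

theorem Simps.ub {s t : State} (h : Simps s t) (hs : Inv s) (b : WithBot ℕ) : UB s b ↔ UB t b := by
  induction h with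
  | refl => exact Iff.rfl
  | tail h1 h ih => exact ih.trans (h.ub (Simps.inv h1 hs) b)

/-! ### Branching -/

/-- The branches cover all pairs of models: either `a` has the same value under both, or it is true
under one and false under the other. In the latter case the second model has another true literal
`m` in the clause, which the first one makes false; hence `m` differs as well and is complementary
to `a` under both. Conversely, branches only restrict the pairs. -/
theorem branch_ub {s : State} {a : Literal} {rest : Clause} (hs : Inv s)
    (hc : a :: rest ∈ s.clauses ∨ ∃ c ∈ s.clauses, c.Perm (a :: rest))
    (hn : ClauseNodup (a :: rest)) (b : WithBot ℕ) :
    UB s b ↔ UB (assign a s).val b ∧ UB (assign a.neg s).val b ∧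
      ∀ m ∈ rest, UB (linkDiffer a m s).val b := by
  obtain ⟨c, hc, hp⟩ : ∃ c ∈ s.clauses, c.Perm (a :: rest) :=
    hc.elim (fun h => ⟨_, h, List.Perm.refl _⟩) id
  have hv : ∀ x ∈ a :: rest, x.var ∈ vars s.live := fun x hx => hs.mem c hc x (hp.mem_iff.2 hx)
  have hva := hv a (by simp)
  have hne : ∀ m ∈ rest, a.var ≠ m.var := fun m hm e =>
    (List.nodup_cons.1 hn).1 (e ▸ List.mem_map_of_mem hm)
  have hsat : ∀ {M}, Sat M s.clauses → SatC M (a :: rest) := fun hM => (SatC.perm hp).1 (hM c hc)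
  rw [assign_ub hs hva, assign_ub (l := a.neg) hs hva]
  have h3 : (∀ m ∈ rest, UB (linkDiffer a m s).val b) ↔ ∀ m ∈ rest,
      UBOn (fun M M' => (litv M a = !litv M m) ∧ (litv M' a = !litv M' m) ∧
        M m.var ≠ M' m.var) s b :=
    forall₂_congr fun m hm => linkDiffer_ub hs hva (hv m (by simp [hm])) (hne m hm) b
  rw [h3]
  constructor
  · intro h
    exact ⟨fun M M' hM hM' _ => h M M' hM hM', fun M M' hM hM' _ => h M M' hM hM',
      fun m _ M M' hM hM' _ => h M M' hM hM'⟩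
  · rintro ⟨h1, h2, h3⟩ M M' hM hM'
    have key : ∀ {K K'}, Sat K s.clauses → Sat K' s.clauses → litv K a = true →
        litv K' a = false → ∃ m ∈ rest, (litv K a = !litv K m) ∧ (litv K' a = !litv K' m) ∧
          K m.var ≠ K' m.var := by
      intro K K' hK hK' ha ha'
      have k1 := hsat hK
      have k2 := hsat hK'
      rw [satC_cons, if_pos ha] at k1
      rw [satC_cons, if_neg (by simp [ha'])] at k2
      obtain ⟨m, hm, k3⟩ := List.countP_pos_iff.1 (by rw [k2]; omega : 0 < rest.countP (litv K'))
      refine ⟨m, hm, by simp [ha, k1 m hm], by simp [ha', k3], fun e => ?_⟩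
      have := k1 m hm
      rw [litv_congr e, k3] at this
      exact absurd this (by simp)
    cases ha : litv M a <;> cases ha' : litv M' a
    · exact h2 M M' hM hM' (by simp [ha, ha'])
    · obtain ⟨m, hm, k1, k2, k3⟩ := key hM' hM ha' ha
      exact h3 m hm M M' hM hM' ⟨k2, k1, k3.symm⟩
    · obtain ⟨m, hm, k⟩ := key hM hM' ha ha'
      exact h3 m hm M M' hM hM' k
    · exact h1 M M' hM hM' ⟨ha, ha'⟩

/-! ## Connected components -/

theorem meets_val {c d : Clause} :
    (meets c d).val = true ↔ ∃ l ∈ c, ∃ m ∈ d, m.var = l.var := by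
  induction c with
  | nil => simp [meets]
  | cons l c ih =>
    simp only [meets, bind_val]
    have := findVar_isSome l.var d
    cases h : (findVar l.var d).val with
    | none =>
      simp only [h, Option.isSome_none] at this
      simp only [ih, List.exists_mem_cons_iff]
      refine (or_iff_right ?_).symm
      simpa [occurs] using this.symm
    | some m =>
      obtain ⟨h1, h2⟩ := findVar_some h
      simp only [pure_val, true_iff]
      exact ⟨l, by simp, m, h1, h2⟩

theorem meetsAny_val {cs : List Clause} {c : Clause} :
    (meetsAny cs c).val = true ↔ ∃ l ∈ c, ¬ Absent l.var cs := by
  simp only [meetsAny, bind_val]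
  have h2 : (∃ l ∈ c, ¬ Absent l.var cs) ↔ ∃ d ∈ cs, (meets c d).val = true := by
    simp only [meets_val, Absent]
    push Not
    tauto
  rw [h2]
  cases h : (pick (meets c) cs).val with
  | none =>
    have := pick_none h
    simp only [pure_val, Bool.false_eq_true, false_iff, not_exists, not_and]
    intro d hd
    simp [this d hd]
  | some r =>
    obtain ⟨d, ds⟩ := r
    obtain ⟨h3, h4⟩ := pick_some_perm h
    simp only [pure_val, true_iff]
    exact ⟨d, h4.mem_iff.2 (by simp), h3⟩

/-- The two formulas have no variable in common. -/
def Apart (F G : List Clause) : Prop := ∀ c ∈ F, ∀ l ∈ c, Absent l.var G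

theorem Apart.symm {F G : List Clause} (h : Apart F G) : Apart G F :=
  fun d hd m hm c hc l hl e => h c hc l hl d hd m hm e.symm

/-- Every round that continues moves at least one clause, so as many rounds as there are outside
clauses suffice. The process stops when no outside clause shares a variable with the inside. -/
theorem grow_spec (k : ℕ) (ins outs : List Clause) (hk : outs.length ≤ k) :
    (ins ++ outs).Perm ((grow k ins outs).val.1 ++ (grow k ins outs).val.2) ∧
      Apart (grow k ins outs).val.1 (grow k ins outs).val.2 ∧
      ins.length ≤ (grow k ins outs).val.1.length := by
  induction k generalizing ins outs with
  | zero =>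
    have : outs = [] := List.length_eq_zero_iff.1 (by omega)
    subst this
    exact ⟨List.Perm.refl _, fun _ _ _ _ => by simp [grow, Absent], le_rfl⟩
  | succ k ih =>
    simp only [grow, bind_val, separate_val]
    have hp := List.filter_append_perm (fun c => (meetsAny ins c).val) outs
    cases h : outs.filter (fun c => (meetsAny ins c).val) with
    | nil =>
      simp only [pure_val]
      refine ⟨List.Perm.refl _, Apart.symm fun c hc l hl => ?_, le_rfl⟩
      have h1 := List.filter_eq_nil_iff.1 h c hc
      rw [meetsAny_val] at h1
      push Not at h1
      exact h1 l hl
    | cons d ds =>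
      simp only [bind_val, append_val]
      rw [h] at hp
      have h1 := hp.length_eq
      simp only [List.cons_append, List.length_cons, List.length_append] at h1
      obtain ⟨h2, h3, h4⟩ := ih (d :: ds ++ ins) (outs.filter fun c => !(meetsAny ins c).val)
        (by omega)
      refine ⟨List.Perm.trans ?_ h2, h3, le_trans (by simp; omega) h4⟩
      refine (hp.symm.append_left ins).trans ?_
      rw [← List.append_assoc]
      exact List.perm_append_comm.append_right _

/-- Only separation and nonemptiness of the pieces are established. That the pieces are connected is
needed neither for correctness nor for the running time. -/
theorem components_spec (k : ℕ) (F : List Clause) (hk : F.length ≤ k) :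
    F.Perm (components k F).val.flatten ∧ (components k F).val.Pairwise Apart ∧
      ∀ d ∈ (components k F).val, d ≠ [] := by
  induction k generalizing F with
  | zero =>
    have : F = [] := List.length_eq_zero_iff.1 (by omega)
    subst this
    simp [components]
  | succ k ih =>
    cases F with
    | nil => simp [components]
    | cons c cs =>
      simp only [components, bind_val, len_val, pure_val]
      obtain ⟨h1, h2, h3⟩ := grow_spec cs.length [c] cs le_rfl
      set r := (grow cs.length [c] cs).val
      have h4 := h1.length_eq
      simp only [List.cons_append, List.nil_append, List.length_cons, List.length_append,
        List.length_nil] at h4 h3 hk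
      obtain ⟨h5, h6, h7⟩ := ih r.2 (by omega)
      refine ⟨?_, List.pairwise_cons.2 ⟨fun d hd x hx l hl e he m hm => ?_, h6⟩, ?_⟩
      · rw [List.flatten_cons]
        exact h1.trans (h5.append_left _)
      · exact h2 x hx l hl e (h5.mem_iff.2 (List.mem_flatten.2 ⟨d, hd, he⟩)) m hm
      · rw [List.forall_mem_cons]
        refine ⟨fun e => ?_, h7⟩
        rw [e] at h3
        simp at h3

/-- The instance given by a connected component. -/
def compState (live : List (ℕ × Gain)) (cs : List Clause) : State :=
  ⟨cs, live.filter fun x => !(isFree cs x).val, 0⟩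

@[simp] theorem toStates_val (live : List (ℕ × Gain)) (ds : List (List Clause)) :
    (toStates live ds).val = ds.map (compState live) := by
  induction ds with
  | nil => rfl
  | cons d ds ih => simp [toStates, ih, compState]

theorem mem_compState {live : List (ℕ × Gain)} {cs : List Clause} {x : ℕ × Gain} :
    x ∈ (compState live cs).live ↔ x ∈ live ∧ ¬ Absent x.1 cs := by
  unfold compState
  rw [List.mem_filter, Bool.not_eq_true', ← Bool.not_eq_true, isFree_val]
  rfl

theorem compState_inv {s : State} (hs : Inv s) {d : List Clause} (hd : ∀ c ∈ d, c ∈ s.clauses) :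
    Inv (compState s.live d) := by
  refine ⟨hs.nodup.sublist (List.filter_sublist.map _), fun c hc l hl => ?_⟩
  obtain ⟨x, hx, hxl⟩ := List.mem_map.1 (hs.mem c (hd c hc) l hl)
  refine List.mem_map.2 ⟨x, mem_compState.2 ⟨hx, fun h => ?_⟩, hxl⟩
  exact h c hc l hl hxl.symm

theorem sum_map_ite {α β : Type} [AddCommMonoid β] (ds : List α) (p : α → Bool) (a : β) :
    (ds.map fun d => if p d then a else 0).sum = ds.countP p • a := by
  induction ds with
  | nil => simp
  | cons d ds ih =>
    rw [List.map_cons, List.sum_cons, ih, List.countP_cons, add_smul, add_comm]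
    cases p d <;> simp

theorem sum_partition {α β γ : Type} [AddCommMonoid β] (ds : List α) (live : List γ)
    (p : α → γ → Bool) (f : γ → β) (h : ∀ x ∈ live, ds.countP (fun d => p d x) = 1) :
    (live.map f).sum = (ds.map fun d => ((live.filter (p d)).map f).sum).sum := by
  induction live with
  | nil => simp
  | cons x live ih =>
    rw [List.map_cons, List.sum_cons, ih fun y hy => h y (by simp [hy])]
    have h1 : ∀ d, (((x :: live).filter (p d)).map f).sum =
        (if p d x then f x else 0) + ((live.filter (p d)).map f).sum := by
      intro d
      cases hp : p d x <;> simp [hp]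
    simp only [h1]
    rw [List.sum_map_add, sum_map_ite ds (fun d => p d x), h x (by simp), one_smul]

/-- Pieces without common variables cannot contain the same variable twice, and each variable that
occurs at all occurs in some piece. -/
theorem countP_comp {v : ℕ} {ds : List (List Clause)} (hd : ds.Pairwise Apart)
    (hv : ¬ Absent v ds.flatten) (p : List Clause → Bool)
    (hp : ∀ d, p d = true ↔ ¬ Absent v d) : ds.countP p = 1 := by
  induction ds with
  | nil => simp [Absent] at hv
  | cons d ds ih =>
    rw [List.pairwise_cons] at hd
    by_cases h : Absent v d
    · rw [List.countP_cons_of_neg (by simp [hp, h])]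
      refine ih hd.2 fun hv' => hv ?_
      intro c hc l hl
      rw [List.flatten_cons, List.mem_append] at hc
      exact hc.elim (fun hc => h c hc l hl) (fun hc => hv' c hc l hl)
    · rw [List.countP_cons_of_pos ((hp d).2 h), Nat.add_eq_right, List.countP_eq_zero]
      intro e he
      rw [hp, not_not]
      unfold Absent at h
      push Not at h
      obtain ⟨c, hc, l, hl, rfl⟩ := h
      exact hd.1 e he c hc l hl

/-- The number `a` is the answer for an instance. -/
def IsValue (s : State) (a : WithBot ℕ) : Prop := ∀ b, UB s b ↔ a ≤ b

/-- The values are discrete. If every total were below `a`, then the predecessor of `a` would be an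
upper bound smaller than `a`. -/
theorem IsValue.attained {s : State} {a : WithBot ℕ} (h : IsValue s a) (ha : a ≠ ⊥) :
    ∃ M M', Sat M s.clauses ∧ Sat M' s.clauses ∧ a ≤ total s M M' := by
  by_contra! hn
  have key : ∀ b, (∀ x : WithBot ℕ, x < a → x ≤ b) → a ≤ b := fun b hb =>
    (h b).1 fun M M' hM hM' => hb _ (hn M M' hM hM')
  obtain ⟨n, rfl⟩ := WithBot.ne_bot_iff_exists.1 ha
  cases n with
  | zero =>
    -- The predecessor of 0 is `⊥`.
    have := key ⊥ fun x hx => by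
      induction x using WithBot.recBotCoe with
      | bot => exact le_rfl
      | coe k => exact absurd (WithBot.coe_lt_coe.1 hx) (Nat.not_lt_zero k)
    exact WithBot.coe_ne_bot (le_bot_iff.1 this)
  | succ n =>
    have := key (n : ℕ) fun x hx => by
      induction x using WithBot.recBotCoe with
      | bot => exact bot_le
      | coe k => exact WithBot.coe_le_coe.2 (Nat.lt_succ_iff.1 (WithBot.coe_lt_coe.1 hx))
    exact absurd (WithBot.coe_le_coe.1 this) (Nat.not_succ_le_self n)

/-- Optimal pairs of models of the pieces are glued together. Gluing is possible because no variable
belongs to two pieces. -/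
theorem attained_components {live : List (ℕ × Gain)} {val : List Clause → WithBot ℕ}
    {ds : List (List Clause)} (hd : ds.Pairwise Apart)
    (hval : ∀ d ∈ ds, IsValue (compState live d) (val d)) (hbot : (ds.map val).sum ≠ ⊥) :
    ∃ M M', Sat M ds.flatten ∧ Sat M' ds.flatten ∧
      (ds.map val).sum ≤ (ds.map fun d => score (compState live d).live M M').sum := by
  induction ds with
  | nil => exact ⟨fun _ => true, fun _ => true, by simp [Sat], by simp [Sat], le_rfl⟩
  | cons d ds ih =>
    rw [List.map_cons, List.sum_cons, WithBot.add_ne_bot] at hbot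
    rw [List.pairwise_cons] at hd
    obtain ⟨N, N', hN, hN', h1⟩ := ih hd.2 (fun e he => hval e (by simp [he])) hbot.2
    obtain ⟨K, K', hK, hK', h2⟩ := (hval d (by simp)).attained hbot.1
    classical
    -- The first piece determines the values of its own variables; all others are taken from the
    -- models for the remaining pieces.
    have glue_sat : ∀ K N : ℕ → Bool, Sat K d → Sat N ds.flatten →
        Sat (fun v => if Absent v d then N v else K v) (d :: ds).flatten := by
      intro K N hK hN
      rw [List.flatten_cons, sat_append]
      constructor
      · refine (sat_congr fun c hc l hl => ?_).2 hK
        exact if_neg fun h => h c hc l hl rfl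
      · refine (sat_congr fun c hc l hl => ?_).2 hN
        refine if_pos ?_
        obtain ⟨e, he, hce⟩ := List.mem_flatten.1 hc
        exact (hd.1 e he).symm c hce l hl
    refine ⟨_, _, glue_sat K N hK hN, glue_sat K' N' hK' hN', ?_⟩
    rw [List.map_cons, List.sum_cons, List.map_cons, List.sum_cons]
    refine add_le_add ?_ ?_
    · refine h2.trans (le_of_eq ?_)
      unfold total
      rw [show (compState live d).acc = 0 from rfl, zero_add]
      have hv : ∀ v ∈ vars (compState live d).live, ¬ Absent v d := by
        intro v hv
        obtain ⟨x, hx, rfl⟩ := List.mem_map.1 hv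
        exact (mem_compState.1 hx).2
      exact score_congr (fun v h => (if_neg (hv v h)).symm) (fun v h => (if_neg (hv v h)).symm)
    · refine h1.trans (le_of_eq ?_)
      congr 1
      refine List.map_congr_left fun e he => ?_
      have hv : ∀ v ∈ vars (compState live e).live, Absent v d := by
        intro v hv
        obtain ⟨x, hx, rfl⟩ := List.mem_map.1 hv
        have h3 := (mem_compState.1 hx).2
        unfold Absent at h3
        push Not at h3
        obtain ⟨c, hc, l, hl, h4⟩ := h3
        rw [← h4]
        exact (hd.1 e he).symm c hc l hl
      exact score_congr (fun v h => (if_pos (hv v h)).symm) (fun v h => (if_pos (hv v h)).symm)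

theorem countP_comp_live {s : State} (hfree : ∀ x ∈ s.live, ¬ Absent x.1 s.clauses)
    {ds : List (List Clause)} (hp : s.clauses.Perm ds.flatten) (hd : ds.Pairwise Apart) :
    ∀ x ∈ s.live, ds.countP (fun d => !(isFree d x).val) = 1 := by
  intro x hx
  refine countP_comp (v := x.1) hd (fun h => hfree x hx fun c hc => h c (hp.mem_iff.1 hc)) _
    fun d => ?_
  rw [Bool.not_eq_true', ← Bool.not_eq_true, isFree_val]
  rfl

/-- A pair of models restricts to each piece, so the sum is an upper bound. It is attained by gluing
unless a piece has no finite answer, and then the sum is `⊥`, which is below everything. Each record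
is counted in exactly one piece since no variable is free. -/
theorem components_value {s : State} (hfree : ∀ x ∈ s.live, ¬ Absent x.1 s.clauses)
    {ds : List (List Clause)} (hp : s.clauses.Perm ds.flatten) (hd : ds.Pairwise Apart)
    {val : List Clause → WithBot ℕ} (hval : ∀ d ∈ ds, IsValue (compState s.live d) (val d)) :
    IsValue s (s.acc + (ds.map val).sum) := by
  have hscore : ∀ M M', score s.live M M' =
      (ds.map fun d => score (compState s.live d).live M M').sum := fun M M' =>
    sum_partition ds s.live (fun d x => !(isFree d x).val) _ (countP_comp_live hfree hp hd)
  intro b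
  constructor
  · intro h
    by_cases hbot : (ds.map val).sum = ⊥
    · rw [hbot, WithBot.add_bot]; exact bot_le
    · obtain ⟨M, M', hM, hM', h1⟩ := attained_components hd hval hbot
      refine le_trans ?_ (h M M' ((Sat.perm hp).2 hM) ((Sat.perm hp).2 hM'))
      unfold total
      rw [hscore]
      exact add_le_add le_rfl h1
  · intro h M M' hM hM'
    refine le_trans ?_ h
    unfold total
    rw [hscore]
    refine add_le_add le_rfl (List.sum_le_sum fun d hd' => ?_)
    have hsub : ∀ K, Sat K s.clauses → Sat K d := fun K hK c hc =>
      (Sat.perm hp).1 hK c (List.mem_flatten.2 ⟨d, hd', hc⟩)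
    have h2 := (hval d hd' (val d)).2 le_rfl M M' (hsub M hM) (hsub M' hM')
    unfold total at h2
    rwa [show (compState s.live d).acc = 0 from rfl, zero_add] at h2

theorem length_compState_sum {s : State} (hfree : ∀ x ∈ s.live, ¬ Absent x.1 s.clauses)
    {ds : List (List Clause)} (hp : s.clauses.Perm ds.flatten) (hd : ds.Pairwise Apart) :
    s.live.length = (ds.map fun d => (compState s.live d).live.length).sum := by
  have := sum_partition ds s.live (fun d x => !(isFree d x).val) (fun _ => 1)
    (countP_comp_live hfree hp hd)
  simpa [compState] using this

theorem size_compState {s : State} {ds : List (List Clause)} (hp : s.clauses.Perm ds.flatten)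
    {d : List Clause} (hd : d ∈ ds) : (compState s.live d).size ≤ s.size := by
  unfold State.size
  refine add_le_add ?_ (List.length_filter_le _ _)
  rw [formSize_perm hp]
  clear hp
  induction ds with
  | nil => simp at hd
  | cons e ds ih =>
    rw [List.flatten_cons, formSize_append]
    rcases List.mem_cons.1 hd with rfl | hd
    · exact Nat.le_add_right _ _
    · exact (ih hd).trans (Nat.le_add_left _ _)

/-! ### Costs -/

section

variable {n : ℕ}

theorem meets_cost (c : Clause) {d : Clause} (h : d.length ≤ n) :
    Cost (meets c d) ((n + 2) * c.length + 1) := by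
  induction c with
  | nil => exact Cost.tick_pure _ (by simp)
  | cons l c ih =>
    refine (Cost.tick_bind ((findVar_cost l.var d).bind (b := (n + 2) * c.length + 1) ?_)).mono
      (by simp only [List.length_cons]; ring_nf; omega)
    split
    · exact Cost.pure _ _
    · exact ih

theorem meetsAny_cost {cs : List Clause} {c : Clause} (h : ∀ d ∈ cs, d.length ≤ n)
    (hcs : cs.length ≤ n) (hc : c.length ≤ n) : Cost (meetsAny cs c) ((n + 10) ^ 3) := by
  refine (Cost.tick_bind ((pick_cost fun d hd => (meets_cost c (h d hd)).mono
    (Nat.succ_le_succ (Nat.mul_le_mul_left (n + 2) hc))).bind (b := 0) ?_)).mono ?_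
  · split <;> exact Cost.pure _ _
  · have := Nat.mul_le_mul_left ((n + 2) * n + 1 + 1) hcs
    simp only [Nat.succ_eq_add_one]
    ring_nf at *
    nlinarith [Nat.zero_le (n ^ 3), Nat.zero_le (n ^ 2)]

theorem grow_cost (k : ℕ) {ins outs : List Clause} (hi : ∀ c ∈ ins, c.length ≤ n)
    (ho : ∀ c ∈ outs, c.length ≤ n) (hn : ins.length + outs.length ≤ n) :
    Cost (grow k ins outs) ((n + 10) ^ 5 * k + 1) := by
  induction k generalizing ins outs with
  | zero => exact Cost.tick_pure _ (by simp)
  | succ k ih =>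
    refine (Cost.tick_bind ((separate_cost fun c hc => meetsAny_cost hi (by omega)
      (ho c hc)).bind (b := n + 1 + ((n + 10) ^ 5 * k + 1)) ?_)).mono ?_
    · simp only [separate_val]
      have hp := List.filter_append_perm (fun c => (meetsAny ins c).val) outs
      cases h : outs.filter (fun c => (meetsAny ins c).val) with
      | nil => exact Cost.pure _ _
      | cons d ds =>
        rw [h] at hp
        have h1 := hp.length_eq
        simp only [List.cons_append, List.length_cons, List.length_append] at h1
        refine ((append_cost _ _).mono (by simp only [List.length_cons]; omega)).bind ?_
        rw [append_val]
        refine ih (fun c hc => ?_) (fun c hc => ?_) ?_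
        · rcases List.mem_append.1 hc with hc | hc
          · exact ho c (hp.mem_iff.1 (List.mem_append_left _ hc))
          · exact hi c hc
        · exact ho c (hp.mem_iff.1 (List.mem_append_right _ hc))
        · simp only [List.length_append, List.length_cons]
          omega
    · have h1 : outs.length ≤ n := by omega
      have := Nat.mul_le_mul_left ((n + 10) ^ 3 + 1) h1
      ring_nf at *
      nlinarith [Nat.zero_le (n ^ 4), Nat.zero_le (n ^ 3), Nat.zero_le (n ^ 2),
        Nat.zero_le (n ^ 5)]

theorem components_cost (k : ℕ) {F : List Clause} (h : ∀ c ∈ F, c.length ≤ n)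
    (hn : F.length ≤ n) : Cost (components k F) ((n + 10) ^ 6 * k + 1) := by
  induction k generalizing F with
  | zero => exact Cost.tick_pure _ (by simp)
  | succ k ih =>
    cases F with
    | nil => exact Cost.tick_pure _ (by simp)
    | cons c cs =>
      simp only [List.length_cons] at hn
      obtain ⟨h1, -, -⟩ := grow_spec cs.length [c] cs le_rfl
      have h2 := h1.length_eq
      simp only [List.cons_append, List.nil_append, List.length_cons, List.length_append] at h2
      refine (Cost.tick_bind (((len_cost cs).mono hn).bind (((grow_cost _
        (fun d hd => h d (by simp_all)) (fun d hd => h d (by simp [hd]))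
        (by simp only [List.length_cons, List.length_nil]; omega)).mono
          (b := (n + 10) ^ 5 * n + 1) ?_).bind (b := (n + 10) ^ 6 * k + 1) ?_))).mono ?_
      · simp only [len_val]
        exact Nat.succ_le_succ (Nat.mul_le_mul_left _ (by omega))
      · refine Cost.bind_pure (ih (fun d hd => ?_) ?_)
        · rw [len_val] at hd
          exact h d (h1.mem_iff.2 (List.mem_append_right _ hd))
        · simp only [len_val]; omega
      · have : n + 10 ≤ (n + 10) ^ 5 := Nat.le_self_pow (by omega) _
        rw [pow_succ (n + 10) 5]
        generalize (n + 10) ^ 5 = Y at *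
        nlinarith

theorem toStates_cost {live : List (ℕ × Gain)} (hl : live.length ≤ n) {ds : List (List Clause)}
    (h : ∀ d ∈ ds, d.length ≤ n ∧ ∀ c ∈ d, c.length ≤ n) :
    Cost (toStates live ds) ((n + 10) ^ 4 * ds.length + 1) := by
  induction ds with
  | nil => exact Cost.tick_pure _ (by simp)
  | cons d ds ih =>
    obtain ⟨h1, h2⟩ := h d (by simp)
    refine (Cost.tick_bind (((separate_cost fun x _ => isFree_cost h2 h1 x).mono
      (Nat.succ_le_succ (Nat.mul_le_mul_left _ hl))).bind
      (ih fun e he => h e (by simp [he])).bind_pure)).mono ?_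
    simp only [List.length_cons, Nat.succ_eq_add_one]
    ring_nf
    nlinarith [Nat.zero_le (n ^ 4), Nat.zero_le (n ^ 3), Nat.zero_le (n ^ 2)]

end

/-! ## Substitutions

Eliminating variables substitutes a truth value or a literal for each of them. -/

/-- A truth value or a literal. -/
structure Val where
  base : Option ℕ
  pos : Bool

namespace Val

/-- The negation. -/
def neg (v : Val) : Val := ⟨v.base, !v.pos⟩

/-- The value true. -/
def T : Val := ⟨none, true⟩

/-- The value false. -/
def F : Val := ⟨none, false⟩

/-- The value under an assignment. -/
def eval (M : ℕ → Bool) (v : Val) : Bool :=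
  match v.base with
  | none => v.pos
  | some u => M u == v.pos

/-- The literal, if it is one. -/
def toLit (v : Val) : Option Literal := v.base.map fun u => ⟨u, v.pos⟩

@[simp] theorem neg_neg (v : Val) : v.neg.neg = v := by simp [neg]

@[simp] theorem neg_base (v : Val) : v.neg.base = v.base := rfl

@[simp] theorem neg_T : T.neg = F := rfl

theorem T_ne_F : T ≠ F := by simp [T, F]

@[simp] theorem eval_neg (M : ℕ → Bool) (v : Val) : v.neg.eval M = !v.eval M := by
  obtain ⟨_ | u, p⟩ := v
  · rfl
  · cases h : M u <;> cases p <;> simp [neg, eval, h]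

@[simp] theorem eval_F (M : ℕ → Bool) : F.eval M = false := rfl

theorem eq_F_of_eval {v : Val} (h : ∀ M, v.eval M = false) : v = F := by
  obtain ⟨_ | u, p⟩ := v
  · have := h fun _ => true
    simp only [eval] at this
    rw [this]; rfl
  · have := h fun _ => p
    simp [eval] at this

theorem eq_T_of_eval {v : Val} (h : ∀ M, v.eval M = true) : v = T := by
  have : v.neg = F := eq_F_of_eval fun M => by rw [eval_neg, h]; rfl
  rw [← neg_neg v, this]; rfl

/-- Values that agree under all assignments are equal as expressions. This converts the semantic
alternative, that a clause is identically satisfied, into statements about the substitution itself.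
-/
theorem eq_of_eval {v w : Val} (h : ∀ M, v.eval M = w.eval M) : v = w := by
  obtain ⟨_ | u, p⟩ := v
  · cases p
    · exact (eq_F_of_eval fun M => (h M).symm).symm
    · exact (eq_T_of_eval fun M => (h M).symm).symm
  · obtain ⟨_ | u', p'⟩ := w
    · cases p'
      · exact eq_F_of_eval h
      · exact eq_T_of_eval h
    · by_cases e : u = u'
      · subst e
        have := h fun _ => p
        simp only [eval, beq_self_eq_true] at this
        rw [beq_iff_eq.1 this.symm]
      · have := h fun x => if x = u then p else !p'
        simp [eval, Ne.symm e] at this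

end Val

/-- The value of a literal under a substitution. -/
def lv (φ : ℕ → Val) (l : Literal) : Val := if l.pos then φ l.var else (φ l.var).neg

/-- The remaining literals of a clause under a substitution. -/
def img (φ : ℕ → Val) (c : Clause) : Clause := c.filterMap fun l => (lv φ l).toLit

/-- The assignment given by a substitution and an assignment. -/
def app (φ : ℕ → Val) (M : ℕ → Bool) : ℕ → Bool := fun v => (φ v).eval M

theorem lv_neg (φ : ℕ → Val) (l : Literal) : lv φ l.neg = (lv φ l).neg := by
  unfold lv
  cases h : l.pos <;> simp [h]

theorem lv_base (φ : ℕ → Val) (l : Literal) : (lv φ l).base = (φ l.var).base := by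
  unfold lv
  split_ifs <;> rfl

theorem litv_app (φ : ℕ → Val) (M : ℕ → Bool) (l : Literal) :
    litv (app φ M) l = (lv φ l).eval M := by
  unfold litv app lv
  cases h : l.pos
  · simp
  · simp

theorem img_perm {φ : ℕ → Val} {c d : Clause} (h : c.Perm d) : (img φ c).Perm (img φ d) :=
  h.filterMap _

/-- Without true literals, dropping the constants means dropping false literals, which does not
change the number of true ones. -/
theorem satC_img {φ : ℕ → Val} {M : ℕ → Bool} {c : Clause} (h : ∀ l ∈ c, lv φ l ≠ Val.T) :
    SatC (app φ M) c ↔ SatC M (img φ c) := by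
  unfold SatC img
  suffices h' : c.countP (litv (app φ M)) =
      (c.filterMap fun l => (lv φ l).toLit).countP (litv M) by rw [h']
  induction c with
  | nil => rfl
  | cons l c ih =>
    have ih := ih fun m hm => h m (by simp [hm])
    have hl := h l (by simp)
    rw [List.countP_cons, ih, List.filterMap_cons, litv_app]
    rcases e : lv φ l with ⟨_ | u, p⟩
    · have : p = false := by
        cases p
        · rfl
        · exact absurd e hl
      simp [Val.toLit, Val.eval, this]
    · simp [Val.toLit, Val.eval, List.countP_cons, litv]

/-- Substitution in a value. -/
def bindVal (ψ : ℕ → Val) (v : Val) : Val :=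
  match v.base with
  | none => v
  | some u => lv ψ ⟨u, v.pos⟩

/-- Composition of substitutions. -/
def compSub (ψ φ : ℕ → Val) : ℕ → Val := fun v => bindVal ψ (φ v)

theorem bindVal_neg (ψ : ℕ → Val) (v : Val) : bindVal ψ v.neg = (bindVal ψ v).neg := by
  obtain ⟨_ | u, p⟩ := v
  · rfl
  · exact lv_neg ψ ⟨u, p⟩

theorem lv_compSub (ψ φ : ℕ → Val) (l : Literal) : lv (compSub ψ φ) l = bindVal ψ (lv φ l) := by
  unfold lv compSub
  split_ifs
  · rfl
  · rw [bindVal_neg]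

theorem eval_bindVal (ψ : ℕ → Val) (M : ℕ → Bool) (v : Val) :
    (bindVal ψ v).eval M = v.eval (app ψ M) := by
  obtain ⟨_ | u, p⟩ := v
  · rfl
  · exact (litv_app ψ M ⟨u, p⟩).symm

theorem app_compSub (ψ φ : ℕ → Val) (M : ℕ → Bool) :
    app (compSub ψ φ) M = app φ (app ψ M) := funext fun _ => eval_bindVal _ _ _

theorem img_compSub (ψ φ : ℕ → Val) (c : Clause) : img (compSub ψ φ) c = img ψ (img φ c) := by
  unfold img
  rw [List.filterMap_filterMap]
  refine List.filterMap_congr fun l _ => ?_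
  rw [lv_compSub]
  obtain ⟨_ | u, p⟩ := lv φ l <;> rfl

/-- Under the substitution `φ`, a clause is satisfied whenever all clauses of `F'` with at most
one literal are, or what remains of it is a clause of `F'`. -/
def Covered (φ : ℕ → Val) (F' : List Clause) (c : Clause) : Prop :=
  (∀ M, (∀ d ∈ F', d.length ≤ 1 → SatC M d) → SatC (app φ M) c) ∨
    ((∀ l ∈ c, lv φ l ≠ Val.T) ∧ ∃ d ∈ F', d.Perm (img φ c))

/-- The substitution `φ` transforms the formula `F` with variables `L` into the formula `F'` with
variables `L'`. -/
structure Subst (φ : ℕ → Val) (F : List Clause) (L : List ℕ) (F' : List Clause) (L' : List ℕ) :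
    Prop where
  sub : ∀ u ∈ L', u ∈ L
  self : ∀ u ∈ L', φ u = ⟨some u, true⟩
  cover : ∀ c ∈ F, Covered φ F' c

/-- The point is that short clauses stay short: a clause with at most one literal is either
satisfied through the short clauses of the final formula, or survives as such a clause itself. A
clause secured by the first substitution therefore remains secured after the second. -/
theorem Subst.comp {φ ψ : ℕ → Val} {F F₁ F₂ : List Clause} {L L₁ L₂ : List ℕ}
    (h : Subst φ F L F₁ L₁) (h' : Subst ψ F₁ L₁ F₂ L₂) : Subst (compSub ψ φ) F L F₂ L₂ := by
  refine ⟨fun u hu => h.sub u (h'.sub u hu), fun u hu => ?_, fun c hc => ?_⟩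
  · unfold compSub
    rw [h.self u (h'.sub u hu)]
    exact h'.self u hu
  · rcases h.cover c hc with h1 | ⟨h1, d, hd, hp⟩
    · refine Or.inl fun M hM => ?_
      rw [app_compSub]
      refine h1 _ fun d hd hl => ?_
      rcases h'.cover d hd with h2 | ⟨h2, e, he, hp⟩
      · exact h2 M hM
      · rw [satC_img h2, ← SatC.perm hp]
        refine hM e he (hp.length_eq.trans_le ((List.length_filterMap_le _ _).trans hl))
    · rcases h'.cover d hd with h2 | ⟨h2, e, he, hp'⟩
      · refine Or.inl fun M hM => ?_
        rw [app_compSub, satC_img h1, ← SatC.perm hp]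
        exact h2 M hM
      · refine Or.inr ⟨fun l hl => ?_, e, he, ?_⟩
        · have h3 := h1 l hl
          rw [lv_compSub]
          rcases hv : lv φ l with ⟨_ | u, p⟩
          · exact fun e' => h3 (hv.trans e')
          · refine h2 ⟨u, p⟩ (hp.mem_iff.2 (List.mem_filterMap.2 ⟨l, hl, ?_⟩))
            rw [hv]; rfl
        · rw [img_compSub]
          exact hp'.trans (img_perm hp)

/-- The substitution of a value for a single variable. -/
def single (v : ℕ) (w : Val) : ℕ → Val := Function.update (fun u => ⟨some u, true⟩) v w

theorem single_of_ne {u v : ℕ} {w : Val} (h : u ≠ v) : single v w u = ⟨some u, true⟩ :=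
  Function.update_of_ne h _ _

@[simp] theorem single_self (v : ℕ) (w : Val) : single v w v = w := Function.update_self _ _ _

theorem lv_single_of_ne {l : Literal} {v : ℕ} {w : Val} (h : l.var ≠ v) :
    lv (single v w) l = ⟨some l.var, l.pos⟩ := by
  unfold lv
  rw [single_of_ne h]
  cases l.pos <;> rfl

/-- The substitution making the literal `l` true. -/
abbrev assignSub (l : Literal) : ℕ → Val := single l.var ⟨none, l.pos⟩

/-- The substitution of the literal `m` for the literal `l`. -/
abbrev linkSub (l m : Literal) : ℕ → Val := single l.var ⟨some m.var, m.pos == l.pos⟩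

theorem lv_assignSub (l : Literal) : lv (assignSub l) l = Val.T := by
  unfold lv
  simp only [assignSub, single_self]
  cases h : l.pos <;> rfl

theorem lv_linkSub_self (l m : Literal) : lv (linkSub l m) l = ⟨some m.var, m.pos⟩ := by
  unfold lv
  simp only [linkSub, single_self]
  cases h : l.pos <;> cases h' : m.pos <;> rfl

theorem lv_linkSub {l m : Literal} (x : Literal) :
    lv (linkSub l m) x = ⟨some (substLit l m x).var, (substLit l m x).pos⟩ := by
  by_cases h : x.var = l.var
  · rcases Literal.eq_or_eq_neg h with e | e
    · rw [e, lv_linkSub_self]; simp [substLit]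
    · rw [e, lv_neg, lv_linkSub_self]; simp [substLit, Val.neg]
  · rw [lv_single_of_ne h]; simp [substLit, h]

theorem img_linkSub (l m : Literal) (c : Clause) :
    img (linkSub l m) c = c.map (substLit l m) := by
  unfold img
  rw [← List.filterMap_eq_map]
  refine List.filterMap_congr fun x _ => ?_
  rw [lv_linkSub]; rfl

theorem lv_assignSub_ne_T {l x : Literal} (h : x ≠ l) : lv (assignSub l) x ≠ Val.T := by
  by_cases h1 : x.var = l.var
  · rcases Literal.eq_or_eq_neg h1 with e | e
    · exact absurd e h
    · rw [e, lv_neg, lv_assignSub]; exact Val.T_ne_F.symm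
  · rw [lv_single_of_ne h1]; simp [Val.T]

theorem img_assignSub {l : Literal} {c : Clause} (h : l ∉ c) :
    img (assignSub l) c = c.filter fun x => decide (x ≠ l.neg) := by
  unfold img
  rw [← List.filterMap_eq_filter]
  refine List.filterMap_congr fun x hx => ?_
  by_cases h1 : x.var = l.var
  · rcases Literal.eq_or_eq_neg h1 with e | e
    · exact absurd (e ▸ hx) h
    · rw [e, lv_neg, lv_assignSub]; simp [Val.F, Val.toLit, Option.guard]
  · have : x ≠ l.neg := fun e => h1 (by rw [e]; rfl)
    rw [lv_single_of_ne h1]; simp [Val.toLit, Option.guard, this]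

/-- A clause containing `l` is equivalent, once `l` is true, to the empty and unit clauses that
replace it. Any other clause only loses occurrences of the negation of `l`. -/
theorem subst_assign {l : Literal} {F : List Clause} {L L' : List ℕ}
    (hL : ∀ u ∈ L', u ∈ L ∧ u ≠ l.var) :
    Subst (assignSub l) F L (F.flatMap (assignClause l)) L' := by
  refine ⟨fun u hu => (hL u hu).1, fun u hu => single_of_ne (hL u hu).2, fun c hc => ?_⟩
  by_cases h : l ∈ c
  · refine Or.inl fun M hM => ?_
    have hl : litv (app (assignSub l) M) l = true := by rw [litv_app, lv_assignSub]; rfl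
    rw [← sat_assignClause hl]
    intro d hd
    have hlen : d.length ≤ 1 := by
      unfold assignClause at hd
      rw [if_pos h] at hd
      obtain ⟨m, -, hd⟩ := List.mem_flatMap.1 hd
      unfold unitOf at hd
      split_ifs at hd <;> simp at hd <;> simp [hd]
    refine (satC_congr fun x hx => ?_).1 (hM d (List.mem_flatMap.2 ⟨c, hc, hd⟩) hlen)
    rw [litv_app, lv_single_of_ne (mem_assignClause hd hx).1]
    rfl
  · refine Or.inr ⟨fun x hx => lv_assignSub_ne_T fun e => h (e ▸ hx), _,
      List.mem_flatMap.2 ⟨c, hc, ?_⟩, List.Perm.refl _⟩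
    rw [img_assignSub h]
    unfold assignClause
    rw [if_neg h]
    simp

theorem subst_link {l m : Literal} {F : List Clause} {L L' : List ℕ}
    (hL : ∀ u ∈ L', u ∈ L ∧ u ≠ l.var) :
    Subst (linkSub l m) F L (F.map (List.map (substLit l m))) L' := by
  refine ⟨fun u hu => (hL u hu).1, fun u hu => single_of_ne (hL u hu).2, fun c hc => ?_⟩
  refine Or.inr ⟨fun x _ => ?_, _, List.mem_map_of_mem hc, by rw [img_linkSub]⟩
  rw [lv_linkSub]; simp [Val.T]

/-- The identity. -/
def idSub : ℕ → Val := fun u => ⟨some u, true⟩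

theorem lv_idSub (l : Literal) : lv idSub l = ⟨some l.var, l.pos⟩ := by
  unfold lv idSub
  cases l.pos <;> rfl

theorem img_idSub (c : Clause) : img idSub c = c := by
  unfold img
  simp only [lv_idSub]
  exact List.filterMap_some

theorem app_idSub (M : ℕ → Bool) : app idSub M = M := by
  funext v
  simp [app, idSub, Val.eval]

theorem covered_idSub {F' : List Clause} {c d : Clause} (hd : d ∈ F') (h : d.Perm c) :
    Covered idSub F' c :=
  Or.inr ⟨fun l _ => by rw [lv_idSub]; simp [Val.T], d, hd, by rwa [img_idSub]⟩

theorem covered_assignSub {l : Literal} {F' : List Clause} {c d : Clause} (hl : l ∉ c)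
    (hd : d ∈ F') (h : d.Perm (c.filter fun x => decide (x ≠ l.neg))) :
    Covered (assignSub l) F' c :=
  Or.inr ⟨fun _ hx => lv_assignSub_ne_T fun e => hl (e ▸ hx), d, hd, by rwa [img_assignSub hl]⟩

theorem covered_absent {l : Literal} {F' : List Clause} {c : Clause}
    (hl : ∀ x ∈ c, x.var ≠ l.var) (hc : c ∈ F') : Covered (assignSub l) F' c := by
  refine covered_assignSub (fun h => hl l h rfl) hc ?_
  rw [List.filter_eq_self.2]
  intro x hx
  simpa using fun e : x = l.neg => hl x hx (by rw [e]; rfl)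

/-- `Subst` need not preserve all models, since it only serves to count variables. This gives the
freedom to fix a value for a superfluous singleton or for a variable that does not occur. -/
theorem Simp.subst {s t : State} (h : Simp s t) (hs : Inv s) :
    ∃ φ, Subst φ s.clauses (vars s.live) t.clauses (vars t.live) := by
  cases h with
  | twice l c d hc hd =>
    have hl : l.neg.var ∈ vars s.live := hs.mem c hc l (hd.mem_iff.2 (by simp))
    rw [assign_val]
    exact ⟨_, subst_assign fun u hu => (mem_vars_dropVar hs.nodup hl).1 hu⟩
  | opposite l c d cs hc hd =>
    refine ⟨idSub, fun u hu => hu, fun u _ => rfl, fun e he => ?_⟩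
    rcases List.mem_cons.1 (hc.mem_iff.1 he) with rfl | he
    · refine Or.inl fun M hM => ?_
      -- Exactly one of `l` and its negation is true, so the clause holds as soon as the new unit
      -- clauses make all its other literals false.
      rw [app_idSub, SatC.perm hd, satC_cons, satC_cons, List.forall_mem_cons, litv_neg]
      have hd' : ∀ m ∈ d, litv M m = false := by
        intro m hm
        have := hM [m.neg] (List.mem_append_left _ (List.mem_map.2 ⟨m, hm, rfl⟩)) (by simp)
        rw [satC_cons] at this
        by_contra h
        simp [h, SatC] at this
      cases litv M l <;> simpa using hd'
    · exact covered_idSub (List.mem_append_right _ he) (List.Perm.refl _)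
  | unit l hl =>
    have hl : l.var ∈ vars s.live := hs.mem _ hl l (by simp)
    rw [assign_val]
    exact ⟨_, subst_assign fun u hu => (mem_vars_dropVar hs.nodup hl).1 hu⟩
  | pair l m cs hc hlm =>
    have hmem := hs.mem [l, m] (hc.mem_iff.2 (by simp))
    have hl := hmem l (by simp)
    have hs' : Inv ⟨cs, s.live, s.acc⟩ :=
      ⟨hs.nodup, fun c h => hs.mem c (hc.mem_iff.2 (by simp [h]))⟩
    have hv := link_vars hs' hl (hmem m (by simp)) hlm
    have h1 : Subst (linkSub l m.neg) cs (vars s.live) (link l m ⟨cs, s.live, s.acc⟩).val.clauses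
        (vars (link l m ⟨cs, s.live, s.acc⟩).val.live) := by
      have h1 := subst_link (l := l) (m := m.neg) (F := cs) (L := vars s.live)
        (L' := vars (link l m ⟨cs, s.live, s.acc⟩).val.live)
        fun u hu => (mem_vars_dropVar hs.nodup hl).1 (hv.mem_iff.1 hu)
      rw [link_val] at h1 ⊢
      exact h1
    refine ⟨_, h1.sub, h1.self, fun e he => ?_⟩
    rcases List.mem_cons.1 (hc.mem_iff.1 he) with rfl | he
    · refine Or.inl fun M _ => ?_
      have h2 : litv (app (linkSub l m.neg) M) l = !litv (app (linkSub l m.neg) M) m := by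
        rw [litv_app, litv_app, lv_linkSub_self, lv_single_of_ne hlm.symm, ← Val.eval_neg]
        rfl
      unfold SatC
      cases h3 : litv (app (linkSub l m.neg) M) m <;> simp [h2, h3]
    · exact h1.cover e he
  | duplicate c d cs hirr hc hd hcd =>
    refine ⟨idSub, fun u hu => hu, fun u _ => rfl, fun e he => ?_⟩
    rcases List.mem_cons.1 (hc.mem_iff.1 he) with rfl | he
    · have h1 : e.Nodup := (hirr e (hc.mem_iff.2 (by simp))).2.of_map _
      have h2 : d.Nodup := (hirr d (hc.mem_iff.2 (by simp [hd]))).2.of_map _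
      exact covered_idSub hd ((List.perm_ext_iff_of_nodup h2 h1).2 fun l => (hcd l).symm)
    · exact covered_idSub he (List.Perm.refl _)
  | merge l m c d cs hirr hc hd hl hm =>
    have hcs : c ∈ s.clauses := hc.mem_iff.2 (by simp)
    have hml : m.var ∈ vars s.live := hs.mem c hcs m (hd.mem_iff.2 (by simp))
    have hll : l.var ∈ vars s.live := hs.mem c hcs l (hd.mem_iff.2 (by simp))
    have hn : ((m :: l :: d).map Literal.var).Nodup := (hd.map _).nodup_iff.1 (hirr c hcs).2
    have hnc : c.Nodup := (hirr c hcs).2.of_map _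
    have hlm : l.var ≠ m.var := fun e => by simp [e] at hn
    have hll' : l.var ∈ vars (dropVar m.var s.live).val :=
      (mem_vars_dropVar hs.nodup hml).2 ⟨hll, hlm⟩
    have hv : ∀ u ∈ vars (mergeSingletons l m c cs s).val.live, u ∈ vars s.live ∧ u ≠ m.var := by
      intro u hu
      rw [mergeSingletons_val] at hu
      rw [(vars_setGain _ hll').mem_iff] at hu
      exact (mem_vars_dropVar hs.nodup hml).1 hu
    -- The singleton `m` is treated as false: it occurs in no other clause, and its own clause turns
    -- into the shortened one.
    refine ⟨assignSub m.neg, fun u hu => (hv u hu).1, fun u hu => single_of_ne (hv u hu).2,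
      fun e he => ?_⟩
    rw [mergeSingletons_val]
    rcases List.mem_cons.1 (hc.mem_iff.1 he) with rfl | he
    · refine covered_assignSub (d := e.erase m) (fun h => ?_) (by simp) ?_
      · rw [List.map_cons, List.nodup_cons] at hn
        rcases List.mem_cons.1 (hd.mem_iff.1 h) with h | h
        · exact Literal.neg_ne m h
        · exact hn.1 (List.mem_map.2 ⟨m.neg, h, rfl⟩)
      · rw [hnc.erase_eq_filter, Literal.neg_neg]
        refine List.Perm.of_eq (List.filter_congr fun x _ => ?_)
        simp only [bne, ne_eq, decide_not]
        congr 1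
    · exact covered_absent (hm e he) (by simp [he])
  | free v g live hirr hl hv =>
    have hp : (vars s.live).Perm (v :: vars live) := hl.map _
    have hvl : v ∉ vars live := (List.nodup_cons.1 (hp.nodup_iff.1 hs.nodup)).1
    -- The value chosen for the free variable is arbitrary.
    refine ⟨assignSub ⟨v, true⟩, fun u hu => hp.mem_iff.2 (by simp only [List.mem_cons]; exact Or.inr hu),
      fun u hu => single_of_ne fun e => hvl ((show u = v from e) ▸ hu), fun c hc => ?_⟩
    exact covered_absent (l := ⟨v, true⟩) (hv c hc) hc

theorem Simps.subst {s t : State} (h : Simps s t) (hs : Inv s) :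
    ∃ φ, Subst φ s.clauses (vars s.live) t.clauses (vars t.live) := by
  induction h with
  | refl =>
    exact ⟨idSub, fun u hu => hu, fun u _ => rfl, fun c hc => covered_idSub hc (List.Perm.refl _)⟩
  | tail h1 h ih =>
    obtain ⟨φ, hφ⟩ := ih
    obtain ⟨ψ, hψ⟩ := h.subst (Simps.inv h1 hs)
    exact ⟨_, hφ.comp hψ⟩

/-! ## Resolved formulas -/

/-- Every clause of `F` becomes true by the substitution `φ`, or what remains of it has at least
three literals and distinct variables; the variables `L'` remain. -/
structure Resolves (φ : ℕ → Val) (F : List Clause) (L L' : List ℕ) : Prop where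
  sub : ∀ u ∈ L', u ∈ L
  self : ∀ u ∈ L', φ u = ⟨some u, true⟩
  clause : ∀ c ∈ F, (∀ M, SatC (app φ M) c) ∨
    ((∀ l ∈ c, lv φ l ≠ Val.T) ∧ 3 ≤ (img φ c).length ∧ ClauseNodup (img φ c))

/-- An irreducible formula has no clause with at most one literal, so the condition in the first
alternative of `Covered` becomes void. -/
theorem Subst.resolves {φ : ℕ → Val} {F F' : List Clause} {L L' : List ℕ}
    (h : Subst φ F L F' L') (hF' : Irreducible F') : Resolves φ F L L' := by
  refine ⟨h.sub, h.self, fun c hc => ?_⟩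
  rcases h.cover c hc with h1 | ⟨h1, d, hd, hp⟩
  · refine Or.inl fun M => h1 M fun d hd hl => ?_
    have := (hF' d hd).1
    omega
  · obtain ⟨h2, h3⟩ := hF' d hd
    exact Or.inr ⟨h1, by rwa [← hp.length_eq], ((hp.map _).nodup_iff).1 h3⟩

/-- If a substitution leads to an instance that is not contradictory, then its composition with
the simplifications resolves the formula. -/
theorem Subst.exists_resolves {φ : ℕ → Val} {F : List Clause} {L : List ℕ} {t : State}
    (h : Subst φ F L t.clauses (vars t.live)) (ht : Inv t)
    (hne : [] ∉ (simplify t).val.clauses) :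
    ∃ ψ, Resolves (compSub ψ φ) F L (vars (simplify t).val.live) := by
  obtain ⟨h1, h2⟩ := simplify_spec ht
  obtain ⟨ψ, hψ⟩ := h1.subst ht
  exact ⟨ψ, (h.comp hψ).resolves (h2.resolve_left hne).irreducible⟩

theorem SatC.unique {M : ℕ → Bool} {c : Clause} (h : SatC M c) {l m : Literal} (hl : l ∈ c)
    (hm : m ∈ c) (hlm : m ≠ l) (h' : litv M l = true) : litv M m = false := by
  rw [SatC.perm (List.perm_cons_erase hl), satC_cons, if_pos h'] at h
  exact h m ((List.mem_erase_of_ne hlm).2 hm)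

theorem SatC.exists_true {M : ℕ → Bool} {c : Clause} (h : SatC M c) : ∃ l ∈ c, litv M l = true := by
  have : 0 < c.countP (litv M) := by rw [show c.countP (litv M) = 1 from h]; omega
  simpa using List.countP_pos_iff.1 this

/-! ### Values forced by a single clause of a resolved formula. -/

section

variable {φ : ℕ → Val} {F : List Clause} {L L' : List ℕ} {c : Clause} {l m : Literal}

theorem base_ne_of_nodup_img (hn : ClauseNodup (img φ c)) (hl : l ∈ c) (hm : m ∈ c) (hlm : l ≠ m)
    {u : ℕ} (h : (lv φ l).base = some u) : (lv φ m).base ≠ some u := by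
  intro h'
  have hp : c.Perm (l :: m :: (c.erase l).erase m) :=
    (List.perm_cons_erase hl).trans
      ((List.perm_cons_erase ((List.mem_erase_of_ne hlm.symm).2 hm)).cons l)
  have := ((img_perm (φ := φ) hp).map Literal.var).nodup_iff.1 hn
  unfold img at this
  rw [List.filterMap_cons_some (b := ⟨u, (lv φ l).pos⟩) (by simp [Val.toLit, h]),
    List.filterMap_cons_some (b := ⟨u, (lv φ m).pos⟩) (by simp [Val.toLit, h'])] at this
  simp at this

/-- A clause with a true literal can only be of the identically satisfied kind, and then its other
literals are false under every assignment. -/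
theorem Resolves.of_true (h : Resolves φ F L L') (hc : c ∈ F) (hl : l ∈ c) (hm : m ∈ c)
    (hlm : m ≠ l) (hT : lv φ l = Val.T) : lv φ m = Val.F := by
  rcases h.clause c hc with h1 | ⟨h1, -⟩
  · refine Val.eq_F_of_eval fun M => ?_
    have := (h1 M).unique hl hm hlm (by rw [litv_app, hT]; rfl)
    rwa [litv_app] at this
  · exact absurd hT (h1 l hl)

/-- Complementary values have the same base variable or are constants of which one is true. Neither
is possible in a clause that remains, and in an identically satisfied clause one of the two is
always the true literal. -/
theorem Resolves.of_neg (h : Resolves φ F L L') (hc : c ∈ F) (hl : l ∈ c) (hm : m ∈ c)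
    (hlm : l ≠ m) (hv : lv φ l = (lv φ m).neg) {x : Literal} (hx : x ∈ c) (hxl : x ≠ l)
    (hxm : x ≠ m) : lv φ x = Val.F := by
  rcases h.clause c hc with h1 | ⟨h1, -, h2⟩
  · refine Val.eq_F_of_eval fun M => ?_
    have h3 : litv (app φ M) l = !litv (app φ M) m := by
      rw [litv_app, litv_app, hv, Val.eval_neg]
    rw [← litv_app]
    cases h4 : litv (app φ M) m
    · exact (h1 M).unique hl hx hxl (by rw [h3, h4]; rfl)
    · exact (h1 M).unique hm hx hxm h4
  · rcases e : lv φ m with ⟨_ | u, p⟩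
    · rw [e] at hv
      cases p
      · exact absurd hv (h1 l hl)
      · exact absurd e (h1 m hm)
    · rw [e] at hv
      exact absurd (by rw [e]) (base_ne_of_nodup_img h2 hl hm hlm (u := u) (by rw [hv]; rfl))

/-- Two literals with a common value are never the true one, and a remaining clause does not repeat
a variable. -/
theorem Resolves.of_eq (h : Resolves φ F L L') (hc : c ∈ F) (hl : l ∈ c) (hm : m ∈ c)
    (hlm : l ≠ m) (hv : lv φ l = lv φ m) : lv φ l = Val.F := by
  rcases h.clause c hc with h1 | ⟨h1, -, h2⟩
  · refine Val.eq_F_of_eval fun M => ?_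
    rw [← litv_app]
    by_contra h4
    have h4 : litv (app φ M) l = true := by simpa using h4
    have := (h1 M).unique hl hm hlm.symm h4
    rw [litv_app, ← hv, ← litv_app, h4] at this
    exact absurd this (by simp)
  · rcases e : lv φ m with ⟨_ | u, p⟩
    · cases p
      · rw [hv, e]; rfl
      · exact absurd e (h1 m hm)
    · exact absurd (by rw [e]) (base_ne_of_nodup_img h2 hl hm hlm (u := u) (by rw [hv, e]))

theorem img_eq_nil (h : ∀ x ∈ c, lv φ x = Val.F) : img φ c = [] := by
  unfold img
  rw [List.filterMap_eq_nil_iff]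
  intro x hx
  rw [h x hx]; rfl

/-- At most two literals can remain, but a remaining clause has three. So the clause is identically
satisfied, which means that exactly one of the two is true under each assignment. -/
theorem Resolves.of_false₂ (h : Resolves φ F L L') (hc : c ∈ F) (hn : c.Nodup) (hl : l ∈ c)
    (hm : m ∈ c) (hlm : l ≠ m) (hF : ∀ x ∈ c, x ≠ l → x ≠ m → lv φ x = Val.F) :
    lv φ l = (lv φ m).neg := by
  have hp : c.Perm (l :: m :: (c.erase l).erase m) :=
    (List.perm_cons_erase hl).trans
      ((List.perm_cons_erase ((List.mem_erase_of_ne hlm.symm).2 hm)).cons l)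
  have hF' : ∀ x ∈ (c.erase l).erase m, lv φ x = Val.F := by
    intro x hx
    rw [(hn.erase l).mem_erase_iff, hn.mem_erase_iff] at hx
    exact hF x hx.2.2 hx.2.1 hx.1
  rcases h.clause c hc with h1 | ⟨-, h1, -⟩
  · refine Val.eq_of_eval fun M => ?_
    have h2 := h1 M
    rw [SatC.perm hp, satC_cons, satC_cons, List.forall_mem_cons, litv_app, litv_app] at h2
    rw [Val.eval_neg]
    cases h3 : (lv φ l).eval M <;> cases h4 : (lv φ m).eval M
    · rw [h3, h4] at h2
      simp only [Bool.false_eq_true, if_false] at h2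
      obtain ⟨x, hx, hx'⟩ := h2.exists_true
      rw [litv_app, hF' x hx] at hx'
      exact absurd hx' (by simp)
    · rfl
    · rfl
    · rw [h3, h4] at h2; simp at h2
  · have h2 := (img_perm (φ := φ) hp).length_eq
    have h3 : (img φ (l :: m :: (c.erase l).erase m)).length ≤ 2 := by
      have h4 := img_eq_nil hF'
      unfold img at h4 ⊢
      rw [show l :: m :: (c.erase l).erase m = [l, m] ++ (c.erase l).erase m from rfl,
        List.filterMap_append, h4, List.append_nil]
      exact List.length_filterMap_le _ _
    omega

theorem Resolves.of_false₁ (h : Resolves φ F L L') (hc : c ∈ F) (hn : c.Nodup) (hl : l ∈ c)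
    (hF : ∀ x ∈ c, x ≠ l → lv φ x = Val.F) : lv φ l = Val.T := by
  rcases h.clause c hc with h1 | ⟨-, h1, -⟩
  · refine Val.eq_T_of_eval fun M => ?_
    obtain ⟨x, hx, hx'⟩ := (h1 M).exists_true
    by_cases e : x = l
    · rwa [e, litv_app] at hx'
    · rw [litv_app, hF x hx e] at hx'
      exact absurd hx' (by simp)
  · have h2 := (img_perm (φ := φ) (List.perm_cons_erase hl)).length_eq
    have h3 : (img φ (l :: c.erase l)).length ≤ 1 := by
      have h4 := img_eq_nil (φ := φ) (c := c.erase l) fun x hx => by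
        rw [hn.mem_erase_iff] at hx
        exact hF x hx.2 hx.1
      unfold img at h4 ⊢
      rw [show l :: c.erase l = [l] ++ c.erase l from rfl, List.filterMap_append, h4,
        List.append_nil]
      exact List.length_filterMap_le _ _
    omega

/-- If only one variable remains in a clause, then the clause becomes true. -/
theorem Resolves.satC (h : Resolves φ F L L') (hc : c ∈ F) {u : ℕ}
    (hu : ∀ x ∈ c, (lv φ x).base = none ∨ (lv φ x).base = some u) (M : ℕ → Bool) :
    SatC (app φ M) c := by
  rcases h.clause c hc with h1 | ⟨-, h1, h2⟩
  · exact h1 M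
  · have h3 : ∀ x ∈ img φ c, x.var = u := by
      intro x hx
      obtain ⟨y, hy, hyx⟩ := List.mem_filterMap.1 hx
      rcases hv : lv φ y with ⟨b, p⟩
      have h := hu y hy
      rw [hv] at hyx h
      rcases h with rfl | rfl
      · exact absurd hyx (by simp [Val.toLit])
      · simp only [Val.toLit, Option.map_some, Option.some.injEq] at hyx
        rw [← hyx]
    match hi : img φ c, h1 with
    | a :: b :: _, _ =>
      rw [hi] at h2 h3
      have ha := h3 a (by simp)
      have hb := h3 b (by simp)
      change ((a :: b :: _).map Literal.var).Nodup at h2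
      rw [List.map_cons, List.map_cons, ha, hb] at h2
      simp at h2

/-- Counting the remaining variables. -/
theorem Resolves.card_le (h : Resolves φ F L L') (hL : L.Nodup) (hL' : L'.Nodup) (V B : Finset ℕ)
    (hV : ∀ v ∈ V, v ∈ L) (hB : ∀ v ∈ V, (φ v).base = none ∨ ∃ u ∈ B, (φ v).base = some u) :
    L'.length + V.card ≤ L.length + B.card := by
  rw [← List.toFinset_card_of_nodup hL, ← List.toFinset_card_of_nodup hL']
  -- A surviving variable is its own value. If it lies in `V`, then it must be one of the base
  -- variables in `B`.
  have h1 : L'.toFinset ⊆ (L.toFinset \ V) ∪ B := by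
    intro u hu
    rw [List.mem_toFinset] at hu
    rw [Finset.mem_union, Finset.mem_sdiff, List.mem_toFinset]
    by_cases hv : u ∈ V
    · refine Or.inr ?_
      have h2 := hB u hv
      rw [h.self u hu] at h2
      simpa using h2
    · exact Or.inl ⟨h.sub u hu, hv⟩
  have h2 := (Finset.card_le_card h1).trans (Finset.card_union_le _ _)
  have h3 : V ⊆ L.toFinset := fun v hv => List.mem_toFinset.2 (hV v hv)
  have h4 := Finset.card_sdiff_add_card_eq_card h3
  omega

end

/-! ## The variables eliminated by branching -/

/-- At least `r` variables are eliminated if the literal `a` of the clause `w` is true. -/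
def ForcesUnit (s : State) (w : Clause) (a : Literal) (r : ℕ) : Prop :=
  ∀ φ L', Resolves φ s.clauses (vars s.live) L' → L'.Nodup → lv φ a = Val.T →
    (∀ x ∈ w, x ≠ a → lv φ x = Val.F) → L'.length + r ≤ s.live.length

/-- At least `r` variables are eliminated if exactly one of the literals `a` and `b` of the clause
`w` is true. -/
def ForcesPair (s : State) (w : Clause) (a b : Literal) (r : ℕ) : Prop :=
  ∀ φ L', Resolves φ s.clauses (vars s.live) L' → L'.Nodup → lv φ a = (lv φ b).neg →
    (∀ x ∈ w, x ≠ a → x ≠ b → lv φ x = Val.F) → L'.length + r ≤ s.live.length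

theorem ForcesUnit.perm {s : State} {w w' : Clause} (h : w.Perm w') {a : Literal} {r : ℕ}
    (hf : ForcesUnit s w a r) : ForcesUnit s w' a r :=
  fun φ L' h1 h2 h3 h4 => hf φ L' h1 h2 h3 fun x hx => h4 x (h.mem_iff.1 hx)

theorem ForcesPair.perm {s : State} {w w' : Clause} (h : w.Perm w') {a b : Literal} {r : ℕ}
    (hf : ForcesPair s w a b r) : ForcesPair s w' a b r :=
  fun φ L' h1 h2 h3 h4 => hf φ L' h1 h2 h3 fun x hx => h4 x (h.mem_iff.1 hx)

theorem ForcesPair.symm {s : State} {w : Clause} {a b : Literal} {r : ℕ}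
    (hf : ForcesPair s w a b r) : ForcesPair s w b a r :=
  fun φ L' h1 h2 h3 h4 => hf φ L' h1 h2 (by rw [h3, Val.neg_neg]) fun x hx hxa hxb => h4 x hx hxb hxa

/-- The value of `x` is fixed or depends on one of the literals `reps`. -/
def DependsOn (φ : ℕ → Val) (reps : List Literal) (x : Literal) : Prop :=
  (lv φ x).base = none ∨ ∃ y ∈ reps, (lv φ x).base = (lv φ y).base

theorem dependsOn_of_eq_F {φ : ℕ → Val} {reps : List Literal} {x : Literal} (h : lv φ x = Val.F) :
    DependsOn φ reps x := Or.inl (by rw [h]; rfl)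

theorem dependsOn_of_eq_T {φ : ℕ → Val} {reps : List Literal} {x : Literal} (h : lv φ x = Val.T) :
    DependsOn φ reps x := Or.inl (by rw [h]; rfl)

/-- Each variable of `ws` is constant or shares its base with a representative, so at most as many
of them survive as there are representatives. All estimates of eliminated variables reduce to this
one. -/
theorem Resolves.count {s : State} (hs : Inv s) {φ : ℕ → Val} {L' : List ℕ}
    (h : Resolves φ s.clauses (vars s.live) L') (hL' : L'.Nodup) {ws : Clause}
    (hn : ClauseNodup ws) (hmem : ∀ x ∈ ws, x.var ∈ vars s.live) (reps : List Literal)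
    (hd : ∀ x ∈ ws, DependsOn φ reps x) :
    L'.length + ws.length ≤ s.live.length + reps.length := by
  have h1 := h.card_le hs.nodup hL' (ws.map Literal.var).toFinset
    (reps.filterMap fun y => (lv φ y).base).toFinset
    (fun v hv => by
      obtain ⟨x, hx, rfl⟩ := List.mem_map.1 (List.mem_toFinset.1 hv)
      exact hmem x hx)
    (fun v hv => by
      obtain ⟨x, hx, rfl⟩ := List.mem_map.1 (List.mem_toFinset.1 hv)
      rw [← lv_base]
      rcases hd x hx with h | ⟨y, hy, h⟩
      · exact Or.inl h
      · cases hb : (lv φ y).base with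
        | none => exact Or.inl (h.trans hb)
        | some u =>
          exact Or.inr ⟨u, List.mem_toFinset.2 (List.mem_filterMap.2 ⟨y, hy, hb⟩), h.trans hb⟩)
  rw [List.toFinset_card_of_nodup hn, List.length_map, List.length_map] at h1
  have h2 := List.toFinset_card_le (reps.filterMap fun y => (lv φ y).base)
  have h3 := List.length_filterMap_le (fun y => (lv φ y).base) reps
  omega

theorem clauseNodup_append {w xs : Clause} (hw : ClauseNodup w) (hxs : ClauseNodup xs)
    (hd : ∀ x ∈ xs, x.var ∉ w.map Literal.var) : ClauseNodup (w ++ xs) := by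
  rw [ClauseNodup, List.map_append, List.nodup_append]
  refine ⟨hw, hxs, fun v hv u hu e => ?_⟩
  obtain ⟨x, hx, rfl⟩ := List.mem_map.1 hu
  exact hd x hx (e ▸ hv)

/-- A clause with distinct variables of the instance. -/
structure Local (s : State) (w : Clause) : Prop where
  nodup : ClauseNodup w
  mem : ∀ x ∈ w, x.var ∈ vars s.live

/-- Literals of distinct variables of the instance that do not occur in `w`. -/
structure New (s : State) (w xs : Clause) : Prop where
  nodup : ClauseNodup xs
  mem : ∀ x ∈ xs, x.var ∈ vars s.live
  new : ∀ x ∈ xs, x.var ∉ w.map Literal.var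

theorem new_nil (s : State) (w : Clause) : New s w [] :=
  ⟨List.nodup_nil, by simp, by simp⟩

section

variable {s : State} {w : Clause} (hs : Inv s) (hw : Local s w)

include hs hw

theorem forcesUnit_of {xs : Clause} (hx : New s w xs) {a : Literal} (reps : List Literal) (r : ℕ)
    (hr : r + reps.length ≤ w.length + xs.length)
    (H : ∀ φ L', Resolves φ s.clauses (vars s.live) L' → lv φ a = Val.T →
      (∀ x ∈ w, x ≠ a → lv φ x = Val.F) → ∀ x ∈ xs, DependsOn φ reps x) :
    ForcesUnit s w a r := by
  intro φ L' h hL' hT hF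
  have hxs := H φ L' h hT hF
  have := h.count hs hL' (clauseNodup_append hw.nodup hx.nodup hx.new)
    (fun x hx' => (List.mem_append.1 hx').elim (hw.mem x) (hx.mem x)) reps
    (fun x hx' => by
      rcases List.mem_append.1 hx' with h1 | h1
      · by_cases e : x = a
        · exact dependsOn_of_eq_T (e ▸ hT)
        · exact dependsOn_of_eq_F (hF x h1 e)
      · exact hxs x h1)
  rw [List.length_append] at this
  omega

/-- The literal `b` is not listed, because its value is the negation of that of `a` and has the same
base. -/
theorem forcesPair_of {xs : Clause} (hx : New s w xs) {a b : Literal} (reps : List Literal) (r : ℕ)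
    (hr : r + reps.length ≤ w.length + xs.length)
    (H : ∀ φ L', Resolves φ s.clauses (vars s.live) L' → lv φ a = (lv φ b).neg →
      (∀ x ∈ w, x ≠ a → x ≠ b → lv φ x = Val.F) → ∀ x ∈ a :: xs, DependsOn φ reps x) :
    ForcesPair s w a b r := by
  intro φ L' h hL' hab hF
  have hxs := H φ L' h hab hF
  have hb : DependsOn φ reps b := by
    have := hxs a (by simp)
    unfold DependsOn at this ⊢
    rwa [hab, Val.neg_base] at this
  have := h.count hs hL' (clauseNodup_append hw.nodup hx.nodup hx.new)
    (fun x hx' => (List.mem_append.1 hx').elim (hw.mem x) (hx.mem x)) reps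
    (fun x hx' => by
      rcases List.mem_append.1 hx' with h1 | h1
      · by_cases e : x = a
        · exact e ▸ hxs a (by simp)
        · by_cases e' : x = b
          · exact e' ▸ hb
          · exact dependsOn_of_eq_F (hF x h1 e e')
      · exact hxs x (by simp [h1]))
  rw [List.length_append] at this
  omega

theorem forcesUnit_base (a : Literal) : ForcesUnit s w a w.length :=
  forcesUnit_of hs hw (new_nil s w) [] _ (by simp) (by simp)

theorem forcesPair_base (a b : Literal) : ForcesPair s w a b (w.length - 1) := by
  -- Natural subtraction makes the claim trivial for an empty clause, whereas counting with one
  -- representative would not give it.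
  by_cases hl : w.length = 0
  · intro φ L' h hL' _ _
    have := h.count hs hL' (ws := []) List.nodup_nil (by simp) [] (by simp)
    simp only [List.length_nil] at this
    omega
  · exact forcesPair_of hs hw (new_nil s w) [a] _ (by simp; omega)
      fun φ L' _ _ _ x hx => Or.inr ⟨a, by simp, by simp_all⟩

omit hs hw in
theorem forcesUnit_absurd {a : Literal}
    (H : ∀ φ L', Resolves φ s.clauses (vars s.live) L' → lv φ a = Val.T →
      (∀ x ∈ w, x ≠ a → lv φ x = Val.F) → False) (r : ℕ) : ForcesUnit s w a r :=
  fun φ L' h _ hT hF => (H φ L' h hT hF).elim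

end

/-! ### Two clauses on the same variables -/

/-- An assignment under which `a` is the only true literal of `w`. -/
def unitAssign (w : Clause) (a : Literal) : ℕ → Bool :=
  fun v => if v = a.var then a.pos else decide ((⟨v, false⟩ : Literal) ∈ w)

theorem eq_of_var_eq {w : Clause} (hn : ClauseNodup w) {x y : Literal} (hx : x ∈ w) (hy : y ∈ w)
    (h : x.var = y.var) : x = y := List.inj_on_of_nodup_map hn hx hy h

theorem litv_unitAssign {w : Clause} (hn : ClauseNodup w) {a x : Literal} (ha : a ∈ w)
    (hx : x ∈ w) : litv (unitAssign w a) x = decide (x = a) := by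
  unfold litv unitAssign
  by_cases h : x.var = a.var
  · have := eq_of_var_eq hn hx ha h
    simp [this]
  · have hxa : x ≠ a := fun e => h (by rw [e])
    rw [if_neg h]
    obtain ⟨v, _ | _⟩ := x
    · simp [hx, hxa]
    · have : (⟨v, false⟩ : Literal) ∉ w := fun h' => by
        have := eq_of_var_eq hn hx h' rfl
        simp at this
      simp [this, hxa]

theorem exists_ne_ne {w : Clause} (hn : ClauseNodup w) (h3 : 3 ≤ w.length) (a b : Literal) :
    ∃ c ∈ w, c ≠ a ∧ c ≠ b := by
  by_contra! h
  have hn' : w.Nodup := hn.of_map _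
  have : w.toFinset ⊆ {a, b} := by
    intro x hx
    rw [Finset.mem_insert, Finset.mem_singleton]
    by_contra! h'
    exact h'.2 (h x (List.mem_toFinset.1 hx) h'.1)
  have h1 := (Finset.card_le_card this).trans Finset.card_le_two
  rw [List.toFinset_card_of_nodup hn'] at h1
  omega

theorem exists_eq_or_eq_neg {w : Clause} {x : Literal} (h : x.var ∈ w.map Literal.var) :
    ∃ y ∈ w, x = y ∨ x = y.neg := by
  obtain ⟨y, hy, e⟩ := List.mem_map.1 h
  exact ⟨y, hy, Literal.eq_or_eq_neg e.symm⟩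

/-- Suppose that `d` is satisfied whenever exactly one literal of `w` is true. If `d` contained the
negation of some `a` in `w`, the case of `a` being true would need another true literal in `d`, the
negation of some `y'`; a third literal of `w` being true then makes both negations true. So `d` lies
in `w`, and it contains each literal of `w` since that may be the only true one. Three literals are
needed: for `w` = (a ∨ b), the clause (¬a ∨ ¬b) has the same models. -/
theorem exists_not_satC {w d : Clause} (hw : ClauseNodup w) (h3 : 3 ≤ w.length)
    (hd : ClauseNodup d) (hsub : ∀ x ∈ d, x.var ∈ w.map Literal.var)
    (hne : ¬ ∀ l, l ∈ d ↔ l ∈ w) : ∃ a ∈ w, ¬ SatC (unitAssign w a) d := by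
  by_contra! h
  have hneg : ∀ a ∈ w, a.neg ∉ d := by
    intro a ha hna
    obtain ⟨y, hy, hyt⟩ := (h a ha).exists_true
    obtain ⟨y', hy', rfl | rfl⟩ := exists_eq_or_eq_neg (hsub y hy)
    · rw [litv_unitAssign hw ha hy'] at hyt
      have e := of_decide_eq_true hyt
      subst e
      exact Literal.neg_ne y (eq_of_var_eq hd hna hy rfl)
    · rw [litv_neg, litv_unitAssign hw ha hy'] at hyt
      have hya : y' ≠ a := by simpa using hyt
      obtain ⟨c, hc, hca, hcy⟩ := exists_ne_ne hw h3 a y'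
      have h1 : litv (unitAssign w c) a.neg = true := by
        rw [litv_neg, litv_unitAssign hw hc ha]; simpa using hca.symm
      have h2 : litv (unitAssign w c) y'.neg = true := by
        rw [litv_neg, litv_unitAssign hw hc hy']; simpa using hcy.symm
      have := (h c hc).unique hna hy (fun e => hya (by
        rw [← Literal.neg_neg y', e, Literal.neg_neg])) h1
      rw [h2] at this
      exact absurd this (by simp)
  have hpos : ∀ x ∈ d, x ∈ w := by
    intro x hx
    obtain ⟨y, hy, rfl | rfl⟩ := exists_eq_or_eq_neg (hsub x hx)
    · exact hy
    · exact absurd hx (hneg y hy)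
  refine hne fun l => ⟨hpos l, fun hl => ?_⟩
  obtain ⟨y, hy, hyt⟩ := (h l hl).exists_true
  rw [litv_unitAssign hw hl (hpos y hy)] at hyt
  exact of_decide_eq_true hyt ▸ hy

/-- Take a literal `a` for which `d` fails when `a` alone is true in `w`. If `a` and `b` are
complementary and still depend on a variable, it is the only variable left in `d`, so `d` holds for
both of its values. One of these makes `a` the true literal of `w`, a contradiction; so no variable
of `w` survives. -/
theorem exists_forcesPair {s : State} {w d : Clause} (hs : Inv s) (hw : Local s w)
    (h3 : 3 ≤ w.length) (hds : d ∈ s.clauses) (hd : ClauseNodup d)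
    (hsub : ∀ x ∈ d, x.var ∈ w.map Literal.var) (hne : ¬ ∀ l, l ∈ d ↔ l ∈ w) :
    ∃ a ∈ w, ∀ b ∈ w, b ≠ a → ForcesPair s w a b w.length := by
  obtain ⟨a, ha, hna⟩ := exists_not_satC hw.nodup h3 hd hsub hne
  refine ⟨a, ha, fun b hb hba => forcesPair_of hs hw (new_nil s w) [] _ (by simp) ?_⟩
  intro φ L' h hab hF x hx
  rw [List.mem_singleton] at hx
  subst hx
  left
  by_contra hbase
  obtain ⟨u, hu⟩ := Option.ne_none_iff_exists'.1 hbase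
  have hbase' : ∀ y ∈ w, (lv φ y).base = none ∨ (lv φ y).base = some u := by
    intro y hy
    by_cases e : y = x
    · exact Or.inr (e ▸ hu)
    · by_cases e' : y = b
      · rw [hab, Val.neg_base] at hu
        exact Or.inr (e' ▸ hu)
      · exact Or.inl (by rw [hF y hy e e']; rfl)
  -- The assignment is constant, with the value that makes the literal `x` true.
  have hsat := h.satC hds (u := u) (fun y hy => by
    obtain ⟨z, hz, rfl | rfl⟩ := exists_eq_or_eq_neg (hsub y hy)
    · exact hbase' y hz
    · rw [lv_neg, Val.neg_base]; exact hbase' z hz) fun _ => (lv φ x).pos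
  refine hna ((satC_congr ?_).1 hsat)
  have hxt : (lv φ x).eval (fun _ => (lv φ x).pos) = true := by
    unfold Val.eval
    rw [hu]
    simp
  have key : ∀ y ∈ w, litv (app φ fun _ => (lv φ x).pos) y = litv (unitAssign w x) y := by
    intro y hy
    rw [litv_unitAssign hw.nodup ha hy, litv_app]
    by_cases e : y = x
    · subst e; simp [hxt]
    · by_cases e' : y = b
      · have h2 := congrArg (Val.eval fun _ => (lv φ x).pos) hab
        rw [hxt, Val.eval_neg, ← e'] at h2
        simpa [e] using h2.symm
      · rw [hF y hy e e']; simp [e]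
  intro y hy
  obtain ⟨z, hz, rfl | rfl⟩ := exists_eq_or_eq_neg (hsub y hy)
  · exact key y hz
  · rw [litv_neg, litv_neg, key z hz]

/-! ### New variables -/

section

variable {s : State} {w d : Clause} (hs : Inv s) (hw : Local s w) (hds : d ∈ s.clauses)

include hs hw hds

/-- All new variables of a clause with the literal `a` are eliminated if `a` is true. -/
theorem forcesUnit_new {xs : Clause} (hx : New s w xs) {a : Literal} (ha : a ∈ w) (had : a ∈ d)
    (hxd : ∀ x ∈ xs, x ∈ d) : ForcesUnit s w a (w.length + xs.length) :=
  forcesUnit_of hs hw hx [] _ (by simp) fun _ _ h hT _ x hx' =>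
    dependsOn_of_eq_F (h.of_true hds had (hxd x hx')
      (fun e => hx.new x hx' (e ▸ List.mem_map_of_mem ha)) hT)

/-- All new variables of a clause with the literals `a` and `b` are eliminated if exactly one of
them is true. -/
theorem forcesPair_new {xs : Clause} (hx : New s w xs) {a b : Literal} (ha : a ∈ w) (hb : b ∈ w)
    (hab : a ≠ b) (had : a ∈ d) (hbd : b ∈ d) (hxd : ∀ x ∈ xs, x ∈ d) :
    ForcesPair s w a b (w.length + xs.length - 1) := by
  have : 0 < w.length := List.length_pos_of_mem ha
  refine forcesPair_of hs hw hx [a] _ (by simp only [List.length_cons, List.length_nil]; omega) ?_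
  intro φ L' h hv _ x hx'
  rcases List.mem_cons.1 hx' with rfl | hx'
  · exact Or.inr ⟨x, by simp, rfl⟩
  · exact dependsOn_of_eq_F (h.of_neg hds had hbd hab hv (hxd x hx')
      (fun e => hx.new x hx' (e ▸ List.mem_map_of_mem ha))
      (fun e => hx.new x hx' (e ▸ List.mem_map_of_mem hb)))

/-- New variables of a clause with the negation of the literal `c` are eliminated if another
literal of `w` is true. -/
theorem forcesUnit_neg {xs : Clause} (hx : New s w xs) {a c : Literal} (hc : c ∈ w) (hca : c ≠ a)
    (hcd : c.neg ∈ d) (hxd : ∀ x ∈ xs, x ∈ d) : ForcesUnit s w a (w.length + xs.length) := by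
  refine forcesUnit_of hs hw hx [] _ (by simp) fun φ L' h _ hF x hx' => ?_
  have hT : lv φ c.neg = Val.T := by rw [lv_neg, hF c hc hca]; rfl
  exact dependsOn_of_eq_F (h.of_true hds hcd (hxd x hx')
    (fun e => hx.new x hx' (List.mem_map.2 ⟨c, hc, by rw [e]; rfl⟩)) hT)

/-- A literal outside the pair is false, so its negation is the true literal of `d` and all new
literals of `d` are false. One variable of the pair may survive. -/
theorem forcesPair_neg {xs : Clause} (hx : New s w xs) {a b c : Literal} (hc : c ∈ w)
    (hca : c ≠ a) (hcb : c ≠ b) (hcd : c.neg ∈ d) (hxd : ∀ x ∈ xs, x ∈ d) :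
    ForcesPair s w a b (w.length + xs.length - 1) := by
  have : 0 < w.length := List.length_pos_of_mem hc
  refine forcesPair_of hs hw hx [a] _ (by simp only [List.length_cons, List.length_nil]; omega) ?_
  intro φ L' h _ hF x hx'
  rcases List.mem_cons.1 hx' with rfl | hx'
  · exact Or.inr ⟨x, by simp, rfl⟩
  · have hT : lv φ c.neg = Val.T := by rw [lv_neg, hF c hc hca hcb]; rfl
    exact dependsOn_of_eq_F (h.of_true hds hcd (hxd x hx')
      (fun e => hx.new x hx' (List.mem_map.2 ⟨c, hc, by rw [e]; rfl⟩)) hT)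

/-- A clause consisting of the literal `c` and of two new literals eliminates a variable if `c` is
false. -/
theorem forcesUnit_link (hd : ClauseNodup d) {x y : Literal} (hx : New s w [x, y]) {a c : Literal}
    (hc : c ∈ w) (hca : c ≠ a) (hp : d.Perm [c, x, y]) : ForcesUnit s w a (w.length + 1) := by
  refine forcesUnit_of hs hw hx [x] _ (by simp) fun φ L' h _ hF z hz => ?_
  have hxy : x ≠ y := fun e => absurd hx.nodup (by simp [e, ClauseNodup])
  have hv : lv φ x = (lv φ y).neg := by
    refine h.of_false₂ hds (hd.of_map _) (hp.mem_iff.2 (by simp)) (hp.mem_iff.2 (by simp)) hxy ?_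
    intro z hz hzx hzy
    have := hp.mem_iff.1 hz
    simp only [List.mem_cons, List.not_mem_nil, or_false, hzx, hzy] at this
    exact this ▸ hF c hc hca
  refine Or.inr ⟨x, by simp, ?_⟩
  simp only [List.mem_cons, List.not_mem_nil, or_false] at hz
  rcases hz with rfl | rfl
  · rfl
  · rw [hv]; rfl

/-- Among the variables of `w` and the two new ones, at most two survive: one for the pair and one
for the new literals, which have become complementary. -/
theorem forcesPair_link (hd : ClauseNodup d) {x y : Literal} (hx : New s w [x, y])
    {a b c : Literal} (hc : c ∈ w) (hca : c ≠ a) (hcb : c ≠ b) (hp : d.Perm [c, x, y]) :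
    ForcesPair s w a b w.length := by
  refine forcesPair_of hs hw hx [a, x] _ (by simp) fun φ L' h _ hF z hz => ?_
  have hxy : x ≠ y := fun e => absurd hx.nodup (by simp [e, ClauseNodup])
  have hv : lv φ x = (lv φ y).neg := by
    refine h.of_false₂ hds (hd.of_map _) (hp.mem_iff.2 (by simp)) (hp.mem_iff.2 (by simp)) hxy ?_
    intro z hz hzx hzy
    have := hp.mem_iff.1 hz
    simp only [List.mem_cons, List.not_mem_nil, or_false, hzx, hzy] at this
    exact this ▸ hF c hc hca hcb
  simp only [List.mem_cons, List.not_mem_nil, or_false] at hz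
  rcases hz with rfl | rfl | rfl
  · exact Or.inr ⟨z, by simp, rfl⟩
  · exact Or.inr ⟨z, by simp, rfl⟩
  · exact Or.inr ⟨x, by simp, by rw [hv]; rfl⟩

omit hs hw in
/-- A clause cannot contain the negation of a literal of `w` other than the true literal `a`. -/
theorem forcesUnit_conflict {a c : Literal} (hc : c ∈ w) (hca : c ≠ a) (had : a ∈ d)
    (hcd : c.neg ∈ d) (hne : c.neg ≠ a) (r : ℕ) : ForcesUnit s w a r := by
  refine forcesUnit_absurd (fun φ L' h hT hF => ?_) r
  have h1 := h.of_true hds had hcd hne hT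
  rw [lv_neg, hF c hc hca] at h1
  exact Val.T_ne_F h1

/-- Both variables are eliminated if one of `a` and `b` is true, and a clause contains `a` and the
negation of `b`. -/
theorem forcesPair_conflict {a b : Literal} (had : a ∈ d) (hbd : b.neg ∈ d) (hne : a ≠ b.neg) :
    ForcesPair s w a b w.length := by
  refine forcesPair_of hs hw (new_nil s w) [] _ (by simp) fun φ L' h hv _ x hx => ?_
  rw [List.mem_singleton] at hx
  subst hx
  exact dependsOn_of_eq_F (h.of_eq hds had hbd hne (by rw [hv, lv_neg]))

/-- A clause consisting of the literals `b` and `c` of `w` and of a new literal eliminates its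
variable if `b` and `c` are false. -/
theorem forcesPair_last (hd : ClauseNodup d) {x : Literal} (hx : New s w [x]) {a a' b c : Literal}
    (hb : b ∈ w) (hc : c ∈ w) (hba : b ≠ a) (hba' : b ≠ a') (hca : c ≠ a) (hca' : c ≠ a')
    (hp : d.Perm [b, c, x]) : ForcesPair s w a a' w.length := by
  refine forcesPair_of hs hw hx [a] _ (by simp) fun φ L' h _ hF z hz => ?_
  simp only [List.mem_cons, List.not_mem_nil, or_false] at hz
  rcases hz with rfl | rfl
  · exact Or.inr ⟨z, by simp, rfl⟩
  · refine dependsOn_of_eq_T (h.of_false₁ hds (hd.of_map _) (hp.mem_iff.2 (by simp)) ?_)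
    intro y hy hyz
    have := hp.mem_iff.1 hy
    simp only [List.mem_cons, List.not_mem_nil, or_false, hyz] at this
    rcases this with rfl | rfl
    · exact hF y hb hba hba'
    · exact hF y hc hca hca'

end

/-! ## Branching on a clause with three literals -/

/-- The reciprocal of the base of the exponential bound. -/
noncomputable def zeta : ℝ := 0.54502

theorem zeta_pos : 0 < zeta := by unfold zeta; norm_num

theorem zeta_lt_one : zeta < 1 := by unfold zeta; norm_num

theorem new_of_mem {s : State} {w d xs : Clause} (hs : Inv s) (hds : d ∈ s.clauses)
    (hn : ClauseNodup xs) (hxd : ∀ x ∈ xs, x ∈ d) (hx : ∀ x ∈ xs, x.var ∉ w.map Literal.var) :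
    New s w xs :=
  ⟨hn, fun x h => hs.mem d hds x (hxd x h), hx⟩

theorem new_singleton {s : State} {w d : Clause} (hs : Inv s) (hds : d ∈ s.clauses) {x : Literal}
    (hxd : x ∈ d) (hx : x.var ∉ w.map Literal.var) : New s w [x] :=
  new_of_mem hs hds (List.nodup_singleton _) (by simpa using hxd) (by simpa using hx)

/-- By themselves the branches eliminate 3, 2, 2, 2 variables, which is not enough. If `d` brings no
new variable, two pair branches improve to 3. Otherwise a new variable disappears either if `a` is
true or, when `d` contains the negation of `a`, if `a` is false. The largest sum is ζ⁴ + 3ζ². -/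
theorem three_forces {s : State} {a b c : Literal} (hs : Inv s) (hw : Local s [a, b, c])
    {d : Clause} (hds : d ∈ s.clauses) (hd : ClauseNodup d)
    (had : ∃ x ∈ d, x.var = a.var) (hne : ¬ ∀ l, l ∈ d ↔ l ∈ [a, b, c]) :
    ∃ r₁ r₂ r₃ r₄ : ℕ, ForcesUnit s [a, b, c] a r₁ ∧ ForcesPair s [a, b, c] b c r₂ ∧
      ForcesPair s [a, b, c] a b r₃ ∧ ForcesPair s [a, b, c] a c r₄ ∧
      zeta ^ r₁ + zeta ^ r₂ + zeta ^ r₃ + zeta ^ r₄ ≤ 1 := by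
  have hab : a ≠ b := fun e => absurd hw.nodup (by simp [e, ClauseNodup])
  have hac : a ≠ c := fun e => absurd hw.nodup (by simp [e, ClauseNodup])
  have hbc : b ≠ c := fun e => absurd hw.nodup (by simp [e, ClauseNodup])
  have u1 := forcesUnit_base hs hw a
  have p := fun x y => forcesPair_base hs hw x y
  by_cases hsub : ∀ x ∈ d, x.var ∈ [a, b, c].map Literal.var
  · obtain ⟨m, hm, h⟩ := exists_forcesPair hs hw le_rfl hds hd hsub hne
    simp only [List.mem_cons, List.not_mem_nil, or_false] at hm
    rcases hm with rfl | rfl | rfl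
    · exact ⟨_, _, _, _, u1, p _ _, h b (by simp) hab.symm, h c (by simp) hac.symm,
        by norm_num [zeta]⟩
    · exact ⟨_, _, _, _, u1, h c (by simp) hbc.symm, (h a (by simp) hab).symm, p _ _,
        by norm_num [zeta]⟩
    · exact ⟨_, _, _, _, u1, (h b (by simp) hbc).symm, p _ _, (h a (by simp) hac).symm,
        by norm_num [zeta]⟩
  · push Not at hsub
    obtain ⟨x, hxd, hx⟩ := hsub
    have hX := new_singleton hs hds hxd hx
    obtain ⟨y, hy, hya⟩ := had
    rcases Literal.eq_or_eq_neg hya with rfl | rfl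
    · exact ⟨_, _, _, _, forcesUnit_new hs hw hds hX (by simp) hy (by simpa using hxd), p _ _,
        p _ _, p _ _, by norm_num [zeta]⟩
    · exact ⟨_, _, _, _, u1, forcesPair_neg hs hw hds hX (c := a) (by simp) hab hac hy
        (by simpa using hxd), p _ _, p _ _, by norm_num [zeta]⟩

/-! ## Branching on a clause with four literals -/

/-- The branches on a clause with four literals eliminate sufficiently many variables. -/
def FourForces (s : State) (a b c e : Literal) : Prop :=
  ∃ r₁ r₂ r₃ r₄ r₅ r₆ r₇ r₈ : ℕ, ForcesUnit s [a, b, c, e] a r₁ ∧ ForcesUnit s [a, b, c, e] b r₂ ∧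
    ForcesPair s [a, b, c, e] c e r₃ ∧ ForcesPair s [a, b, c, e] b c r₄ ∧
    ForcesPair s [a, b, c, e] b e r₅ ∧ ForcesPair s [a, b, c, e] a b r₆ ∧
    ForcesPair s [a, b, c, e] a c r₇ ∧ ForcesPair s [a, b, c, e] a e r₈ ∧
    zeta ^ r₁ + zeta ^ r₂ + zeta ^ r₃ + zeta ^ r₄ + zeta ^ r₅ + zeta ^ r₆ + zeta ^ r₇ + zeta ^ r₈ ≤ 1

theorem perm_swap_last (a b c e : Literal) : [a, b, e, c].Perm [a, b, c, e] :=
  ((List.Perm.swap c e []).cons b).cons a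

/-- The literals `c` and `e` play the same role in the branching, so the cases need to be treated
for one of them only. -/
theorem FourForces.swap {s : State} {a b c e : Literal} (h : FourForces s a b e c) :
    FourForces s a b c e := by
  obtain ⟨r₁, r₂, r₃, r₄, r₅, r₆, r₇, r₈, h1, h2, h3, h4, h5, h6, h7, h8, hz⟩ := h
  have hp := perm_swap_last a b c e
  exact ⟨r₁, r₂, r₃, r₅, r₄, r₆, r₈, r₇, h1.perm hp, h2.perm hp, (h3.perm hp).symm, h5.perm hp,
    h4.perm hp, h6.perm hp, h8.perm hp, h7.perm hp, by linarith⟩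

theorem Local.swap {s : State} {a b c e : Literal} (h : Local s [a, b, c, e]) :
    Local s [a, b, e, c] :=
  ⟨(((perm_swap_last a b c e).map _).nodup_iff).2 h.nodup,
    fun x hx => h.mem x ((perm_swap_last a b c e).mem_iff.1 hx)⟩

structure FourDistinct (a b c e : Literal) : Prop where
  ab : a.var ≠ b.var
  ac : a.var ≠ c.var
  ae : a.var ≠ e.var
  bc : b.var ≠ c.var
  be : b.var ≠ e.var
  ce : c.var ≠ e.var

theorem Local.fourDistinct {s : State} {a b c e : Literal} (h : Local s [a, b, c, e]) :
    FourDistinct a b c e := by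
  have := h.nodup
  simp only [ClauseNodup, List.map_cons, List.map_nil, List.nodup_cons, List.mem_cons,
    List.not_mem_nil, or_false, not_or, List.nodup_nil, and_true, not_false_eq_true] at this
  exact ⟨this.1.1, this.1.2.1, this.1.2.2, this.2.1.1, this.2.1.2, this.2.2⟩

theorem ne_of_var_ne {x y : Literal} (h : x.var ≠ y.var) : x ≠ y := fun e => h (by rw [e])

section

variable {s : State} {a b c e : Literal} (hs : Inv s) (hw : Local s [a, b, c, e]) {d : Clause}
  (hds : d ∈ s.clauses) (hd : ClauseNodup d)

include hs hw hds hd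

/-- Each literal of `w` belongs to three of the six pairs, and for a suitable literal these three
branches eliminate all four variables instead of three. -/
theorem four_of_subset (hsub : ∀ x ∈ d, x.var ∈ [a, b, c, e].map Literal.var)
    (hne : ¬ ∀ l, l ∈ d ↔ l ∈ [a, b, c, e]) : FourForces s a b c e := by
  have hv := hw.fourDistinct
  have hab := ne_of_var_ne hv.ab
  have hac := ne_of_var_ne hv.ac
  have hae := ne_of_var_ne hv.ae
  have hbc := ne_of_var_ne hv.bc
  have hbe := ne_of_var_ne hv.be
  have hce := ne_of_var_ne hv.ce
  have u := fun x => forcesUnit_base hs hw x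
  have p := fun x y => forcesPair_base hs hw x y
  obtain ⟨m, hm, h⟩ := exists_forcesPair hs hw (by simp) hds hd hsub hne
  simp only [List.mem_cons, List.not_mem_nil, or_false] at hm
  rcases hm with rfl | rfl | rfl | rfl
  · exact ⟨_, _, _, _, _, _, _, _, u _, u _, p _ _, p _ _, p _ _, h b (by simp) hab.symm,
      h c (by simp) hac.symm, h e (by simp) hae.symm, by norm_num [zeta]⟩
  · exact ⟨_, _, _, _, _, _, _, _, u _, u _, p _ _, h c (by simp) hbc.symm, h e (by simp) hbe.symm,
      (h a (by simp) hab).symm, p _ _, p _ _, by norm_num [zeta]⟩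
  · exact ⟨_, _, _, _, _, _, _, _, u _, u _, h e (by simp) hce.symm, (h b (by simp) hbc).symm,
      p _ _, p _ _, (h a (by simp) hac).symm, p _ _, by norm_num [zeta]⟩
  · exact ⟨_, _, _, _, _, _, _, _, u _, u _, (h c (by simp) hce).symm, p _ _,
      (h b (by simp) hbe).symm, p _ _, p _ _, (h a (by simp) hae).symm, by norm_num [zeta]⟩

/-- The clause `d` shares `a` and `c` with `w`. The new variable improves the branch with `a` true
and the pair of `a` and `c`. A further gain comes from `e` if it is in `d`, from a second new
variable, or, if `d` has three literals, from the pair of `b` and `e`, where `a` and `c` are false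
and the new literal must be true. -/
theorem four_of_shared (hlen : d.length ≤ 4) (had : a ∈ d) (hcd : c ∈ d)
    (hbd : b.var ∉ d.map Literal.var) (hed : e.neg ∉ d) {x : Literal} (hxd : x ∈ d)
    (hx : x.var ∉ [a, b, c, e].map Literal.var) : FourForces s a b c e := by
  have hv := hw.fourDistinct
  have hac := ne_of_var_ne hv.ac
  have u := fun x => forcesUnit_base hs hw x
  have p := fun x y => forcesPair_base hs hw x y
  have hX := new_singleton hs hds hxd hx
  have hXd : ∀ y ∈ [x], y ∈ d := by simpa using hxd
  have u1 := forcesUnit_new hs hw hds hX (a := a) (by simp) had hXd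
  have p13 := forcesPair_new hs hw hds hX (a := a) (b := c) (by simp) (by simp) hac had hcd hXd
  by_cases hee : e ∈ d
  · exact ⟨_, _, _, _, _, _, _, _, u1, u _, p _ _, p _ _, p _ _, p _ _, p13,
      forcesPair_new hs hw hds hX (by simp) (by simp) (ne_of_var_ne hv.ae) had hee hXd,
      by norm_num [zeta]⟩
  have hp : d.Perm (a :: c :: (d.erase a).erase c) :=
    (List.perm_cons_erase had).trans
      ((List.perm_cons_erase ((List.mem_erase_of_ne hac.symm).2 hcd)).cons a)
  generalize (d.erase a).erase c = q at hp
  have hn := ((hp.map Literal.var).nodup_iff).1 hd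
  have hq : ∀ y ∈ q, y.var ∉ [a, b, c, e].map Literal.var := by
    intro y hy hyw
    have hyd : y ∈ d := hp.mem_iff.2 (by simp [hy])
    have hyq : y.var ∈ q.map Literal.var := List.mem_map_of_mem hy
    simp only [List.map_cons, List.nodup_cons, List.mem_cons, not_or] at hn
    simp only [List.map_cons, List.map_nil, List.mem_cons, List.not_mem_nil, or_false] at hyw
    rcases hyw with h | h | h | h
    · exact hn.1.2 (h ▸ hyq)
    · exact hbd (h ▸ List.mem_map_of_mem hyd)
    · exact hn.2.1 (h ▸ hyq)
    · rcases Literal.eq_or_eq_neg h with rfl | rfl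
      · exact hee hyd
      · exact hed hyd
  have hlen' := hp.length_eq
  have hxq : x ∈ q := by
    have := hp.mem_iff.1 hxd
    simp only [List.mem_cons] at this
    rcases this with rfl | rfl | h
    · exact absurd (by simp) hx
    · exact absurd (by simp) hx
    · exact h
  match q, hp, hn, hq, hlen', hxq with
  | [y], hp, hn, hq, _, _ =>
    have hyd : y ∈ d := hp.mem_iff.2 (by simp)
    exact ⟨_, _, _, _, _, _, _, _, u1, u _, p _ _, p _ _,
      forcesPair_last hs hw hds hd (new_singleton hs hds hyd (hq y (by simp))) (b := a) (c := c)
        (by simp) (by simp) (ne_of_var_ne hv.ab) (ne_of_var_ne hv.ae) (ne_of_var_ne hv.bc).symm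
        (ne_of_var_ne hv.ce) hp, p _ _, p13, p _ _, by norm_num [zeta]⟩
  | [y, t], hp, hn, hq, _, _ =>
    have hyd : ∀ z ∈ [y, t], z ∈ d := fun z hz => hp.mem_iff.2 (by simp at hz; simp [hz])
    have hY := new_of_mem (w := [a, b, c, e]) (xs := [y, t]) hs hds
      (List.nodup_cons.1 (List.nodup_cons.1 hn).2).2 hyd hq
    exact ⟨_, _, _, _, _, _, _, _, forcesUnit_new hs hw hds hY (by simp) had hyd, u _, p _ _,
      p _ _, p _ _, p _ _, forcesPair_new hs hw hds hY (by simp) (by simp) hac had hcd hyd,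
      p _ _, by norm_num [zeta]⟩
  | _ :: _ :: _ :: _, _, _, _, hlen', _ =>
    simp only [List.length_cons] at hlen'
    omega

/-- Another clause with the variable of the first literal. -/
theorem four_of_first (h3 : 3 ≤ d.length) (hlen : d.length ≤ 4) (had : ∃ x ∈ d, x.var = a.var)
    (hne : ¬ ∀ l, l ∈ d ↔ l ∈ [a, b, c, e]) : FourForces s a b c e ∨
      ∃ x y t, d.Perm [a, x, y, t] ∧ New s [a, b, c, e] [x, y, t] := by
  have hv := hw.fourDistinct
  have hab := ne_of_var_ne hv.ab
  have hac := ne_of_var_ne hv.ac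
  have hae := ne_of_var_ne hv.ae
  have u := fun x => forcesUnit_base hs hw x
  have p := fun x y => forcesPair_base hs hw x y
  by_cases hsub : ∀ x ∈ d, x.var ∈ [a, b, c, e].map Literal.var
  · exact Or.inl (four_of_subset hs hw hds hd hsub hne)
  push Not at hsub
  obtain ⟨x, hxd, hx⟩ := hsub
  have hX := new_singleton hs hds hxd hx
  have hXd : ∀ y ∈ [x], y ∈ d := by simpa using hxd
  obtain ⟨y, hy, hya⟩ := had
  -- If `d` contains the negation of `a`, then the new literal is false in each of the four branches
  -- considered with `a` false.
  rcases (Literal.eq_or_eq_neg hya).symm with rfl | hya'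
  · exact Or.inl ⟨_, _, _, _, _, _, _, _, u _,
      forcesUnit_neg hs hw hds hX (c := a) (by simp) hab hy hXd,
      forcesPair_neg hs hw hds hX (c := a) (by simp) hac hae hy hXd,
      forcesPair_neg hs hw hds hX (c := a) (by simp) hab hac hy hXd,
      forcesPair_neg hs hw hds hX (c := a) (by simp) hab hae hy hXd, p _ _, p _ _, p _ _,
      by norm_num [zeta]⟩
  rw [hya'] at hy
  by_cases hneg : ∃ m ∈ [b, c, e], m.neg ∈ d
  · obtain ⟨m, hm, hmd⟩ := hneg
    have hm' : m ∈ [a, b, c, e] := List.mem_cons_of_mem _ hm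
    have hma : m.var ≠ a.var := by
      simp only [List.mem_cons, List.not_mem_nil, or_false] at hm
      rcases hm with rfl | rfl | rfl
      · exact hv.ab.symm
      · exact hv.ac.symm
      · exact hv.ae.symm
    -- The branch with `a` true is contradictory, hence counts as eliminating any number of
    -- variables; 20 makes its term small enough for all the sums.
    have u1 := forcesUnit_conflict hds hm' (ne_of_var_ne hma) hy hmd
      (ne_of_var_ne (by simpa using hma)) 20
    have p1 := forcesPair_conflict hs hw hds hy hmd (ne_of_var_ne (by simpa using hma.symm))
    simp only [List.mem_cons, List.not_mem_nil, or_false] at hm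
    rcases hm with rfl | rfl | rfl
    · exact Or.inl ⟨_, _, _, _, _, _, _, _, u1, u _, p _ _, p _ _, p _ _, p1, p _ _, p _ _,
        by norm_num [zeta]⟩
    · exact Or.inl ⟨_, _, _, _, _, _, _, _, u1, u _, p _ _, p _ _, p _ _, p _ _, p1, p _ _,
        by norm_num [zeta]⟩
    · exact Or.inl ⟨_, _, _, _, _, _, _, _, u1, u _, p _ _, p _ _, p _ _, p _ _, p _ _, p1,
        by norm_num [zeta]⟩
  have hbn : b.neg ∉ d := fun h => hneg ⟨b, by simp, h⟩
  have hcn : c.neg ∉ d := fun h => hneg ⟨c, by simp, h⟩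
  have hen : e.neg ∉ d := fun h => hneg ⟨e, by simp, h⟩
  by_cases hbd : b ∈ d
  · exact Or.inl ⟨_, _, _, _, _, _, _, _, forcesUnit_new hs hw hds hX (by simp) hy hXd,
      forcesUnit_new hs hw hds hX (by simp) hbd hXd, p _ _, p _ _, p _ _,
      forcesPair_new hs hw hds hX (by simp) (by simp) hab hy hbd hXd, p _ _, p _ _,
      by norm_num [zeta]⟩
  have hbd' : b.var ∉ d.map Literal.var := by
    intro h
    obtain ⟨z, hz, hzb⟩ := List.mem_map.1 h
    rcases Literal.eq_or_eq_neg hzb with rfl | rfl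
    · exact hbd hz
    · exact hbn hz
  by_cases hcd : c ∈ d
  · exact Or.inl (four_of_shared hs hw hds hd hlen hy hcd hbd' hen hxd hx)
  by_cases hed : e ∈ d
  · refine Or.inl (four_of_shared hs hw.swap hds hd hlen hy hed hbd' hcn hxd fun h => hx ?_).swap
    exact ((perm_swap_last a b c e).map Literal.var).mem_iff.1 h
  have hp : d.Perm (a :: d.erase a) := List.perm_cons_erase hy
  generalize d.erase a = q at hp
  have hn := ((hp.map Literal.var).nodup_iff).1 hd
  have hq : ∀ y ∈ q, y.var ∉ [a, b, c, e].map Literal.var := by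
    intro y hy hyw
    have hyd : y ∈ d := hp.mem_iff.2 (by simp [hy])
    simp only [List.map_cons, List.nodup_cons] at hn
    simp only [List.map_cons, List.map_nil, List.mem_cons, List.not_mem_nil, or_false] at hyw
    rcases hyw with h | h | h | h
    · exact hn.1 (h ▸ List.mem_map_of_mem hy)
    · exact hbd' (h ▸ List.mem_map_of_mem hyd)
    · rcases Literal.eq_or_eq_neg h with rfl | rfl
      · exact hcd hyd
      · exact hcn hyd
    · rcases Literal.eq_or_eq_neg h with rfl | rfl
      · exact hed hyd
      · exact hen hyd
  have hlen' := hp.length_eq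
  have hqd : ∀ y ∈ q, y ∈ d := fun y hy => hp.mem_iff.2 (by simp [hy])
  have hQ : New s [a, b, c, e] q := new_of_mem hs hds (List.nodup_cons.1 hn).2 hqd hq
  -- Now `a` is the only literal that `d` shares with `w`. With two new literals, these are linked
  -- as soon as `a` is false; with three, there is only the gain in the branch with `a` true, and
  -- the decision is postponed.
  match q, hp, hQ, hlen' with
  | [y, t], hp, hQ, _ =>
    exact Or.inl ⟨_, _, _, _, _, _, _, _, u _,
      forcesUnit_link hs hw hds hd hQ (c := a) (by simp) hab hp,
      forcesPair_link hs hw hds hd hQ (c := a) (by simp) hac hae hp,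
      forcesPair_link hs hw hds hd hQ (c := a) (by simp) hab hac hp,
      forcesPair_link hs hw hds hd hQ (c := a) (by simp) hab hae hp, p _ _, p _ _, p _ _,
      by norm_num [zeta]⟩
  | [y, t, r], hp, hQ, _ => exact Or.inr ⟨y, t, r, hp, hQ⟩
  | [], _, _, hlen' => simp only [List.length_cons, List.length_nil] at hlen'; omega
  | [_], _, _, hlen' => simp only [List.length_cons, List.length_nil] at hlen'; omega
  | _ :: _ :: _ :: _ :: _, _, _, hlen' => simp only [List.length_cons] at hlen'; omega

/-- Another clause with the variable of the second literal, but without that of the first one. -/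
theorem four_of_second (h3 : 3 ≤ d.length) (hlen : d.length ≤ 4) (hbd : ∃ x ∈ d, x.var = b.var)
    (had : a.var ∉ d.map Literal.var) (hne : ¬ ∀ l, l ∈ d ↔ l ∈ [a, b, c, e])
    (u1 : ForcesUnit s [a, b, c, e] a 7) : FourForces s a b c e := by
  have hv := hw.fourDistinct
  have hbc := ne_of_var_ne hv.bc
  have hbe := ne_of_var_ne hv.be
  have u := fun x => forcesUnit_base hs hw x
  have p := fun x y => forcesPair_base hs hw x y
  by_cases hsub : ∀ x ∈ d, x.var ∈ [a, b, c, e].map Literal.var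
  · exact four_of_subset hs hw hds hd hsub hne
  push Not at hsub
  obtain ⟨x, hxd, hx⟩ := hsub
  have hX := new_singleton hs hds hxd hx
  have hXd : ∀ y ∈ [x], y ∈ d := by simpa using hxd
  obtain ⟨y, hy, hyb⟩ := hbd
  rcases (Literal.eq_or_eq_neg hyb).symm with rfl | hyb'
  -- The negation of `b` is true in the branch for the pair of `c` and `e`, so both `x` and a third
  -- literal `t` of `d` are false there.
  · obtain ⟨t, ht, htb, htx⟩ := exists_ne_ne hd h3 b.neg x
    have p34 : ForcesPair s [a, b, c, e] c e 5 := by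
      -- If the variable of `t` belongs to `w`, it is that of `c` or `e`, and both of these become
      -- constant: four variables and `x` are eliminated. If it is new, then `x` and `t` add two to
      -- the three variables of `w`. The total is 5 either way.
      by_cases htw : t.var ∈ [a, b, c, e].map Literal.var
      · refine forcesPair_of hs hw hX [] _ (by simp) fun φ L' h hce hF z hz => ?_
        have hT : lv φ b.neg = Val.T := by rw [lv_neg, hF b (by simp) hbc hbe]; rfl
        have ht' : (lv φ t).base = none := by rw [h.of_true hds hy ht htb hT]; rfl
        have hc : (lv φ c).base = none := by
          simp only [List.map_cons, List.map_nil, List.mem_cons, List.not_mem_nil, or_false] at htw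
          rw [lv_base] at ht'
          rcases htw with h | h | h | h
          · exact absurd (h ▸ List.mem_map_of_mem ht) had
          · exact absurd (eq_of_var_eq hd ht hy h) htb
          · rwa [lv_base, ← h]
          · rwa [hce, Val.neg_base, lv_base, ← h]
        simp only [List.mem_cons, List.not_mem_nil, or_false] at hz
        rcases hz with rfl | rfl
        · exact Or.inl hc
        · exact dependsOn_of_eq_F (h.of_true hds hy hxd
            (fun h => hx (by rw [h]; simp)) hT)
      · have hXT : New s [a, b, c, e] [x, t] := by
          refine new_of_mem hs hds ?_ (by simp [hxd, ht]) (fun z hz => ?_)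
          · simpa [ClauseNodup] using fun h => htx (eq_of_var_eq hd ht hxd h.symm)
          · simp only [List.mem_cons, List.not_mem_nil, or_false] at hz
            rcases hz with rfl | rfl
            · exact hx
            · exact htw
        exact forcesPair_neg hs hw hds hXT (c := b) (by simp) hbc hbe hy (by simp [hxd, ht])
    exact ⟨_, _, _, _, _, _, _, _, u1, u _, p34, p _ _, p _ _, p _ _, p _ _, p _ _,
      by norm_num [zeta]⟩
  rw [hyb'] at hy
  by_cases hneg : ∃ m ∈ [c, e], m.neg ∈ d
  · obtain ⟨m, hm, hmd⟩ := hneg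
    have hmb : m.var ≠ b.var := by
      simp only [List.mem_cons, List.not_mem_nil, or_false] at hm
      rcases hm with rfl | rfl
      · exact hv.bc.symm
      · exact hv.be.symm
    exact ⟨_, _, _, _, _, _, _, _, u1,
      forcesUnit_conflict hds (List.mem_cons_of_mem _ (List.mem_cons_of_mem _ hm))
        (ne_of_var_ne hmb) hy hmd (ne_of_var_ne (by simpa using hmb)) 20,
      p _ _, p _ _, p _ _, p _ _, p _ _, p _ _, by norm_num [zeta]⟩
  have hcn : c.neg ∉ d := fun h => hneg ⟨c, by simp, h⟩
  have hen : e.neg ∉ d := fun h => hneg ⟨e, by simp, h⟩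
  by_cases hcd : c ∈ d
  · exact ⟨_, _, _, _, _, _, _, _, u1, forcesUnit_new hs hw hds hX (by simp) hy hXd, p _ _,
      forcesPair_new hs hw hds hX (by simp) (by simp) hbc hy hcd hXd, p _ _, p _ _, p _ _, p _ _,
      by norm_num [zeta]⟩
  by_cases hed : e ∈ d
  · exact ⟨_, _, _, _, _, _, _, _, u1, forcesUnit_new hs hw hds hX (by simp) hy hXd, p _ _,
      p _ _, forcesPair_new hs hw hds hX (by simp) (by simp) hbe hy hed hXd, p _ _, p _ _, p _ _,
      by norm_num [zeta]⟩
  have hp : d.Perm (b :: d.erase b) := List.perm_cons_erase hy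
  generalize d.erase b = q at hp
  have hn := ((hp.map Literal.var).nodup_iff).1 hd
  have hq : ∀ y ∈ q, y.var ∉ [a, b, c, e].map Literal.var := by
    intro y hy hyw
    have hyd : y ∈ d := hp.mem_iff.2 (by simp [hy])
    simp only [List.map_cons, List.nodup_cons] at hn
    simp only [List.map_cons, List.map_nil, List.mem_cons, List.not_mem_nil, or_false] at hyw
    rcases hyw with h | h | h | h
    · exact had (h ▸ List.mem_map_of_mem hyd)
    · exact hn.1 (h ▸ List.mem_map_of_mem hy)
    · rcases Literal.eq_or_eq_neg h with rfl | rfl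
      · exact hcd hyd
      · exact hcn hyd
    · rcases Literal.eq_or_eq_neg h with rfl | rfl
      · exact hed hyd
      · exact hen hyd
  have hlen' := hp.length_eq
  have hqd : ∀ y ∈ q, y ∈ d := fun y hy => hp.mem_iff.2 (by simp [hy])
  have hQ : New s [a, b, c, e] q := new_of_mem hs hds (List.nodup_cons.1 hn).2 hqd hq
  have u2 := forcesUnit_new hs hw hds hQ (a := b) (by simp) hy hqd
  match q, hp, hQ, hlen', u2 with
  | [y, t], hp, hQ, _, u2 =>
    exact ⟨_, _, _, _, _, _, _, _, u1, u2,
      forcesPair_link hs hw hds hd hQ (c := b) (by simp) hbc hbe hp, p _ _, p _ _, p _ _, p _ _,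
      p _ _, by norm_num [zeta]⟩
  | [y, t, r], _, _, _, u2 =>
    -- This is the critical case, with sum 2ζ⁷ + 6ζ³; it is less than 1 by under 10⁻⁴ and dictates
    -- the choice of ζ.
    exact ⟨_, _, _, _, _, _, _, _, u1, u2, p _ _, p _ _, p _ _, p _ _, p _ _, p _ _,
      by norm_num [zeta]⟩
  | [], _, _, hlen', _ => simp only [List.length_cons, List.length_nil] at hlen'; omega
  | [_], _, _, hlen', _ => simp only [List.length_cons, List.length_nil] at hlen'; omega
  | _ :: _ :: _ :: _ :: _, _, _, hlen', _ => simp only [List.length_cons] at hlen'; omega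

end

/-- A clause other than `w` that contains the variable of `a`. -/
def Other (s : State) (w : Clause) (a : Literal) : Prop :=
  ∃ d ∈ s.clauses, (∃ x ∈ d, x.var = a.var) ∧ ¬ ∀ l, l ∈ d ↔ l ∈ w

/-- If the clause through `a` does not settle the matter, it has three new variables and the branch
with `a` true eliminates seven. The clause through `b` may also contain the variable of `a`; then it
shares two variables with `w`, and the postponed case cannot arise again. -/
theorem four_forces {s : State} {a b c e : Literal} (hs : Inv s) (hw : Local s [a, b, c, e])
    (hirr : Irreducible s.clauses) (hlen : ∀ d ∈ s.clauses, d.length ≤ 4)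
    (ha : Other s [a, b, c, e] a) (hb : Other s [a, b, c, e] b) : FourForces s a b c e := by
  obtain ⟨d, hds, had, hne⟩ := ha
  rcases four_of_first hs hw hds (hirr d hds).2 (hirr d hds).1 (hlen d hds) had hne with
    h | ⟨x, y, t, hp, hX⟩
  · exact h
  have u1 := forcesUnit_new hs hw hds hX (a := a) (by simp) (hp.mem_iff.2 (by simp))
    (fun z hz => hp.mem_iff.2 (List.mem_cons_of_mem _ hz))
  obtain ⟨d', hds', hbd, hne'⟩ := hb
  by_cases had' : a.var ∈ d'.map Literal.var
  · rcases four_of_first hs hw hds' (hirr d' hds').2 (hirr d' hds').1 (hlen d' hds')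
      (List.mem_map.1 had') hne' with h | ⟨x, y, t, hp, hX⟩
    · exact h
    · obtain ⟨z, hz, hzb⟩ := hbd
      have := hp.mem_iff.1 hz
      rcases List.mem_cons.1 this with rfl | h
      · exact absurd hzb hw.fourDistinct.ab
      · exact absurd (by rw [hzb]; simp) (hX.new z h)
  · exact four_of_second hs hw hds' (hirr d' hds').2 (hirr d' hds').1 (hlen d' hds') hbd had' hne' u1

/-! ## The weight of an instance -/

/-- The weight of an instance: zero if the simplifications lead to a contradiction, and otherwise
the exponential bound for the number of variables that remain. -/
noncomputable def wt (t : State) : ℝ :=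
  if [] ∈ (simplify t).val.clauses then 0 else zeta⁻¹ ^ (simplify t).val.live.length

theorem one_le_inv_zeta : 1 ≤ zeta⁻¹ := (one_le_inv₀ zeta_pos).2 zeta_lt_one.le

/-- A contradictory branch has weight 0, so eliminated variables have to be counted only for
branches that survive simplification. -/
theorem wt_le {t : State} {n r : ℕ}
    (h : [] ∉ (simplify t).val.clauses → (simplify t).val.live.length + r ≤ n) :
    wt t ≤ zeta ^ r * zeta⁻¹ ^ n := by
  have hz := zeta_pos
  unfold wt
  split_ifs with h1
  · positivity
  · obtain ⟨m, rfl⟩ := Nat.exists_eq_add_of_le (h h1)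
    rw [show zeta ^ r * zeta⁻¹ ^ ((simplify t).val.live.length + r + m) =
      (zeta * zeta⁻¹) ^ r * zeta⁻¹ ^ (simplify t).val.live.length * zeta⁻¹ ^ m by ring,
      mul_inv_cancel₀ hz.ne', one_pow, one_mul]
    exact le_mul_of_one_le_right (by positivity) (one_le_pow₀ one_le_inv_zeta)

theorem wt_le_pow {t : State} (ht : Inv t) {n r : ℕ} (h : t.live.length + r ≤ n) :
    wt t ≤ zeta ^ r * zeta⁻¹ ^ n :=
  wt_le fun _ => (Nat.add_le_add_right (simplify_spec ht).1.live_le r).trans h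

theorem bindVal_T (ψ : ℕ → Val) : bindVal ψ Val.T = Val.T := rfl

theorem bindVal_F (ψ : ℕ → Val) : bindVal ψ Val.F = Val.F := rfl

theorem bindVal_lit (ψ : ℕ → Val) (l : Literal) : bindVal ψ ⟨some l.var, l.pos⟩ = lv ψ l := by
  unfold bindVal lv
  rfl

theorem lv_assignSub_of_neg (l : Literal) : lv (assignSub l.neg) l = Val.F := by
  have h := lv_assignSub l.neg
  rw [lv_neg] at h
  rw [← Val.neg_neg (lv _ l), h, Val.neg_T]

theorem lv_linkSub_neg {l m : Literal} (hlm : l.var ≠ m.var) :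
    lv (linkSub l m.neg) l = (lv (linkSub l m.neg) m).neg := by
  rw [lv_linkSub_self, lv_single_of_ne hlm.symm]
  rfl

/-! ### Weights of the branches. -/

section

variable {s t : State} {w : Clause} {φ : ℕ → Val} (hc : ∃ c ∈ s.clauses, c.Perm w)
  (hφ : Subst φ s.clauses (vars s.live) t.clauses (vars t.live)) (ht : Inv t)

include hc hφ ht

/-- The branching clause itself is among those resolved, so the true literal `a` makes its other
literals false; this is the hypothesis that `ForcesUnit` asks for. -/
theorem wt_le_unit {a : Literal} {r : ℕ} (ha : a ∈ w) (hT : lv φ a = Val.T)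
    (hf : ForcesUnit s w a r) : wt t ≤ zeta ^ r * zeta⁻¹ ^ s.live.length := by
  obtain ⟨c, hcs, hcw⟩ := hc
  refine wt_le fun hne => ?_
  obtain ⟨ψ, hψ⟩ := hφ.exists_resolves ht hne
  have hT' : lv (compSub ψ φ) a = Val.T := by rw [lv_compSub, hT, bindVal_T]
  have h := hf _ _ hψ ((simplify_spec ht).1.inv ht).nodup hT' fun x hx hxa =>
    hψ.of_true hcs (hcw.mem_iff.2 ha) (hcw.mem_iff.2 hx) hxa hT'
  simpa using h

theorem wt_le_pair {a b : Literal} {r : ℕ} (ha : a ∈ w) (hb : b ∈ w) (hab : a ≠ b)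
    (hv : lv φ a = (lv φ b).neg) (hf : ForcesPair s w a b r) :
    wt t ≤ zeta ^ r * zeta⁻¹ ^ s.live.length := by
  obtain ⟨c, hcs, hcw⟩ := hc
  refine wt_le fun hne => ?_
  obtain ⟨ψ, hψ⟩ := hφ.exists_resolves ht hne
  have hv' : lv (compSub ψ φ) a = (lv (compSub ψ φ) b).neg := by
    rw [lv_compSub, lv_compSub, hv, bindVal_neg]
  have h := hf _ _ hψ ((simplify_spec ht).1.inv ht).nodup hv' fun x hx hxa hxb =>
    hψ.of_neg hcs (hcw.mem_iff.2 ha) (hcw.mem_iff.2 hb) hab hv' (hcw.mem_iff.2 hx) hxa hxb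
  simpa using h

/-- Setting all literals but two to false is a pair branch in disguise: the clause makes the
remaining two complementary. -/
theorem wt_le_pair_of_false (hw : w.Nodup) {a b : Literal} {r : ℕ} (ha : a ∈ w) (hb : b ∈ w)
    (hab : a ≠ b) (hF : ∀ x ∈ w, x ≠ a → x ≠ b → lv φ x = Val.F) (hf : ForcesPair s w a b r) :
    wt t ≤ zeta ^ r * zeta⁻¹ ^ s.live.length := by
  obtain ⟨c, hcs, hcw⟩ := hc
  refine wt_le fun hne => ?_
  obtain ⟨ψ, hψ⟩ := hφ.exists_resolves ht hne
  have hF' : ∀ x ∈ w, x ≠ a → x ≠ b → lv (compSub ψ φ) x = Val.F := fun x hx hxa hxb => by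
    rw [lv_compSub, hF x hx hxa hxb, bindVal_F]
  have h := hf _ _ hψ ((simplify_spec ht).1.inv ht).nodup
    (hψ.of_false₂ hcs (hcw.nodup_iff.2 hw) (hcw.mem_iff.2 ha) (hcw.mem_iff.2 hb) hab
      fun x hx => hF' x (hcw.mem_iff.1 hx)) hF'
  simpa using h

end

section

variable {s : State} (hs : Inv s)

include hs

theorem subst_assign_state {l : Literal} (hl : l.var ∈ vars s.live) :
    Subst (assignSub l) s.clauses (vars s.live) (assign l s).val.clauses
      (vars (assign l s).val.live) := by
  rw [assign_val]
  exact subst_assign fun u hu => (mem_vars_dropVar hs.nodup hl).1 hu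

theorem subst_linkDiffer {l m : Literal} (hl : l.var ∈ vars s.live)
    (hm : m.var ∈ vars s.live) (hlm : l.var ≠ m.var) :
    Subst (linkSub l m.neg) s.clauses (vars s.live) (linkDiffer l m s).val.clauses
      (vars (linkDiffer l m s).val.live) := by
  have h := subst_link (l := l) (m := m.neg) (F := s.clauses) (L := vars s.live)
    (L' := vars (linkDiffer l m s).val.live) fun u hu =>
      (mem_vars_dropVar hs.nodup hl).1 ((linkDiffer_vars hs hl hm hlm).mem_iff.1 hu)
  rw [linkDiffer_val, link_val] at h ⊢
  exact h

variable {w : Clause} (hc : ∃ c ∈ s.clauses, c.Perm w) (hw : Local s w)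

include hc hw

theorem wt_assign_le {a : Literal} {r : ℕ} (ha : a ∈ w) (hf : ForcesUnit s w a r) :
    wt (assign a s).val ≤ zeta ^ r * zeta⁻¹ ^ s.live.length :=
  wt_le_unit hc (subst_assign_state hs (hw.mem a ha)) (hs.assign (hw.mem a ha)) ha (lv_assignSub a) hf

theorem wt_linkDiffer_le {a b : Literal} {r : ℕ} (ha : a ∈ w) (hb : b ∈ w) (hab : a ≠ b)
    (hf : ForcesPair s w a b r) :
    wt (linkDiffer a b s).val ≤ zeta ^ r * zeta⁻¹ ^ s.live.length := by
  have hv : a.var ≠ b.var := fun h => hab (eq_of_var_eq hw.nodup ha hb h)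
  exact wt_le_pair hc (subst_linkDiffer hs (hw.mem a ha) (hw.mem b hb) hv)
    (hs.linkDiffer (hw.mem a ha) (hw.mem b hb) hv) ha hb hab (lv_linkSub_neg hv) hf

end

/-- If `a` is false, then only `b` and `c` are left in the clause, so this branch is estimated as
the pair of `b` and `c`. -/
theorem branch_three {s : State} {a b c : Literal} (hs : Inv s)
    (hc : ∃ d ∈ s.clauses, d.Perm [a, b, c]) (hirr : Irreducible s.clauses)
    (hw : Local s [a, b, c]) (ha : Other s [a, b, c] a) :
    wt (assign a s).val + wt (assign a.neg s).val +
      (wt (linkDiffer a b s).val + wt (linkDiffer a c s).val) ≤ zeta⁻¹ ^ s.live.length := by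
  obtain ⟨d, hds, had, hne⟩ := ha
  obtain ⟨r₁, r₂, r₃, r₄, h1, h2, h3, h4, hz⟩ := three_forces hs hw hds (hirr d hds).2 had hne
  have hab : a ≠ b := fun e => absurd hw.nodup (by simp [e, ClauseNodup])
  have hac : a ≠ c := fun e => absurd hw.nodup (by simp [e, ClauseNodup])
  have hbc : b ≠ c := fun e => absurd hw.nodup (by simp [e, ClauseNodup])
  have haL : a.neg.var ∈ vars s.live := hw.mem a (by simp)
  have w1 := wt_assign_le hs hc hw (by simp) h1
  have w2 := wt_le_pair_of_false hc (subst_assign_state hs haL) (hs.assign haL)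
    (hw.nodup.of_map _) (by simp) (by simp) hbc (fun x hx hxb hxc => by
      have : x = a := by simpa [hxb, hxc] using hx
      rw [this, lv_assignSub_of_neg]) h2
  have w3 := wt_linkDiffer_le hs hc hw (by simp) (by simp) hab h3
  have w4 := wt_linkDiffer_le hs hc hw (by simp) (by simp) hac h4
  have h0 : 0 ≤ zeta⁻¹ ^ s.live.length := pow_nonneg (zero_le_one.trans one_le_inv_zeta) _
  have := mul_le_mul_of_nonneg_right hz h0
  linarith

theorem branch_four {s : State} {a b c e : Literal} (hs : Inv s)
    (hc : ∃ d ∈ s.clauses, d.Perm [a, b, c, e]) (hirr : Irreducible s.clauses)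
    (hlen : ∀ d ∈ s.clauses, d.length ≤ 4) (hw : Local s [a, b, c, e])
    (ha : Other s [a, b, c, e] a) (hb : Other s [a, b, c, e] b) :
    wt (assign a s).val + (wt (assign b (assign a.neg s).val).val +
      wt (assign b.neg (assign a.neg s).val).val +
      (wt (linkDiffer b c (assign a.neg s).val).val +
        wt (linkDiffer b e (assign a.neg s).val).val)) +
      (wt (linkDiffer a b s).val + wt (linkDiffer a c s).val + wt (linkDiffer a e s).val) ≤
      zeta⁻¹ ^ s.live.length := by
  obtain ⟨r₁, r₂, r₃, r₄, r₅, r₆, r₇, r₈, h1, h2, h3, h4, h5, h6, h7, h8, hz⟩ :=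
    four_forces hs hw hirr hlen ha hb
  have hv := hw.fourDistinct
  have hL := hw.mem
  simp only [List.mem_cons, List.not_mem_nil, or_false, forall_eq_or_imp, forall_eq] at hL
  obtain ⟨haL, hbL, hcL, heL⟩ := hL
  have haL' : a.neg.var ∈ vars s.live := haL
  have hs₀ := hs.assign haL'
  have hφ := subst_assign_state hs haL'
  have hmem : ∀ x : Literal, x.var ≠ a.var → x.var ∈ vars s.live →
      x.var ∈ vars (assign a.neg s).val.live := fun x hx hxl => by
    rw [assign_val]
    exact (mem_vars_dropVar hs.nodup haL').2 ⟨hxl, hx⟩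
  have hb₀ := hmem b hv.ab.symm hbL
  have hc₀ := hmem c hv.ac.symm hcL
  have he₀ := hmem e hv.ae.symm heL
  -- Making `a` false first does not affect the other variables, so under the composite substitution
  -- the literals `b`, `c` and `e` have the values given by the second step.
  have hlv : ∀ (ψ : ℕ → Val) (x : Literal), x.var ≠ a.var →
      lv (compSub ψ (assignSub a.neg)) x = lv ψ x := fun ψ x hx => by
    rw [lv_compSub, lv_single_of_ne (v := a.neg.var) hx, bindVal_lit]
  have w1 := wt_assign_le hs hc hw (by simp) h1
  have w2 := wt_le_unit hc (hφ.comp (subst_assign_state hs₀ hb₀)) (hs₀.assign hb₀) (by simp)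
    (by rw [hlv _ _ hv.ab.symm, lv_assignSub]) h2
  have w3 := wt_le_pair_of_false hc (hφ.comp (subst_assign_state hs₀ (l := b.neg) hb₀))
    (hs₀.assign hb₀) (hw.nodup.of_map _) (by simp) (by simp) (ne_of_var_ne hv.ce)
    (fun x hx hxc hxe => by
      have : x = a ∨ x = b := by simpa [hxc, hxe] using hx
      rcases this with rfl | rfl
      · rw [lv_compSub, lv_assignSub_of_neg, bindVal_F]
      · rw [hlv _ _ hv.ab.symm, lv_assignSub_of_neg]) h3
  have w4 := wt_le_pair hc (hφ.comp (subst_linkDiffer hs₀ hb₀ hc₀ hv.bc))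
    (hs₀.linkDiffer hb₀ hc₀ hv.bc) (by simp) (by simp) (ne_of_var_ne hv.bc)
    (by rw [hlv _ _ hv.ab.symm, hlv _ _ hv.ac.symm, lv_linkSub_neg hv.bc]) h4
  have w5 := wt_le_pair hc (hφ.comp (subst_linkDiffer hs₀ hb₀ he₀ hv.be))
    (hs₀.linkDiffer hb₀ he₀ hv.be) (by simp) (by simp) (ne_of_var_ne hv.be)
    (by rw [hlv _ _ hv.ab.symm, hlv _ _ hv.ae.symm, lv_linkSub_neg hv.be]) h5
  have w6 := wt_linkDiffer_le hs hc hw (by simp) (by simp) (ne_of_var_ne hv.ab) h6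
  have w7 := wt_linkDiffer_le hs hc hw (by simp) (by simp) (ne_of_var_ne hv.ac) h7
  have w8 := wt_linkDiffer_le hs hc hw (by simp) (by simp) (ne_of_var_ne hv.ae) h8
  have h0 : 0 ≤ zeta⁻¹ ^ s.live.length := pow_nonneg (zero_le_one.trans one_le_inv_zeta) _
  have := mul_le_mul_of_nonneg_right hz h0
  linarith

/-- Here `k + 1` is the length of the clause. Beyond the base case the sum decreases, since (k + 1)ζ
≤ k for k ≥ 4. -/
theorem zeta_sum_le {k : ℕ} (hk : 4 ≤ k) : zeta + zeta ^ (k + 1) + k * zeta ^ k ≤ 1 := by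
  induction k, hk using Nat.le_induction with
  | base => norm_num [zeta]
  | succ k hk ih =>
    have hz : zeta ≤ 0.55 := by norm_num [zeta]
    have hz0 := zeta_pos
    have hk' : (4 : ℝ) ≤ k := by exact_mod_cast hk
    have h1 : zeta ^ (k + 1 + 1) ≤ zeta ^ (k + 1) :=
      pow_le_pow_of_le_one hz0.le zeta_lt_one.le (by omega)
    have h2 : ((k : ℝ) + 1) * zeta ^ (k + 1) ≤ k * zeta ^ k := by
      rw [pow_succ', ← mul_assoc]
      refine mul_le_mul_of_nonneg_right ?_ (by positivity)
      nlinarith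
    push_cast
    linarith

theorem sum_map_le {α : Type} {f : α → ℝ} {B : ℝ} {xs : List α} (h : ∀ x ∈ xs, f x ≤ B) :
    (xs.map f).sum ≤ xs.length * B := by
  simpa using List.sum_le_card_nsmul (xs.map f) B (by simpa using h)

/-- For at least five literals no other clause is needed: the branches eliminate all variables of
the clause, one variable, and all but one variable of the clause, respectively. -/
theorem branch_many {s : State} {a : Literal} {rest : Clause} (hs : Inv s)
    (hc : ∃ d ∈ s.clauses, d.Perm (a :: rest)) (hw : Local s (a :: rest))
    (hk : 4 ≤ rest.length) :
    wt (assign a s).val + wt (assign a.neg s).val +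
      (rest.map fun m => wt (linkDiffer a m s).val).sum ≤ zeta⁻¹ ^ s.live.length := by
  have ha : a ∉ rest := (List.nodup_cons.1 (hw.nodup.of_map _)).1
  have haL : a.neg.var ∈ vars s.live := hw.mem a (by simp)
  have w1 := wt_assign_le hs hc hw (by simp) (forcesUnit_base hs hw a)
  have w2 := wt_le_pow (hs.assign haL) (n := s.live.length) (r := 1) (length_assign haL).le
  have w3 := sum_map_le (f := fun m => wt (linkDiffer a m s).val) (xs := rest) fun m hm =>
    wt_linkDiffer_le hs hc hw (by simp) (by simp [hm]) (fun h => ha (h ▸ hm))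
      (forcesPair_base hs hw a m)
  have h0 : 0 ≤ zeta⁻¹ ^ s.live.length := pow_nonneg (zero_le_one.trans one_le_inv_zeta) _
  have := mul_le_mul_of_nonneg_right (zeta_sum_le hk) h0
  simp only [List.length_cons, Nat.add_sub_cancel, pow_one] at w1 w2 w3
  linarith

/-! ## The resources of the recursive calls -/

/-- The run `r` uses at most `b` steps and `b` memory blocks of its own, while its calls take the
time `τ` and the memory `D`, which they release. -/
structure Track {α : Type} (r : Run α) (b D : ℕ) (τ : ℝ) : Prop where
  time : (r.time : ℝ) ≤ b + τ
  kept : r.kept ≤ b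
  peak : r.peak ≤ b + D

namespace Track

variable {α β : Type} {D : ℕ}

theorem mono {r : Run α} {b b' : ℕ} {τ τ' : ℝ} (h : Track r b D τ) (hb : b ≤ b') (hτ : τ ≤ τ') :
    Track r b' D τ' := by
  have hb' : (b : ℝ) ≤ b' := by exact_mod_cast hb
  exact ⟨h.time.trans (by linarith), h.kept.trans hb, h.peak.trans (by omega)⟩

/-- The times of the calls add up, but the memory `D` is shared: what a call has used is free again
when the next one starts. Polynomial space rests on this. -/
theorem bind {x : Run α} {f : α → Run β} {a b : ℕ} {σ τ : ℝ} (hx : Track x a D σ)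
    (hf : Track (f x.val) b D τ) : Track (x >>= f) (a + b) D (σ + τ) := by
  have h1 := hx.time
  have h2 := hf.time
  refine ⟨?_, Nat.add_le_add hx.kept hf.kept, max_le (hx.peak.trans (by omega)) ?_⟩
  · change ((x.time + (f x.val).time : ℕ) : ℝ) ≤ _
    push_cast
    linarith
  · have := hx.kept
    have := hf.peak
    omega

theorem _root_.MaxHammingXSAT.Cost.track {r : Run α} {b : ℕ} (h : Cost r b) : Track r b D 0 :=
  ⟨by rw [add_zero]; exact_mod_cast h.time, h.kept, h.peak.trans (by omega)⟩

theorem pure (a : α) : Track (Pure.pure a : Run α) 0 D 0 := (Cost.pure a 0).track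

theorem cost_bind {x : Run α} {f : α → Run β} {a b : ℕ} {τ : ℝ} (hx : Cost x a)
    (hf : Track (f x.val) b D τ) : Track (x >>= f) (a + b) D τ := by
  simpa using hx.track.bind hf

theorem bind_pure {x : Run α} {f : α → β} {b : ℕ} {τ : ℝ} (h : Track x b D τ) :
    Track (x >>= fun y => Pure.pure (f y)) b D τ := by
  simpa using Track.bind (f := fun y => Pure.pure (f y)) h (Track.pure (f x.val))

theorem tick_bind {f : Unit → Run β} {b : ℕ} {τ : ℝ} (hf : Track (f ()) b D τ) :
    Track (MaxHammingXSAT.tick >>= f) (1 + b) D τ := cost_bind Cost.tick hf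

theorem call {x : Run (WithBot ℕ)} {τ : ℝ} (hp : x.peak ≤ D) (ht : (x.time : ℝ) ≤ τ) :
    Track (MaxHammingXSAT.call x) 1 D τ := by
  refine ⟨?_, le_rfl, by change x.peak + 1 ≤ _; omega⟩
  change ((x.time + 1 : ℕ) : ℝ) ≤ _
  push_cast
  linarith

end Track

/-- The run solves the instance with memory `D` and in time `τ`. -/
structure Solves (r : Run (WithBot ℕ)) (t : State) (D : ℕ) (τ : ℝ) : Prop where
  value : IsValue t r.val
  peak : r.peak ≤ D
  time : (r.time : ℝ) ≤ τ

theorem Solves.track {r : Run (WithBot ℕ)} {t : State} {D : ℕ} {τ : ℝ} (h : Solves r t D τ) :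
    Track (call r) 1 D τ := .call h.peak h.time

/-- The recursive procedure `rec` solves all instances of size at most `n` with less than `L`
variables. -/
def SolvesBelow (rec : State → Run (WithBot ℕ)) (n L D : ℕ) (A W : ℝ) : Prop :=
  ∀ t, Inv t → t.size ≤ n → t.live.length < L → Solves (rec t) t D (A + W * wt t)

/-! ## Sums of answers -/

@[simp] theorem sumAnswers_val (rec : State → Run (WithBot ℕ)) (ts : List State) :
    (sumAnswers rec ts).val = (ts.map fun t => (rec t).val).sum := by
  induction ts with
  | nil => rfl
  | cons t ts ih => simp [sumAnswers, ih]

theorem sumAnswers_track {rec : State → Run (WithBot ℕ)} {D : ℕ} {τ : State → ℝ} {ts : List State}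
    (h : ∀ t ∈ ts, Solves (rec t) t D (τ t)) :
    Track (sumAnswers rec ts) (2 * ts.length + 1) D (ts.map τ).sum := by
  induction ts with
  | nil => exact (Cost.tick_pure _ le_rfl).track
  | cons t ts ih =>
    refine (Track.tick_bind ((h t (by simp)).track.bind
      (ih fun u hu => h u (by simp [hu])).bind_pure)).mono ?_ ?_
    · simp only [List.length_cons]; omega
    · simp

/-! ## Maxima of answers -/

section

variable {rec : State → Run (WithBot ℕ)} {n L D : ℕ} {A W : ℝ}
  (H : SolvesBelow rec n L D A W)

include H

variable {s : State} (hs : Inv s) (hn : s.size ≤ n) (hL : s.live.length ≤ L)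

include hs hn hL

theorem solves_assign {l : Literal} (hl : l.var ∈ vars s.live) :
    Solves (rec (assign l s).val) (assign l s).val D (A + W * wt (assign l s).val) :=
  H _ (hs.assign hl) ((size_assign l s).trans hn) (by have := length_assign hl; omega)

theorem solves_linkDiffer {l m : Literal} (hl : l.var ∈ vars s.live)
    (hm : m.var ∈ vars s.live) (hlm : l.var ≠ m.var) :
    Solves (rec (linkDiffer l m s).val) (linkDiffer l m s).val D
      (A + W * wt (linkDiffer l m s).val) :=
  H _ (hs.linkDiffer hl hm hlm) ((size_linkDiffer l m s).trans hn)
    (by have := length_linkDiffer (m := m) hl; omega)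

/-- A maximum lies below `b` exactly if all its members do, which matches the conjunction of upper
bounds in `branch_ub`. -/
theorem differAnswers_le_iff {a : Literal} {ms : Clause} (hl : Local s (a :: ms))
    (b : WithBot ℕ) :
    (differAnswers rec a s ms).val ≤ b ↔ ∀ m ∈ ms, UB (linkDiffer a m s).val b := by
  have hms : ∀ m ∈ ms, (rec (linkDiffer a m s).val).val ≤ b ↔ UB (linkDiffer a m s).val b :=
    fun m hm => ((solves_linkDiffer H hs hn hL (hl.mem a (by simp)) (hl.mem m (by simp [hm]))
      fun h => (List.nodup_cons.1 hl.nodup).1 (h ▸ List.mem_map_of_mem hm)).value b).symm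
  clear hl
  induction ms with
  | nil => simp [differAnswers]
  | cons m ms ih =>
    simp only [differAnswers, bind_val, pure_val, call_val, max_le_iff, List.forall_mem_cons]
    exact and_congr (hms m (by simp)) (ih fun u hu => hms u (by simp [hu]))

theorem differAnswers_track {a : Literal} {ms : Clause} (hl : Local s (a :: ms)) :
    Track (differAnswers rec a s ms) (((n + 10) ^ 3 + 2) * ms.length + 1) D
      (ms.length * A + W * (ms.map fun m => wt (linkDiffer a m s).val).sum) := by
  have hms : ∀ m ∈ ms, Solves (rec (linkDiffer a m s).val) (linkDiffer a m s).val D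
      (A + W * wt (linkDiffer a m s).val) := fun m hm =>
    solves_linkDiffer H hs hn hL (hl.mem a (by simp)) (hl.mem m (by simp [hm]))
      fun h => (List.nodup_cons.1 hl.nodup).1 (h ▸ List.mem_map_of_mem hm)
  clear hl
  induction ms with
  | nil =>
    refine Track.mono (τ := 0) (b := 1) (Cost.tick_pure _ le_rfl).track ?_ ?_ <;> simp
  | cons m ms ih =>
    refine (Track.tick_bind (.cost_bind (linkDiffer_cost a m (State.small hn)) ((hms m (by simp)).track.bind
      (ih fun u hu => hms u (by simp [hu])).bind_pure))).mono ?_ ?_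
    · simp only [List.length_cons]
      rw [mul_add]
      omega
    · simp only [List.map_cons, List.sum_cons, List.length_cons]
      push_cast
      linarith

end

/-- The weight of the calls in case that the first literal is false. -/
noncomputable def falseWt (a : Literal) (rest : Clause) (s : State) : ℝ :=
  match rest with
  | [b, c, e] => wt (assign b (assign a.neg s).val).val +
      wt (assign b.neg (assign a.neg s).val).val +
      ([c, e].map fun m => wt (linkDiffer b m (assign a.neg s).val).val).sum
  | _ => wt (assign a.neg s).val

theorem falseWt_of_ne {a : Literal} {rest : Clause} (s : State) (h : rest.length ≠ 3) :
    falseWt a rest s = wt (assign a.neg s).val := by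
  match rest, h with
  | [], _ => rfl
  | [_], _ => rfl
  | [_, _], _ => rfl
  | [_, _, _], h => exact absurd rfl h
  | _ :: _ :: _ :: _ :: _, _ => rfl

theorem falseAnswer_of_ne (rec : State → Run (WithBot ℕ)) (a : Literal) {rest : Clause} (s : State)
    (h : rest.length ≠ 3) :
    falseAnswer rec a rest s = (do tick; let s₀ ← assign a.neg s; call (rec s₀)) := by
  match rest, h with
  | [], _ => rfl
  | [_], _ => rfl
  | [_, _], _ => rfl
  | [_, _, _], h => exact absurd rfl h
  | _ :: _ :: _ :: _ :: _, _ => rfl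

/-- The clause on which the algorithm branches. -/
structure Chosen (s : State) (a b : Literal) (rest : Clause) : Prop where
  perm : ∃ c ∈ s.clauses, c.Perm (a :: b :: rest)
  nodup : ClauseNodup (a :: b :: rest)
  long : 3 ≤ (a :: b :: rest).length
  longest : ∀ c ∈ s.clauses, c.length ≤ (a :: b :: rest).length
  irreducible : Irreducible s.clauses
  fst : Other s (a :: b :: rest) a
  snd : Other s (a :: b :: rest) b

theorem Chosen.local {s : State} {a b : Literal} {rest : Clause} (h : Chosen s a b rest)
    (hs : Inv s) : Local s (a :: b :: rest) := by
  obtain ⟨c, hc, hp⟩ := h.perm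
  exact ⟨h.nodup, fun x hx => hs.mem c hc x (hp.mem_iff.2 hx)⟩

/-- After `a` has been made false, the rest of the clause is a clause of the new instance; in the
case of four literals the algorithm branches on it at once. -/
theorem Chosen.perm_assign {s : State} {a b : Literal} {rest : Clause} (h : Chosen s a b rest) :
    ∃ c ∈ (assign a.neg s).val.clauses, c.Perm (b :: rest) := by
  obtain ⟨c, hc, hp⟩ := h.perm
  have hn := h.nodup
  have ha : a ∉ b :: rest := (List.nodup_cons.1 (hn.of_map _)).1
  refine ⟨c.filter fun m => decide (m ≠ a.neg.neg), ?_, ?_⟩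
  · rw [assign_val]
    refine List.mem_flatMap.2 ⟨c, hc, ?_⟩
    have h1 : a.neg ∉ c := fun h1 => by
      rcases List.mem_cons.1 (hp.mem_iff.1 h1) with h2 | h2
      · exact Literal.neg_ne a h2
      · exact (List.nodup_cons.1 hn).1 (List.mem_map.2 ⟨_, h2, rfl⟩)
    rw [assignClause, if_neg h1, List.mem_singleton]
  · refine (hp.filter _).trans (List.Perm.of_eq ?_)
    rw [Literal.neg_neg, List.filter_cons_of_neg (by simp), List.filter_eq_self]
    intro m hm
    simpa using fun e : m = a => ha (e ▸ hm)

theorem Chosen.local_assign {s : State} {a b : Literal} {rest : Clause} (h : Chosen s a b rest)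
    (hs : Inv s) : Local (assign a.neg s).val (b :: rest) := by
  obtain ⟨c, hc, hp⟩ := h.perm_assign
  have hs₀ := hs.assign (l := a.neg) ((h.local hs).mem a (by simp))
  exact ⟨(List.nodup_cons.1 h.nodup).2, fun x hx => hs₀.mem c hc x (hp.mem_iff.2 hx)⟩

/-- The weights of all calls made by one branching step add up to at most ζ⁻ᵐ for m variables. Hence
the exponential part of the bound does not grow from one level of the recursion to the next. -/
theorem Chosen.weight {s : State} {a b : Literal} {rest : Clause} (h : Chosen s a b rest)
    (hs : Inv s) :
    wt (assign a s).val + falseWt a (b :: rest) s +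
      ((b :: rest).map fun m => wt (linkDiffer a m s).val).sum ≤ zeta⁻¹ ^ s.live.length := by
  have hw := h.local hs
  match rest, h, hw with
  | [], h, _ => exact absurd h.long (by simp)
  | [c], h, hw =>
    have := branch_three hs h.perm h.irreducible hw h.fst
    simpa [falseWt] using this
  | [c, e], h, hw =>
    have := branch_four hs h.perm h.irreducible h.longest hw h.fst h.snd
    simpa [falseWt, add_assoc] using this
  | c :: e :: f :: rest, h, hw => exact branch_many hs h.perm hw (by simp)

section

variable {rec : State → Run (WithBot ℕ)} {n D : ℕ} {A W : ℝ} {s : State}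
  (H : SolvesBelow rec n s.live.length D A W) (hA : 0 ≤ A) (hs : Inv s) (hn : s.size ≤ n)
  {a b : Literal} {rest : Clause} (h : Chosen s a b rest)

include H hs hn h

/-- For a clause with four literals this is a second use of `branch_ub`, on the three literals that
are left. -/
theorem falseAnswer_value :
    IsValue (assign a.neg s).val (falseAnswer rec a (b :: rest) s).val := by
  have hw := h.local hs
  have haL : a.neg.var ∈ vars s.live := hw.mem a (by simp)
  by_cases h3 : (b :: rest).length = 3
  · obtain ⟨c, e, rfl⟩ : ∃ c e, rest = [c, e] :=
      List.length_eq_two.1 (by simpa using h3)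
    intro x
    have hs₀ := hs.assign haL
    have hn₀ := (size_assign a.neg s).trans hn
    have hL₀ : (assign a.neg s).val.live.length ≤ s.live.length := by
      have := length_assign haL
      omega
    have hw₀ := h.local_assign hs
    have hb₀ := hw₀.mem b (by simp)
    simp only [falseAnswer, bind_val, pure_val, call_val, max_le_iff]
    rw [differAnswers_le_iff H hs₀ hn₀ hL₀ hw₀, ← (solves_assign H hs₀ hn₀ hL₀ hb₀).value,
      ← (solves_assign H hs₀ hn₀ hL₀ (l := b.neg) hb₀).value,
      branch_ub hs₀ (Or.inr h.perm_assign) hw₀.nodup, and_assoc]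
  · rw [falseAnswer_of_ne rec a s h3]
    exact (solves_assign H hs hn le_rfl haL).value

-- At most four recursive calls are made, so the factor 5 is not sharp; it covers both forms of the
-- procedure.
include hA in
theorem falseAnswer_track :
    Track (falseAnswer rec a (b :: rest) s) (5 * (n + 10) ^ 3 + 10) D
      (5 * A + W * falseWt a (b :: rest) s) := by
  have hw := h.local hs
  have haL : a.neg.var ∈ vars s.live := hw.mem a (by simp)
  have hS := State.small hn
  by_cases h3 : (b :: rest).length = 3
  · obtain ⟨c, e, rfl⟩ : ∃ c e, rest = [c, e] :=
      List.length_eq_two.1 (by simpa using h3)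
    have hs₀ := hs.assign haL
    have hn₀ := (size_assign a.neg s).trans hn
    have hS₀ := State.small hn₀
    have hL₀ : (assign a.neg s).val.live.length ≤ s.live.length := by
      have := length_assign haL
      omega
    have hw₀ := h.local_assign hs
    have hb₀ := hw₀.mem b (by simp)
    refine Track.mono (Track.tick_bind (.cost_bind (assign_cost _ hS) (.cost_bind (assign_cost _ hS₀)
      ((solves_assign H hs₀ hn₀ hL₀ hb₀).track.bind (.cost_bind (assign_cost _ hS₀)
      ((solves_assign H hs₀ hn₀ hL₀ (l := b.neg) hb₀).track.bind
      (differAnswers_track H hs₀ hn₀ hL₀ hw₀).bind_pure)))))) ?_ ?_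
    · simp only [List.length_cons, List.length_nil]
      omega
    · simp only [falseWt, List.length_cons, List.length_nil]
      push_cast
      linarith
  · rw [falseAnswer_of_ne rec a s h3, falseWt_of_ne s h3]
    refine Track.mono (Track.tick_bind (.cost_bind (assign_cost _ hS)
      (solves_assign H hs hn le_rfl haL).track)) ?_ ?_
    · omega
    · linarith

theorem branch_value : IsValue s (branch rec (a :: b :: rest) s).val := by
  have hw := h.local hs
  have haL : a.var ∈ vars s.live := hw.mem a (by simp)
  intro x
  simp only [branch, bind_val, pure_val, call_val, max_le_iff]
  rw [differAnswers_le_iff H hs hn le_rfl hw, ← (solves_assign H hs hn le_rfl haL).value,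
    ← falseAnswer_value H hs hn h, branch_ub hs (Or.inr h.perm) hw.nodup, and_assoc]

include hA in
theorem branch_track (hW : 0 ≤ W) :
    Track (branch rec (a :: b :: rest) s) ((n + 10) ^ 4) D
      ((n + 6) * A + W * zeta⁻¹ ^ s.live.length) := by
  have hw := h.local hs
  have haL : a.var ∈ vars s.live := hw.mem a (by simp)
  have hS := State.small hn
  have hlen : (b :: rest).length ≤ n := by
    obtain ⟨c, hc, hp⟩ := h.perm
    have := hp.length_eq.symm.trans_le (hS.clause c hc)
    simp only [List.length_cons] at this ⊢
    omega
  -- The number of calls is estimated by 1 for the true case, 5 for the false case and `n` for the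
  -- pairs.
  refine Track.mono (Track.tick_bind (.cost_bind (assign_cost _ hS)
    ((solves_assign H hs hn le_rfl haL).track.bind ((falseAnswer_track H hA hs hn h).bind
    (differAnswers_track H hs hn le_rfl hw).bind_pure)))) ?_ ?_
  · have h1 := Nat.mul_le_mul_left ((n + 10) ^ 3 + 2) hlen
    have h2 : n + 10 ≤ (n + 10) ^ 3 := Nat.le_self_pow (by norm_num) _
    rw [pow_succ (n + 10) 3]
    nlinarith
  · have h1 := mul_le_mul_of_nonneg_left (h.weight hs) hW
    have h2 : ((b :: rest).length : ℝ) ≤ n := by exact_mod_cast hlen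
    have h3 := mul_le_mul_of_nonneg_right h2 hA
    linarith

end

/-! ## The choice of the clause -/

theorem longest_spec (c : Clause) (cs : List Clause) :
    (longest c cs).val ∈ c :: cs ∧ ∀ d ∈ c :: cs, d.length ≤ (longest c cs).val.length := by
  induction cs generalizing c with
  | nil => simp [longest]
  | cons d ds ih =>
    simp only [longest, bind_val, len_val]
    split_ifs with h
    · obtain ⟨h1, h2⟩ := ih d
      refine ⟨List.mem_cons_of_mem _ h1, List.forall_mem_cons.2 ⟨?_, h2⟩⟩
      exact h.le.trans (h2 d (by simp))
    · obtain ⟨h1, h2⟩ := ih c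
      rw [List.forall_mem_cons] at h2
      refine ⟨?_, List.forall_mem_cons.2 ⟨h2.1, List.forall_mem_cons.2 ⟨?_, h2.2⟩⟩⟩
      · rcases List.mem_cons.1 h1 with h1 | h1 <;> simp [h1]
      · exact (not_lt.1 h).trans h2.1

theorem longest_cost {n : ℕ} {c : Clause} {cs : List Clause} (h : ∀ d ∈ c :: cs, d.length ≤ n) :
    Cost (longest c cs) ((2 * n + 3) * cs.length + 1) := by
  induction cs generalizing c with
  | nil => exact Cost.tick_pure _ (by simp)
  | cons d ds ih =>
    simp only [List.forall_mem_cons] at h ih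
    have h1 : Cost (if c.length < d.length then longest d ds else longest c ds)
        ((2 * n + 3) * ds.length + 1) := by
      split_ifs
      · exact ih ⟨h.2.1, h.2.2⟩
      · exact ih ⟨h.1, h.2.2⟩
    refine Cost.mono (a := 1 + ((n + 1) + ((n + 1) + ((2 * n + 3) * ds.length + 1))))
      (Cost.tick_bind (Cost.bind ((len_cost c).mono (Nat.add_le_add_right h.1 1))
        (Cost.bind ((len_cost d).mono (Nat.add_le_add_right h.2.1 1)) ?_))) ?_
    · simpa using h1
    · rw [List.length_cons, mul_add]; omega

/-- A literal of a clause has positive degree, so if its variable is not a singleton, it occurs in a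
second clause. That clause has a different set of literals since duplicates have been removed. -/
theorem Simplified.other {s : State} (h : Simplified s) {w : Clause} (hw : w ∈ s.clauses)
    {l : Literal} (hl : l ∈ w) (hs : s.clauses.countP (occurs l.var) ≠ 1) {w' : Clause}
    (hw' : w.Perm w') : Other s w' l := by
  have hp := List.perm_cons_erase hw
  have h1 : occurs l.var w = true := by
    unfold occurs
    exact decide_eq_true ⟨l, hl, rfl⟩
  rw [hp.countP_eq, List.countP_cons_of_pos h1] at hs
  obtain ⟨d, hd, hd'⟩ := List.countP_pos_iff.1 (show 0 < (s.clauses.erase w).countP (occurs l.var)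
    by omega)
  have h2 := (hp.pairwise_iff (fun {c d} (h : ¬ ∀ l, l ∈ c ↔ l ∈ d) h' =>
    h fun l => (h' l).symm)).1 h.distinct
  refine ⟨d, List.mem_of_mem_erase hd, by simpa [occurs] using hd', fun hdw => ?_⟩
  exact (List.pairwise_cons.1 h2).1 d hd fun m => hw'.mem_iff.trans (hdw m).symm

/-- A clause has at least three literals and at most one singleton, so when non-singletons are
listed first, the first two literals both occur in other clauses. -/
theorem Simplified.chosen {s : State} (h : Simplified s) {w : Clause} (hw : w ∈ s.clauses)
    (hmax : ∀ c ∈ s.clauses, c.length ≤ w.length) :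
    ∃ a b rest, (w.filter fun l => !(isSingleton s.clauses l).val) ++
      (w.filter fun l => (isSingleton s.clauses l).val) = a :: b :: rest ∧
      Chosen s a b rest := by
  have h1 : ((w.filter fun l => !(isSingleton s.clauses l).val) ++
      (w.filter fun l => (isSingleton s.clauses l).val)).Perm w :=
    List.perm_append_comm.trans (List.filter_append_perm _ _)
  have h2 := h.singleton w hw
  obtain ⟨h3, hn⟩ := h.irreducible w hw
  have h4 := h1.length_eq
  rw [List.length_append] at h4
  simp only [isSingleton_val] at h1 h4 ⊢
  have h5 : ∀ x ∈ w.filter (fun l => !decide (s.clauses.countP (occurs l.var) = 1)),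
      x ∈ w ∧ s.clauses.countP (occurs x.var) ≠ 1 := fun x hx => by
    simpa using List.mem_filter.1 hx
  generalize w.filter (fun l => !decide (s.clauses.countP (occurs l.var) = 1)) = u at h1 h4 h5 ⊢
  match u, h1, h4, h5 with
  | [], _, h4, _ => simp only [List.length_nil] at h4; omega
  | [_], _, h4, _ => simp only [List.length_cons, List.length_nil] at h4; omega
  | a :: b :: u, h1, _, h5 =>
    refine ⟨a, b, _, rfl, ⟨w, hw, h1.symm⟩, ((h1.map _).nodup_iff).2 hn, ?_, fun c hc => ?_,
      h.irreducible, ?_, ?_⟩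
    · exact h3.trans_eq h1.length_eq.symm
    · exact (hmax c hc).trans_eq h1.length_eq.symm
    · exact h.other hw (h5 a (by simp)).1 (h5 a (by simp)).2 h1.symm
    · exact h.other hw (h5 b (by simp)).1 (h5 b (by simp)).2 h1.symm

/-! ## Solving simplified instances -/

/-- Branching on a longest one of the given clauses. -/
def branchOn (rec : State → Run (WithBot ℕ)) (s : State) (c : Clause) (cs : List Clause) :
    Run (WithBot ℕ) := do
  let w ← longest c cs
  let r ← separate (isSingleton s.clauses) w
  let w ← append r.2 r.1
  branch rec w s

/-- The work on a simplified instance. -/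
def solveSimplified (rec : State → Run (WithBot ℕ)) (s : State) : Run (WithBot ℕ) := do
  match ← pick isEmptyClause s.clauses with
  | some _ => pure ⊥
  | none =>
    match s.clauses with
    | [] => pure s.acc
    | c :: cs =>
      let n ← len s.clauses
      match ← components n s.clauses with
      | d₁ :: d₂ :: ds =>
        let ts ← toStates s.live (d₁ :: d₂ :: ds)
        let x ← sumAnswers rec ts
        pure (s.acc + x)
      | _ => branchOn rec s c cs

/-- Holds by definition. The work after simplification can thus be analysed for an arbitrary
recursive procedure. -/
theorem solve_succ (k : ℕ) (s : State) :
    solve (k + 1) s = (do tick; let t ← simplify s; solveSimplified (solve k) t) := rfl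

theorem branchOn_value {rec : State → Run (WithBot ℕ)} {n D : ℕ} {A W : ℝ} {s : State}
    (H : SolvesBelow rec n s.live.length D A W) (hs : Inv s) (hn : s.size ≤ n)
    (h : Simplified s) {c : Clause} {cs : List Clause} (hc : s.clauses = c :: cs) :
    IsValue s (branchOn rec s c cs).val := by
  obtain ⟨h1, h2⟩ := longest_spec c cs
  rw [← hc] at h1 h2
  obtain ⟨a, b, rest, h3, h4⟩ := h.chosen h1 h2
  simp only [branchOn, bind_val, append_val, separate_val]
  rw [h3]
  exact branch_value H hs hn h4

theorem branchOn_track {rec : State → Run (WithBot ℕ)} {n D : ℕ} {A W : ℝ} {s : State}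
    (H : SolvesBelow rec n s.live.length D A W) (hA : 0 ≤ A) (hW : 0 ≤ W) (hs : Inv s)
    (hn : s.size ≤ n) (h : Simplified s) {c : Clause} {cs : List Clause}
    (hc : s.clauses = c :: cs) :
    Track (branchOn rec s c cs) ((n + 10) ^ 5) D
      ((n + 6) * A + W * zeta⁻¹ ^ s.live.length) := by
  have hS := State.small hn
  obtain ⟨h1, h2⟩ := longest_spec c cs
  rw [← hc] at h1 h2
  obtain ⟨a, b, rest, h3, h4⟩ := h.chosen h1 h2
  have h5 := hS.clause _ h1
  have h6 : cs.length ≤ n := by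
    have := hS.clauses
    rw [hc, List.length_cons] at this
    omega
  have hn3 : (n + 10) ^ 3 = n ^ 3 + 30 * n ^ 2 + 300 * n + 1000 := by ring
  have k1 : Cost (longest c cs) ((n + 10) ^ 3) :=
    (longest_cost fun d hd => hS.clause d (hc ▸ hd)).mono (by
      have := Nat.mul_le_mul_left (2 * n + 3) h6
      nlinarith)
  have k2 : Cost (separate (isSingleton s.clauses) (longest c cs).val) ((n + 10) ^ 3) :=
    (separate_cost fun x _ => isSingleton_cost hS.clause x).mono (by
      have h7 := Nat.mul_le_mul_left (n + 2) hS.clauses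
      have h8 := Nat.mul_le_mul (Nat.add_le_add_right h7 3) h5
      nlinarith)
  have k3 : Cost (append (separate (isSingleton s.clauses) (longest c cs).val).val.2
      (separate (isSingleton s.clauses) (longest c cs).val).val.1) (n + 1) := by
    refine (append_cost _ _).mono (Nat.add_le_add_right ?_ 1)
    rw [separate_val]
    exact (List.length_filter_le _ _).trans h5
  refine Track.mono (.cost_bind k1 (.cost_bind k2 (.cost_bind k3 (b := (n + 10) ^ 4) ?_))) ?_ le_rfl
  · rw [append_val, separate_val]
    dsimp only
    rw [h3]
    exact branch_track H hA hs hn h4 hW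
  · have h7 : n + 1 ≤ (n + 10) ^ 3 := le_trans (by omega) (Nat.le_self_pow (by norm_num) _)
    have h8 : (n + 10) ^ 3 ≤ (n + 10) ^ 4 := Nat.pow_le_pow_right (by omega) (by omega)
    rw [pow_succ (n + 10) 4]
    nlinarith

theorem isEmptyClause_val (c : Clause) : (isEmptyClause c).val = true ↔ c = [] := by
  cases c <;> simp [isEmptyClause]

theorem isEmptyClause_cost (c : Clause) : Cost (isEmptyClause c) 1 := by
  cases c <;> exact Cost.tick_pure _ le_rfl

theorem isValue_bot {s : State} (h : [] ∈ s.clauses) : IsValue s ⊥ := fun b =>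
  iff_of_true (fun M _ hM _ => absurd (hM [] h) (by simp [SatC])) bot_le

theorem isValue_acc {s : State} (h : s.clauses = []) (hl : s.live = []) : IsValue s s.acc := by
  intro b
  have ht : ∀ M M', total s M M' = s.acc := fun M M' => by simp [total, score, hl]
  refine ⟨fun hb => ?_, fun hb M M' _ _ => (ht M M').trans_le hb⟩
  have := hb (fun _ => true) (fun _ => true) (by simp [Sat, h]) (by simp [Sat, h])
  rwa [ht] at this

/-- Two variables already give a factor ζ⁻² ≥ 2, and x + y ≤ xy if x and y are at least 2. -/
theorem sum_inv_zeta_pow_le {ms : List ℕ} (h : ∀ m ∈ ms, 2 ≤ m) :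
    (ms.map fun m => zeta⁻¹ ^ m).sum ≤ zeta⁻¹ ^ ms.sum := by
  have h2 : ∀ m, 2 ≤ m → 2 ≤ zeta⁻¹ ^ m := fun m hm =>
    le_trans (by norm_num [zeta]) (pow_le_pow_right₀ one_le_inv_zeta hm)
  induction ms with
  | nil => simp
  | cons m ms ih =>
    have ih := ih fun x hx => h x (by simp [hx])
    rw [List.map_cons, List.sum_cons, List.sum_cons, pow_add]
    cases ms with
    | nil => simp
    | cons k ms =>
      have h3 := h2 m (h m (by simp))
      have h4 := h2 (k :: ms).sum (by
        have := h k (by simp)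
        rw [List.sum_cons]; omega)
      nlinarith

theorem length_le_of_perm_flatten {F : List Clause} {ds : List (List Clause)}
    (hp : F.Perm ds.flatten) (hne : ∀ d ∈ ds, d ≠ []) : ds.length ≤ F.length := by
  have h := List.length_le_sum_of_one_le (ds.map List.length) (by
    simpa [Nat.one_le_iff_ne_zero] using hne)
  rwa [List.length_map, ← List.length_flatten, ← hp.length_eq] at h

/-- A component has at least three variables. -/
theorem three_le_compState {s : State} (hs : Inv s) (hirr : Irreducible s.clauses)
    {d : List Clause} (hd : ∀ c ∈ d, c ∈ s.clauses) (hne : d ≠ []) :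
    3 ≤ (compState s.live d).live.length := by
  obtain ⟨c, hc⟩ := List.exists_mem_of_ne_nil d hne
  obtain ⟨h3, hn⟩ := hirr c (hd c hc)
  have h1 : c.map Literal.var ⊆ vars (compState s.live d).live := fun v hv => by
    obtain ⟨l, hl, rfl⟩ := List.mem_map.1 hv
    exact (compState_inv hs hd).mem c hc l hl
  have := (List.subperm_of_subset hn h1).length_le
  rw [List.length_map, List.length_map] at this
  omega

section

variable {rec : State → Run (WithBot ℕ)} {n D : ℕ} {A W : ℝ} {s : State}
  (H : SolvesBelow rec n s.live.length D A W) (hs : Inv s) (hn : s.size ≤ n) (h : Simplified s)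
  {ds : List (List Clause)} (hp : s.clauses.Perm ds.flatten) (hd : ds.Pairwise Apart)
  (hne : ∀ d ∈ ds, d ≠ []) (h2 : 2 ≤ ds.length)

include hs h hp hne in
theorem three_le_components {d : List Clause} (hdd : d ∈ ds) :
    3 ≤ (compState s.live d).live.length :=
  three_le_compState hs h.irreducible
    (fun _ hc => hp.mem_iff.2 (List.mem_flatten.2 ⟨d, hdd, hc⟩)) (hne d hdd)

include H hs hn h hp hd hne h2

/-- Some other component exists and has at least three variables, so each component has fewer
variables than the whole and the recursion may be applied to it. -/
theorem solves_components {d : List Clause} (hdd : d ∈ ds) :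
    Solves (rec (compState s.live d)) (compState s.live d) D (A + W * wt (compState s.live d)) := by
  refine H _ (compState_inv hs fun _ hc => hp.mem_iff.2 (List.mem_flatten.2 ⟨d, hdd, hc⟩))
    ((size_compState hp hdd).trans hn) ?_
  rw [length_compState_sum h.free hp hd]
  have hp' := List.perm_cons_erase hdd
  rw [(hp'.map _).sum_eq, List.map_cons, List.sum_cons]
  obtain ⟨e, he⟩ := List.exists_mem_of_length_pos (l := ds.erase d) (by
    rw [List.length_erase_of_mem hdd]; omega)
  have h3 := three_le_components hs h hp hne (List.mem_of_mem_erase he)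
  have h4 := List.single_le_sum (l := (ds.erase d).map fun d => (compState s.live d).live.length)
    (by simp) _ (List.mem_map_of_mem he)
  omega

theorem components_answer :
    IsValue s (s.acc + (sumAnswers rec (ds.map (compState s.live))).val) := by
  rw [sumAnswers_val, List.map_map]
  exact components_value h.free hp hd fun d hdd =>
    (solves_components H hs hn h hp hd hne h2 hdd).value

theorem components_track (hA : 0 ≤ A) (hW : 0 ≤ W) :
    Track (sumAnswers rec (ds.map (compState s.live))) (2 * n + 1) D
      ((n + 6) * A + W * zeta⁻¹ ^ s.live.length) := by
  have hds : ds.length ≤ n := (length_le_of_perm_flatten hp hne).trans (State.small hn).clauses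
  refine (sumAnswers_track (D := D) (τ := fun t => A + W * zeta⁻¹ ^ t.live.length)
    (ts := ds.map (compState s.live)) fun t ht => ?_).mono ?_ ?_
  · obtain ⟨d, hdd, rfl⟩ := List.mem_map.1 ht
    have h1 := solves_components H hs hn h hp hd hne h2 hdd
    refine ⟨h1.value, h1.peak, h1.time.trans ?_⟩
    have h3 := wt_le_pow (r := 0) (compState_inv hs fun _ hc =>
      hp.mem_iff.2 (List.mem_flatten.2 ⟨d, hdd, hc⟩)) le_rfl
    rw [pow_zero, one_mul] at h3
    have := mul_le_mul_of_nonneg_left h3 hW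
    simpa using this
  · rw [List.length_map]; omega
  · have h1 := sum_inv_zeta_pow_le (ms := ds.map fun d => (compState s.live d).live.length) (by
      intro m hm
      obtain ⟨d, hdd, rfl⟩ := List.mem_map.1 hm
      have := three_le_components hs h hp hne hdd
      omega)
    rw [← length_compState_sum h.free hp hd, List.map_map] at h1
    have h3 := mul_le_mul_of_nonneg_left h1 hW
    have h4 : (ds.length : ℝ) ≤ n := by exact_mod_cast hds
    have h5 := mul_le_mul_of_nonneg_right h4 hA
    rw [List.map_map]
    simp only [Function.comp_def, List.sum_map_add, List.map_const', List.sum_replicate,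
      nsmul_eq_mul, List.sum_map_mul_left] at h3 ⊢
    linarith

end

/-- No calls are made if there is an empty clause, so their time is 0; this is what justifies giving
contradictory instances weight 0. -/
theorem solveSimplified_spec {rec : State → Run (WithBot ℕ)} {n D : ℕ} {A W : ℝ} {s : State}
    (H : SolvesBelow rec n s.live.length D A W) (hA : 0 ≤ A) (hW : 0 ≤ W) (hs : Inv s)
    (hn : s.size ≤ n) (h : [] ∈ s.clauses ∨ Simplified s) :
    IsValue s (solveSimplified rec s).val ∧ Track (solveSimplified rec s) ((n + 10) ^ 8) D
      (if [] ∈ s.clauses then 0 else (n + 6) * A + W * zeta⁻¹ ^ s.live.length) := by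
  have hS := State.small hn
  have hz : 0 ≤ zeta⁻¹ ^ s.live.length := pow_nonneg (zero_le_one.trans one_le_inv_zeta) _
  have hτ : 0 ≤ (n + 6) * A + W * zeta⁻¹ ^ s.live.length := by positivity
  have k1 : Cost (pick isEmptyClause s.clauses) (2 * n + 1) :=
    (pick_cost fun c _ => isEmptyClause_cost c).mono
      (Nat.add_le_add_right (Nat.mul_le_mul_left 2 hS.clauses) 1)
  have k2 : Cost (len s.clauses) (n + 1) :=
    (len_cost _).mono (Nat.add_le_add_right hS.clauses 1)
  have k3 : Cost (components s.clauses.length s.clauses) ((n + 10) ^ 6 * n + 1) :=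
    (components_cost _ hS.clause hS.clauses).mono
      (Nat.add_le_add_right (Nat.mul_le_mul_left _ hS.clauses) 1)
  have e1 : n + 10 ≤ (n + 10) ^ 4 := Nat.le_self_pow (by norm_num) _
  have e2 : (n + 10) ^ 4 ≤ (n + 10) ^ 5 := Nat.pow_le_pow_right (by omega) (by omega)
  have e3 : (n + 10) ^ 5 ≤ (n + 10) ^ 6 := Nat.pow_le_pow_right (by omega) (by omega)
  have e4 : (n + 10) ^ 4 * n ≤ (n + 10) ^ 6 * n :=
    Nat.mul_le_mul_right n (Nat.pow_le_pow_right (by omega) (by omega))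
  have e5 : (n + 10) ^ 8 = (n + 10) ^ 6 * n * n + 20 * ((n + 10) ^ 6 * n) + 100 * (n + 10) ^ 6 := by
    ring
  cases hpk : (pick isEmptyClause s.clauses).val with
  | some p =>
    obtain ⟨c, cs⟩ := p
    obtain ⟨h1, h2⟩ := pick_some_perm hpk
    rw [isEmptyClause_val] at h1
    subst h1
    have h3 : [] ∈ s.clauses := h2.mem_iff.2 (by simp)
    refine ⟨?_, ?_⟩
    · simp only [solveSimplified, bind_val, hpk, pure_val]
      exact isValue_bot h3
    · rw [if_pos h3]
      refine Track.mono (.cost_bind k1 (b := 0) ?_) (by omega) le_rfl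
      rw [hpk]
      exact .pure _
  | none =>
    have h3 : [] ∉ s.clauses := fun h3 => by
      have := pick_none hpk [] h3
      rw [(isEmptyClause_val []).2 rfl] at this
      exact absurd this (by simp)
    have h := h.resolve_left h3
    rw [if_neg h3]
    cases hcl : s.clauses with
    | nil =>
      have hl : s.live = [] := List.eq_nil_iff_forall_not_mem.2 fun x hx =>
        h.free x hx (by simp [Absent, hcl])
      refine ⟨?_, ?_⟩
      · simp only [solveSimplified, bind_val, hcl]
        exact isValue_acc hcl hl
      · refine Track.mono (.cost_bind k1 (b := 0) ?_) (by omega) hτ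
        rw [hpk]
        simp only [hcl]
        exact .pure _
    | cons c cs =>
      obtain ⟨h4, h5, h6⟩ := components_spec s.clauses.length s.clauses le_rfl
      have hbv := branchOn_value H hs hn h hcl
      have hbt := branchOn_track H hA hW hs hn h hcl
      have hv := components_answer H hs hn h h4 h5 h6
      have ht := fun h2 => components_track H hs hn h h4 h5 h6 h2 hA hW
      have k4 : Cost (toStates s.live (components s.clauses.length s.clauses).val)
          ((n + 10) ^ 4 * n + 1) := by
        refine (toStates_cost hS.live fun d hd => ?_).mono
          (Nat.add_le_add_right (Nat.mul_le_mul_left _ ?_) 1)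
        · have hsub := List.sublist_flatten_of_mem hd
          exact ⟨(hsub.length_le.trans_eq h4.length_eq.symm).trans hS.clauses,
            fun e he => hS.clause e (h4.mem_iff.2 (hsub.subset he))⟩
        · exact (length_le_of_perm_flatten h4 h6).trans hS.clauses
      obtain ⟨cl, live, acc⟩ := s
      dsimp only at hcl
      subst hcl
      dsimp only at *
      rcases hcomp : (components (c :: cs).length (c :: cs)).val with _ | ⟨d₁, _ | ⟨d₂, ds⟩⟩
      · refine ⟨?_, ?_⟩
        · simp only [solveSimplified, bind_val, hpk, len_val, hcomp]
          exact hbv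
        · refine Track.mono (.cost_bind k1 (b := (n + 1) + (((n + 10) ^ 6 * n + 1) + (n + 10) ^ 5)) ?_)
            (by omega) le_rfl
          rw [hpk]
          refine .cost_bind k2 (.cost_bind (by rw [len_val]; exact k3) ?_)
          rw [len_val, hcomp]
          exact hbt
      · refine ⟨?_, ?_⟩
        · simp only [solveSimplified, bind_val, hpk, len_val, hcomp]
          exact hbv
        · refine Track.mono (.cost_bind k1 (b := (n + 1) + (((n + 10) ^ 6 * n + 1) + (n + 10) ^ 5)) ?_)
            (by omega) le_rfl
          rw [hpk]
          refine .cost_bind k2 (.cost_bind (by rw [len_val]; exact k3) ?_)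
          rw [len_val, hcomp]
          exact hbt
      · rw [hcomp] at hv ht k4
        refine ⟨?_, ?_⟩
        · simp only [solveSimplified, bind_val, pure_val, hpk, len_val, hcomp, toStates_val]
          exact hv (by simp)
        · refine Track.mono (.cost_bind k1 (b := (n + 1) + (((n + 10) ^ 6 * n + 1) +
            (((n + 10) ^ 4 * n + 1) + (2 * n + 1)))) ?_) (by omega) le_rfl
          rw [hpk]
          refine .cost_bind k2 (.cost_bind (by rw [len_val]; exact k3) ?_)
          rw [len_val, hcomp]
          refine .cost_bind k4 ?_
          rw [toStates_val]
          exact (ht (by simp)).bind_pure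

/-- Write P for (n + 10)⁹. One level costs at most P steps and P blocks of its own. Its calls, at
most n + 6 in the estimate, contribute an additive P each and k(n + 8)P times their total weight. -/
theorem solve_solvesBelow (n k : ℕ) :
    SolvesBelow (solve k) n k (k * (n + 10) ^ 9) (((n + 10) ^ 9 : ℕ) : ℝ)
      (k * (n + 8) * ((n + 10) ^ 9 : ℕ)) := by
  have hP1 : (n + 10) ^ 8 + (n + 10) ^ 8 + 1 ≤ (n + 10) ^ 9 := by
    have := Nat.one_le_pow 8 (n + 10) (by omega)
    rw [pow_succ (n + 10) 8]
    nlinarith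
  generalize (n + 10) ^ 9 = P at hP1 ⊢
  induction k with
  | zero => exact fun t _ _ h => absurd h (by omega)
  | succ k ih =>
    intro t ht htn hlt
    obtain ⟨h1, h2⟩ := simplify_spec ht
    have hs := h1.inv ht
    have hn := h1.size_le.trans htn
    have hl := h1.live_le
    have H : SolvesBelow (solve k) n (simplify t).val.live.length (k * P) P
        (k * (n + 8) * P) := fun u hu hun hul => ih u hu hun (by omega)
    obtain ⟨h3, h4⟩ := solveSimplified_spec H (by positivity) (by positivity) hs hn h2
    have h5 := Track.tick_bind (f := fun _ => simplify t >>= solveSimplified (solve k))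
      (.cost_bind (simplify_cost htn) h4)
    rw [← solve_succ] at h5
    replace h5 := h5.mono (b' := P) (by omega) le_rfl
    refine ⟨fun b => ?_, h5.peak.trans_eq (by ring), h5.time.trans (add_le_add_right ?_ _)⟩
    · rw [h1.ub ht]
      exact h3 b
    -- If there is no contradiction, the weight is at least 1 and absorbs the additive terms (n +
    -- 6)P into the coefficient of the next level.
    · unfold wt
      split_ifs with h6
      · simp
      · have h7 : 1 ≤ zeta⁻¹ ^ (simplify t).val.live.length := one_le_pow₀ one_le_inv_zeta
        have h8 : (0 : ℝ) ≤ (n + 8) * P := by positivity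
        have h9 := mul_le_mul_of_nonneg_left h7 h8
        have h10 : (0 : ℝ) ≤ P := by positivity
        push_cast
        linarith

/-! ## The list of variables -/

theorem addVars_spec (c : Clause) {live : List (ℕ × Gain)} (hn : (vars live).Nodup)
    (hg : ∀ x ∈ live, x.2 = ⟨0, 0, 1⟩) :
    (vars (addVars c live).val).Nodup ∧ (∀ x ∈ (addVars c live).val, x.2 = ⟨0, 0, 1⟩) ∧
      ∀ v, v ∈ vars (addVars c live).val ↔ v ∈ vars live ∨ v ∈ c.map Literal.var := by
  induction c generalizing live with
  | nil => exact ⟨hn, hg, by simp [addVars]⟩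
  | cons l c ih =>
    simp only [addVars, bind_val]
    cases h : (pick (fun x : ℕ × Gain => do tick; pure (decide (x.1 = l.var))) live).val with
    | some p =>
      obtain ⟨x, ys⟩ := p
      obtain ⟨h1, h2⟩ := pick_some_perm h
      have hx : l.var ∈ vars live := by
        have h1 : x.1 = l.var := by simpa using h1
        exact h1 ▸ List.mem_map_of_mem (h2.mem_iff.2 (by simp))
      obtain ⟨h3, h4, h5⟩ := ih hn hg
      refine ⟨h3, h4, fun v => ?_⟩
      rw [h5, List.map_cons, List.mem_cons]
      refine ⟨fun h => h.imp_right Or.inr, ?_⟩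
      rintro (h | rfl | h)
      · exact Or.inl h
      · exact Or.inl hx
      · exact Or.inr h
    | none =>
      have hx : l.var ∉ vars live := fun hx => by
        obtain ⟨x, hx, hxl⟩ := List.mem_map.1 hx
        have := pick_none h x hx
        simp [hxl] at this
      obtain ⟨h3, h4, h5⟩ := ih (live := (l.var, ⟨0, 0, 1⟩) :: live)
        (List.nodup_cons.2 ⟨hx, hn⟩) (by simpa using hg)
      refine ⟨h3, h4, fun v => ?_⟩
      rw [h5, List.map_cons, vars, List.map_cons, List.mem_cons, List.mem_cons]
      tauto

theorem allVars_spec (F : List Clause) {live : List (ℕ × Gain)} (hn : (vars live).Nodup)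
    (hg : ∀ x ∈ live, x.2 = ⟨0, 0, 1⟩) :
    (vars (allVars F live).val).Nodup ∧ (∀ x ∈ (allVars F live).val, x.2 = ⟨0, 0, 1⟩) ∧
      ∀ v, v ∈ vars (allVars F live).val ↔ v ∈ vars live ∨ v ∈ F.flatten.map Literal.var := by
  induction F generalizing live with
  | nil => exact ⟨hn, hg, by simp [allVars]⟩
  | cons c F ih =>
    obtain ⟨h1, h2, h3⟩ := addVars_spec c hn hg
    obtain ⟨h4, h5, h6⟩ := ih h1 h2
    refine ⟨h4, h5, fun v => ?_⟩
    rw [List.flatten_cons, List.map_append, List.mem_append, ← or_assoc, ← h3]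
    exact h6 v

theorem addVars_length (c : Clause) (live : List (ℕ × Gain)) :
    (addVars c live).val.length ≤ live.length + c.length := by
  induction c generalizing live with
  | nil => simp [addVars]
  | cons l c ih =>
    simp only [addVars, bind_val, List.length_cons]
    split
    · have := ih live; omega
    · have := ih ((l.var, ⟨0, 0, 1⟩) :: live)
      rw [List.length_cons] at this
      omega

theorem addVars_cost {n : ℕ} (c : Clause) {live : List (ℕ × Gain)}
    (h : live.length + c.length ≤ n) : Cost (addVars c live) ((2 * n + 2) * c.length + 1) := by
  induction c generalizing live with
  | nil => exact Cost.tick_pure _ (by simp)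
  | cons l c ih =>
    rw [List.length_cons] at h
    refine Cost.mono (a := 1 + ((2 * n + 1) + ((2 * n + 2) * c.length + 1))) (Cost.tick_bind
      (Cost.bind ((pick_cost (K := 1) fun x _ => Cost.tick_pure _ le_rfl).mono (by omega)) ?_)) ?_
    · split
      · exact ih (by omega)
      · exact ih (by rw [List.length_cons]; omega)
    · rw [List.length_cons, mul_add]; omega

theorem allVars_cost {n : ℕ} (F : Formula) {live : List (ℕ × Gain)}
    (h : live.length + litCount F ≤ n) :
    Cost (allVars F live) ((2 * n + 2) * inputSize F + 1) := by
  induction F generalizing live with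
  | nil => exact Cost.tick_pure _ (by simp)
  | cons c F ih =>
    rw [litCount_cons] at h
    have h1 := addVars_length c live
    refine Cost.mono (Cost.tick_bind (Cost.bind (addVars_cost c (n := n) (by omega))
      (ih (by omega)))) ?_
    have : inputSize (c :: F) = c.length + 1 + inputSize F := by simp [inputSize]
    rw [this, mul_add, mul_add]
    omega

/-! ## The Hamming distance -/

theorem isXModel_iff {F : Formula} (M : ℕ → Bool) :
    IsXModel F (fun v => M v.1) ↔ Sat M F := by
  refine forall₂_congr fun c hc => ?_
  unfold SatC
  rw [List.countP_congr fun l hl => ?_]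
  have : l.var ∈ varSet F :=
    List.mem_toFinset.2 (List.mem_map_of_mem (List.mem_flatten.2 ⟨c, hc, hl⟩))
  simp [Literal.holds, litv, this]

theorem score_eq_sum {live : List (ℕ × Gain)} (hg : ∀ x ∈ live, x.2 = ⟨0, 0, 1⟩)
    (M M' : ℕ → Bool) :
    score live M M' = (((vars live).map fun v => if M v ≠ M' v then 1 else 0).sum : ℕ) := by
  induction live with
  | nil => rfl
  | cons x live ih =>
    rw [score_cons, ih fun y hy => hg y (by simp [hy]), hg x (by simp), vars, vars, List.map_cons,
      List.map_cons, List.sum_cons, Nat.cast_add]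
    congr 1
    cases M x.1 <;> cases M' x.1 <;> rfl

theorem hammingDist_eq_sum {F : Formula} {L : List ℕ} (hn : L.Nodup)
    (hL : ∀ v, v ∈ L ↔ v ∈ varSet F) (M M' : ℕ → Bool) :
    hammingDist (fun v : {v // v ∈ varSet F} => M v.1) (fun v => M' v.1) =
      (L.map fun v => if M v ≠ M' v then 1 else 0).sum := by
  have h : L.toFinset = varSet F := Finset.ext fun v => by rw [List.mem_toFinset, hL]
  rw [← List.sum_toFinset _ hn, h, hammingDist, Finset.card_filter,
    Finset.sum_coe_sort (varSet F) fun v => if M v ≠ M' v then 1 else 0]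

/-- Both numbers have the same upper bounds. Assignments to the variables of `F` are exactly the
restrictions of assignments to all natural numbers, and each initial record contributes 1 for a
difference and 0 otherwise. -/
theorem eq_maxHammingDistance {F : Formula} {live : List (ℕ × Gain)} (hn : (vars live).Nodup)
    (hg : ∀ x ∈ live, x.2 = ⟨0, 0, 1⟩) (hL : ∀ v, v ∈ vars live ↔ v ∈ varSet F)
    {a : WithBot ℕ} (h : IsValue ⟨F, live, 0⟩ a) : a = maxHammingDistance F := by
  classical
  have ht : ∀ M M', total ⟨F, live, 0⟩ M M' =
      ((hammingDist (fun v : {v // v ∈ varSet F} => M v.1) (fun v => M' v.1) : ℕ) : WithBot ℕ) := by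
    intro M M'
    rw [total, zero_add, score_eq_sum hg, hammingDist_eq_sum hn hL]
  refine eq_of_forall_ge_iff fun b => ?_
  rw [← h b, maxHammingDistance, Finset.sup_le_iff]
  constructor
  · rintro hb ⟨p, q⟩ hpq
    rw [Finset.mem_filter] at hpq
    obtain ⟨-, hp, hq⟩ := hpq
    have hext : ∀ p : Assignment F, ∃ M : ℕ → Bool, p = fun v => M v.1 := fun p =>
      ⟨fun v => if hv : v ∈ varSet F then p ⟨v, hv⟩ else false, by funext v; simp⟩
    obtain ⟨M, rfl⟩ := hext p
    obtain ⟨M', rfl⟩ := hext q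
    exact (ht M M').symm.trans_le (hb M M' ((isXModel_iff M).1 hp) ((isXModel_iff M').1 hq))
  · intro hb M M' hM hM'
    rw [ht]
    exact hb (_, _) (Finset.mem_filter.2
      ⟨Finset.mem_univ _, (isXModel_iff M).2 hM, (isXModel_iff M').2 hM'⟩)

/-! ## The algorithm -/

theorem litCount_le_inputSize (F : Formula) : litCount F ≤ inputSize F :=
  List.sum_le_sum fun _ _ => Nat.le_succ _

theorem formSize_le_inputSize (F : Formula) : formSize F ≤ inputSize F :=
  List.sum_le_sum fun c _ => by unfold clauseSize; omega

theorem initial_spec (F : Formula) :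
    (vars (allVars F []).val).Nodup ∧ (∀ x ∈ (allVars F []).val, x.2 = ⟨0, 0, 1⟩) ∧
      ∀ v, v ∈ vars (allVars F []).val ↔ v ∈ varSet F := by
  obtain ⟨h1, h2, h3⟩ := allVars_spec F (live := []) List.nodup_nil (by simp)
  exact ⟨h1, h2, fun v => by rw [h3, varSet, List.mem_toFinset]; simp⟩

theorem initial_inv (F : Formula) : Inv ⟨F, (allVars F []).val, 0⟩ := by
  obtain ⟨h1, -, h3⟩ := initial_spec F
  exact ⟨h1, fun c hc l hl => (h3 _).2
    (List.mem_toFinset.2 (List.mem_map_of_mem (List.mem_flatten.2 ⟨c, hc, hl⟩)))⟩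

theorem initial_length (F : Formula) : (allVars F []).val.length = numVars F := by
  obtain ⟨h1, -, h3⟩ := initial_spec F
  rw [numVars, ← List.length_map (f := Prod.fst), ← List.toFinset_card_of_nodup h1]
  exact congrArg _ (Finset.ext fun v => by rw [List.mem_toFinset, h3])

theorem numVars_le_inputSize (F : Formula) : numVars F ≤ inputSize F := by
  refine le_trans ?_ (litCount_le_inputSize F)
  refine (List.toFinset_card_le _).trans_eq ?_
  rw [List.length_map, List.length_flatten, litCount]

/-- The procedure on the initial instance. -/
theorem initial_solves (F : Formula) :
    Solves (solve (numVars F + 1) ⟨F, (allVars F []).val, 0⟩) ⟨F, (allVars F []).val, 0⟩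
      ((numVars F + 1) * (2 * inputSize F + 10) ^ 9)
      (((2 * inputSize F + 10) ^ 9 : ℕ) + ((numVars F + 1 : ℕ) : ℝ) * ((2 * inputSize F : ℕ) + 8) *
        ((2 * inputSize F + 10) ^ 9 : ℕ) * wt ⟨F, (allVars F []).val, 0⟩) := by
  refine solve_solvesBelow _ _ _ (initial_inv F) ?_ ?_
  -- The clauses and the variables contribute at most the input size each, which explains the factor
  -- 2.
  · have h1 := formSize_le_inputSize F
    have h2 := numVars_le_inputSize F
    rw [← initial_length] at h2
    unfold State.size
    dsimp only
    omega
  · rw [initial_length]; omega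

theorem Q_val (F : Formula) : (Q F).val = maxHammingDistance F := by
  obtain ⟨h1, h2, h3⟩ := initial_spec F
  refine eq_maxHammingDistance h1 h2 h3 ?_
  simp only [Q, bind_val, call_val, len_val, initial_length]
  exact (initial_solves F).value

/-- The polynomial factor. -/
noncomputable def bound : Polynomial ℕ :=
  (2 * .X + 2) * .X + .X + 4 + (2 * .X + 10) ^ 9 + (.X + 1) * (2 * .X + 8) * (2 * .X + 10) ^ 9

theorem bound_eval (N : ℕ) : bound.eval N = (2 * N + 2) * N + N + 4 + (2 * N + 10) ^ 9 +
    (N + 1) * (2 * N + 8) * (2 * N + 10) ^ 9 := by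
  simp [bound]

theorem Q_track (F : Formula) :
    Track (Q F) ((2 * inputSize F + 2) * inputSize F + inputSize F + 4)
      ((numVars F + 1) * (2 * inputSize F + 10) ^ 9)
      (((2 * inputSize F + 10) ^ 9 : ℕ) + ((numVars F + 1 : ℕ) : ℝ) * ((2 * inputSize F : ℕ) + 8) *
        ((2 * inputSize F + 10) ^ 9 : ℕ) * wt ⟨F, (allVars F []).val, 0⟩) := by
  have h1 := numVars_le_inputSize F
  have k1 := allVars_cost F (live := []) (n := inputSize F) (by
    simpa using litCount_le_inputSize F)
  have k2 : Cost (len (allVars F []).val) (numVars F + 1) := by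
    rw [← initial_length]
    exact len_cost _
  refine Track.mono (Track.tick_bind (.cost_bind k1 (.cost_bind k2 (b := 1) ?_))) (by omega) le_rfl
  rw [len_val, initial_length]
  exact (initial_solves F).track

theorem Q_peak (F : Formula) : (Q F).peak ≤ bound.eval (inputSize F) := by
  refine (Q_track F).peak.trans ?_
  rw [bound_eval]
  have h1 := numVars_le_inputSize F
  generalize (2 * inputSize F + 10) ^ 9 = P
  have h2 : (numVars F + 1) * P ≤ (inputSize F + 1) * (2 * inputSize F + 8) * P :=
    Nat.mul_le_mul_right P ((Nat.add_le_add_right h1 1).trans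
      (Nat.le_mul_of_pos_right _ (by omega)))
  omega

/-- Simplification does not add variables, so the weight of the initial instance is at most ζ⁻¹ to
the number of variables. That power is at least 1, so additive polynomial terms can be multiplied by
it. -/
theorem Q_time (F : Formula) :
    ((Q F).time : ℝ) ≤ (bound.eval (inputSize F) : ℕ) * zeta⁻¹ ^ numVars F := by
  refine (Q_track F).time.trans ?_
  rw [bound_eval]
  have h1 : ((numVars F : ℕ) : ℝ) ≤ inputSize F := by exact_mod_cast numVars_le_inputSize F
  have h2 := wt_le_pow (r := 0) (initial_inv F) le_rfl
  simp only [pow_zero, one_mul, initial_length, add_zero] at h2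
  have h3 : 1 ≤ zeta⁻¹ ^ numVars F := one_le_pow₀ one_le_inv_zeta
  generalize (2 * inputSize F + 10) ^ 9 = P
  generalize (2 * inputSize F + 2) * inputSize F + inputSize F + 4 = B
  have hP : (0 : ℝ) ≤ P := Nat.cast_nonneg _
  have hN : (0 : ℝ) ≤ inputSize F := Nat.cast_nonneg _
  push_cast
  have h4 : ((numVars F : ℝ) + 1) * (2 * inputSize F + 8) * P *
      wt ⟨F, (allVars F []).val, 0⟩ ≤
      ((inputSize F : ℝ) + 1) * (2 * inputSize F + 8) * P * zeta⁻¹ ^ numVars F := by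
    refine (mul_le_mul_of_nonneg_left h2 (by positivity)).trans ?_
    gcongr
  have h5 : (B : ℝ) + P ≤ (B + P) * zeta⁻¹ ^ numVars F :=
    le_mul_of_one_le_right (by positivity) h3
  linarith

/-! ## Polynomials and exponentials -/

theorem inv_zeta_lt : zeta⁻¹ < 1.8348 := by norm_num [zeta]

theorem eval_mono (p : Polynomial ℕ) : Monotone fun n => p.eval n := by
  intro m n h
  induction p using Polynomial.induction_on' with
  | add p q hp hq => simpa using Nat.add_le_add hp hq
  | monomial k a => simpa using Nat.mul_le_mul_left a (Nat.pow_le_pow_left h k)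

/-- It suffices to consider monomials, for which nᵏrⁿ tends to 0 and is therefore bounded. -/
theorem exists_eval_mul_pow_le (p : Polynomial ℕ) {r : ℝ} (h0 : 0 ≤ r) (h1 : r < 1) :
    ∃ C : ℝ, ∀ n : ℕ, (p.eval n : ℕ) * r ^ n ≤ C := by
  induction p using Polynomial.induction_on' with
  | add p q hp hq =>
    obtain ⟨C, hC⟩ := hp
    obtain ⟨D, hD⟩ := hq
    refine ⟨C + D, fun n => ?_⟩
    rw [Polynomial.eval_add, Nat.cast_add, add_mul]
    exact add_le_add (hC n) (hD n)
  | monomial k a =>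
    obtain ⟨C, hC⟩ := (tendsto_pow_const_mul_const_pow_of_abs_lt_one k
      (by rwa [abs_of_nonneg h0])).bddAbove_range
    refine ⟨a * C, fun n => ?_⟩
    have := mul_le_mul_of_nonneg_left (hC (Set.mem_range_self n)) (Nat.cast_nonneg (α := ℝ) a)
    simpa [mul_assoc] using this

theorem exists_mul_pow_le (p : Polynomial ℕ) {x y : ℝ} (hx : 0 ≤ x) (hxy : x < y) :
    ∃ C : ℝ, ∀ n : ℕ, (p.eval n : ℕ) * x ^ n ≤ C * y ^ n := by
  have hy : 0 < y := hx.trans_lt hxy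
  obtain ⟨C, hC⟩ := exists_eval_mul_pow_le p (div_nonneg hx hy.le) ((div_lt_one hy).2 hxy)
  refine ⟨C, fun n => ?_⟩
  have := mul_le_mul_of_nonneg_right (hC n) (pow_nonneg hy.le n)
  rwa [mul_assoc, ← mul_pow, div_mul_cancel₀ _ hy.ne'] at this

end MaxHammingXSAT

theorem mainTheorem1 :
    (∀ F : MaxHammingXSAT.Formula,
      (MaxHammingXSAT.Q F).val = MaxHammingXSAT.maxHammingDistance F) ∧
    (∃ p : Polynomial ℕ, ∀ F : MaxHammingXSAT.Formula,
      (MaxHammingXSAT.Q F).peak ≤ p.eval (MaxHammingXSAT.inputSize F)) ∧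
    (∃ p : Polynomial ℕ, ∀ F : MaxHammingXSAT.Formula,
      ((MaxHammingXSAT.Q F).time : ℝ) ≤
        (p.eval (MaxHammingXSAT.inputSize F) : ℕ) * (1.8348 : ℝ) ^ MaxHammingXSAT.numVars F) ∧
    (∀ q : Polynomial ℕ, ∃ C : ℝ, ∀ F : MaxHammingXSAT.Formula,
      MaxHammingXSAT.inputSize F ≤ q.eval (MaxHammingXSAT.numVars F) →
        ((MaxHammingXSAT.Q F).time : ℝ) ≤ C * (1.8348 : ℝ) ^ MaxHammingXSAT.numVars F) := by
  have hz : 0 ≤ MaxHammingXSAT.zeta⁻¹ := zero_le_one.trans MaxHammingXSAT.one_le_inv_zeta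
  refine ⟨MaxHammingXSAT.Q_val, ⟨_, MaxHammingXSAT.Q_peak⟩, ⟨MaxHammingXSAT.bound, fun F => ?_⟩,
    fun q => ?_⟩
  · exact (MaxHammingXSAT.Q_time F).trans (mul_le_mul_of_nonneg_left
      (pow_le_pow_left₀ hz MaxHammingXSAT.inv_zeta_lt.le _) (Nat.cast_nonneg _))
  -- For inputs of size at most `q` of the number of variables, the polynomial factor is itself
  -- polynomial in that number, and the gap between ζ⁻¹ and 1.8348 absorbs it.
  · obtain ⟨C, hC⟩ := MaxHammingXSAT.exists_mul_pow_le (MaxHammingXSAT.bound.comp q) hz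
      MaxHammingXSAT.inv_zeta_lt
    refine ⟨C, fun F hF => (MaxHammingXSAT.Q_time F).trans (le_trans ?_ (hC _))⟩
    rw [Polynomial.eval_comp]
    exact mul_le_mul_of_nonneg_right (Nat.cast_le.2 (MaxHammingXSAT.eval_mono _ hF))
      (pow_nonneg hz _)
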